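/- Let $G$ be a compact Lie group of even dimension with Lie algebra $\mathfrak g$ (the bracket being that of left-invariant vector fields), and let $B$ be a bi-invariant metric, i.e. an $\mathrm{Ad}(G)$-invariant positive definite symmetric bilinear form on $\mathfrak g$, extended $\mathbb C$-bilinearly to $\mathfrak g^{\mathbb C}=\mathfrak g\otimes\mathbb C$. Let $\mathfrak h\subset\mathfrak g^{\mathbb C}$ be a Cartan subalgebra stable under complex conjugation, with root decomposition $\mathfrak g^{\mathbb C}=\mathfrak h\oplus\bigoplus_\alpha\mathfrak g_\alpha$, fix a system of positive roots, and let $I_{\mathfrak h}$ be a complex structure on the real vector space $\mathfrak h^{\mathbb R}=\mathfrak g\cap\mathfrak h$ with $B(I_{\mathfrak h}x,I_{\mathfrak h}y)=B(x,y)$. Let $\mathfrak h=\mathfrak h^{1,0}\oplus\mathfrak h^{0,1}$ be the decomposition into the $\pm\sqrt{-1}$-eigenspaces of $I_{\mathfrak h}$, and put $$\mathfrak g^{1,0}=\mathfrak h^{1,0}\oplus\bigoplus_{\alpha>0}\mathfrak g_\alpha,\qquad \mathfrak g^{0,1}=\mathfrak h^{0,1}\oplus\bigoplus_{\alpha<0}\mathfrak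 g_\alpha .$$ Let $\mathfrak d=\mathfrak g\oplus\overline{\mathfrak g}$ be the direct sum of two copies of the Lie algebra $\mathfrak g$, with the form $B_{\mathfrak d}=B\oplus(-B)$, and define subspaces of $\mathfrak d^{\mathbb C}$ by $$\mathcal L_\phi=\mathfrak g^{1,0}\oplus\mathfrak g^{1,0},\qquad \mathcal L_\psi=\mathfrak g^{1,0}\oplus\mathfrak g^{0,1}.$$ Let $\xi^L,\xi^R$ be the left- and right-invariant vector fields with value $\xi\in\mathfrak g$ at the identity, $\theta^L,\theta^R$ the left and right Maurer–Cartan forms, and $$s:\mathfrak d\to\Gamma(TG\oplus T^*G),\qquad s(\xi,\xi')=(\xi^L-\xi'^R)\oplus\big(B(\theta^L,\xi)+B(\theta^R,\xi')\big).$$ Let $H=\frac16B(\theta^L,[\theta^L,\theta^L])$ be the Cartan $3$-form, i.e. $H(\xi_1^L,\xi_2^L,\xi_3^L)=B([\xi_1,\xi_2],\xi_3)$. On $TG\oplus T^*G$ use the pairing $\langle v+\xi,u+\eta\rangle=\frac12(\xi(u)+\eta(v))$ and the $H$-twisted Courant bracket $$[u+\xi,v+\eta]_H=[u,v]+\mathcal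 L_u\eta-\mathcal L_v\xi-\tfrac12 d(i_u\eta-i_v\xi)-i_vi_uH .$$ Then: (1) Each of $\mathcal L_\phi$ and $\mathcal L_\psi$ is maximal isotropic in $\mathfrak d^{\mathbb C}$ for $B_{\mathfrak d}$, satisfies $\mathfrak d^{\mathbb C}=\mathcal L\oplus\overline{\mathcal L}$, and is closed under the bracket of $\mathfrak d^{\mathbb C}$. (2) There are unique fields $\mathcal J_\phi,\mathcal J_\psi$ of real endomorphisms of $TG\oplus T^*G$ whose $-\sqrt{-1}$-eigenspaces at every $g\in G$ are $s(\mathcal L_\phi)|_g$ and $s(\mathcal L_\psi)|_g$, respectively, and $(\mathcal J_\phi,\mathcal J_\psi)$ is an $H$-twisted generalized Kähler structure on $G$: $H$ is smooth and closed; $\mathcal J_\phi$ and $\mathcal J_\psi$ are smooth sections of $SO(TG\oplus T^*G)$ with square $-\mathrm{id}$ whose $-\sqrt{-1}$-eigenbundles are involutive for $[\,,\,]_H$; they commute; and $\langle -\mathcal J_\phi\mathcal J_\psi\,\cdot\,,\,\cdot\,\rangle$ is a positive definite symmetric form on $TG\oplus T^*G$. -/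

import Mathlib

open scoped Manifold ContDiff TensorProduct
open Bundle

noncomputable section

/-! ### Complexification of real vector spaces -/

section Complexification

variable {V : Type*} [AddCommGroup V] [Module ℝ V]

/-- The element `a + i b` of the complexification `ℂ ⊗ V`. -/
def mkC (a b : V) : ℂ ⊗[ℝ] V := 1 ⊗ₜ[ℝ] a + Complex.I ⊗ₜ[ℝ] b

/-- The real part `ℂ ⊗ V → V`. -/
def reC : ℂ ⊗[ℝ] V →ₗ[ℝ] V :=
  (TensorProduct.lid ℝ V).toLinearMap ∘ₗ Complex.reLm.rTensor V

/-- The imaginary part `ℂ ⊗ V → V`. -/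
def imC : ℂ ⊗[ℝ] V →ₗ[ℝ] V :=
  (TensorProduct.lid ℝ V).toLinearMap ∘ₗ Complex.imLm.rTensor V

theorem mkC_reC_imC (z : ℂ ⊗[ℝ] V) : mkC (reC z) (imC z) = z := by
  induction z using TensorProduct.induction_on with
  | zero => simp [mkC]
  | tmul c v =>
    have h : c = (c.re : ℝ) • (1 : ℂ) + (c.im : ℝ) • Complex.I := by
      apply Complex.ext <;> simp
    have h1 : reC (c ⊗ₜ[ℝ] v) = c.re • v := by simp [reC]
    have h2 : imC (c ⊗ₜ[ℝ] v) = c.im • v := by simp [imC]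
    rw [h1, h2, mkC]
    conv_rhs => rw [h, TensorProduct.add_tmul, TensorProduct.smul_tmul, TensorProduct.smul_tmul]
  | add x y hx hy =>
    have : mkC (reC (x + y)) (imC (x + y)) = mkC (reC x) (imC x) + mkC (reC y) (imC y) := by
      simp only [mkC, map_add, TensorProduct.tmul_add]; abel
    rw [this, hx, hy]

/-- Complex conjugation on `ℂ ⊗ V`, as a conjugate-linear map. -/
def conjC : ℂ ⊗[ℝ] V →ₛₗ[starRingEnd ℂ] ℂ ⊗[ℝ] V where
  toFun := Complex.conjAe.toLinearMap.rTensor V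
  map_add' := map_add _
  map_smul' c z := by
    induction z using TensorProduct.induction_on with
    | zero => simp
    | tmul d v => simp [TensorProduct.smul_tmul']
    | add x y hx hy => simp only [smul_add, map_add, hx, hy]

/-- A subspace is maximal isotropic for a bilinear form. -/
def IsMaximalIsotropic {W : Type*} [AddCommGroup W] [Module ℂ W] (B : LinearMap.BilinForm ℂ W)
    (L : Submodule ℂ W) : Prop :=
  Maximal (fun U : Submodule ℂ W => ∀ x ∈ U, ∀ y ∈ U, B x y = 0) L

end Complexification

/-! ### Generalized complex and generalized Kähler structures -/

section GeneralizedGeometry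

variable {E : Type*} [NormedAddCommGroup E] [NormedSpace ℝ E]
  {M : Type*} [TopologicalSpace M] [ChartedSpace E M]

variable (E) in
/-- The fibre `T_x M ⊕ T_x^* M`. -/
abbrev GenTangent (x : M) : Type _ :=
  TangentSpace 𝓘(ℝ, E) x × (TangentSpace 𝓘(ℝ, E) x →L[ℝ] ℝ)

/-- The pairing `⟨v + ξ, u + η⟩ = (ξ(u) + η(v)) / 2` on `T_x M ⊕ T_x^* M`. -/
def genPairing (x : M) : LinearMap.BilinForm ℝ (GenTangent E x) :=
  LinearMap.mk₂ ℝ (fun e f => (1 / 2 : ℝ) * (e.2 f.1 + f.2 e.1))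
    (fun e e' f => by simp; ring) (fun c e f => by simp; ring)
    (fun e f f' => by simp; ring) (fun c e f => by simp; ring)

variable (E) in
/-- Sections (not necessarily smooth) of `TM ⊕ T^*M`. -/
abbrev GenSection (M : Type*) [TopologicalSpace M] [ChartedSpace E M] : Type _ :=
  ∀ x : M, GenTangent E x

/-- Smoothness of a section of `TM ⊕ T^*M`: both components are smooth. -/
def IsSmoothGenSection [IsManifold 𝓘(ℝ, E) ∞ M] (e : GenSection E M) : Prop :=
  ContMDiff 𝓘(ℝ, E) 𝓘(ℝ, E).tangent ∞ (fun x => (⟨x, (e x).1⟩ : TangentBundle 𝓘(ℝ, E) M)) ∧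
  ContMDiff 𝓘(ℝ, E) (𝓘(ℝ, E).prod 𝓘(ℝ, E →L[ℝ] ℝ)) ∞
    (fun x => TotalSpace.mk' (E →L[ℝ] ℝ)
      (E := fun y : M => TangentSpace 𝓘(ℝ, E) y →L[ℝ] Trivial M ℝ y) x (e x).2)

/-- The Lie derivative `L_u η` of a one-form along a vector field at `x₀`: in the chart at `x₀` it
is `w ↦ (Dη · u)(w) + η(Du · w)`. -/
def lieDerivOneForm (u : ∀ x : M, TangentSpace 𝓘(ℝ, E) x)
    (η : ∀ x : M, TangentSpace 𝓘(ℝ, E) x →L[ℝ] ℝ) (x₀ : M) :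
    TangentSpace 𝓘(ℝ, E) x₀ →L[ℝ] ℝ :=
  let φ := extChartAt 𝓘(ℝ, E) x₀
  let u' : E → E := fun y => VectorField.mpullback 𝓘(ℝ, E) 𝓘(ℝ, E) φ.symm u y
  let η' : E → (E →L[ℝ] ℝ) := fun y =>
    (η (φ.symm y)).comp (mfderiv 𝓘(ℝ, E) 𝓘(ℝ, E) φ.symm y)
  (fderiv ℝ η' (φ x₀) (u' (φ x₀)) + (η' (φ x₀)).comp (fderiv ℝ u' (φ x₀))).comp
    (mfderiv 𝓘(ℝ, E) 𝓘(ℝ, E) φ x₀)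

/-- The differential of a real function, as a one-form. -/
def dFun (f : M → ℝ) (x : M) : TangentSpace 𝓘(ℝ, E) x →L[ℝ] ℝ :=
  mfderiv 𝓘(ℝ, E) 𝓘(ℝ, ℝ) f x

variable (E) in
/-- Three-forms (not necessarily smooth) on `M`. -/
abbrev ThreeForm (M : Type*) [TopologicalSpace M] [ChartedSpace E M] : Type _ :=
  ∀ x : M, TangentSpace 𝓘(ℝ, E) x [⋀^Fin 3]→L[ℝ] ℝ

/-- A three-form written in the chart at `x₀`. -/
def ThreeForm.inChart (H : ThreeForm E M) (x₀ : M) (y : E) : E [⋀^Fin 3]→L[ℝ] ℝ :=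
  (H ((extChartAt 𝓘(ℝ, E) x₀).symm y)).compContinuousLinearMap
    (mfderiv 𝓘(ℝ, E) 𝓘(ℝ, E) (extChartAt 𝓘(ℝ, E) x₀).symm y)

/-- A smooth closed three-form. -/
def ThreeForm.IsSmoothClosed (H : ThreeForm E M) : Prop :=
  ∀ x₀ : M, ContDiffOn ℝ ∞ (H.inChart x₀) (extChartAt 𝓘(ℝ, E) x₀).target ∧
    ∀ y ∈ (extChartAt 𝓘(ℝ, E) x₀).target, extDeriv (H.inChart x₀) y = 0

/-- The one-form `i_v i_u H = H(u, v, ·)`. -/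
def contractTwo (H : ThreeForm E M) (x : M) (u v : TangentSpace 𝓘(ℝ, E) x) :
    TangentSpace 𝓘(ℝ, E) x →L[ℝ] ℝ :=
  (H x).toContinuousMultilinearMap.toContinuousLinearMap ![u, v, 0] 2

/-- The `H`-twisted Courant bracket of sections of `TM ⊕ T^*M`,
`[u + ξ, v + η] = [u, v] + L_u η - L_v ξ - d(i_u η - i_v ξ) / 2 - i_v i_u H`. -/
def courant (H : ThreeForm E M) (e f : GenSection E M) : GenSection E M := fun x =>
  (VectorField.mlieBracket 𝓘(ℝ, E) (fun y => (e y).1) (fun y => (f y).1) x,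
    lieDerivOneForm (fun y => (e y).1) (fun y => (f y).2) x
      - lieDerivOneForm (fun y => (f y).1) (fun y => (e y).2) x
      - (1 / 2 : ℝ) • dFun (fun y => (f y).2 (e y).1 - (e y).2 (f y).1) x
      - contractTwo H x (e x).1 (f x).1)

variable (E) in
/-- Sections (not necessarily smooth) of `(TM ⊕ T^*M)^ℂ`. -/
abbrev GenSectionC (M : Type*) [TopologicalSpace M] [ChartedSpace E M] : Type _ :=
  ∀ x : M, ℂ ⊗[ℝ] GenTangent E x

/-- Smoothness of a complex section: real and imaginary parts are smooth. -/
def IsSmoothGenSectionC [IsManifold 𝓘(ℝ, E) ∞ M] (e : GenSectionC E M) : Prop :=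
  IsSmoothGenSection (fun x => reC (e x)) ∧ IsSmoothGenSection (fun x => imC (e x))

/-- The complex bilinear extension of the `H`-twisted Courant bracket. -/
def courantC (H : ThreeForm E M) (e f : GenSectionC E M) : GenSectionC E M := fun x =>
  mkC
    (courant H (fun y => reC (e y)) (fun y => reC (f y)) x
      - courant H (fun y => imC (e y)) (fun y => imC (f y)) x)
    (courant H (fun y => reC (e y)) (fun y => imC (f y)) x
      + courant H (fun y => imC (e y)) (fun y => reC (f y)) x)

variable (E) in
/-- Fields of endomorphisms (not necessarily smooth) of `TM ⊕ T^*M`. -/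
abbrev GenEndField (M : Type*) [TopologicalSpace M] [ChartedSpace E M] : Type _ :=
  ∀ x : M, Module.End ℝ (GenTangent E x)

/-- The `-i`-eigenspace of `J_x` in `(T_x M ⊕ T_x^* M)^ℂ`. -/
def negIEigenspace (J : GenEndField E M) (x : M) : Submodule ℂ (ℂ ⊗[ℝ] GenTangent E x) :=
  Module.End.eigenspace ((J x).baseChange ℂ) (-Complex.I)

/-- An almost generalized complex structure: a smooth section `J` of `SO(TM ⊕ T^*M)` with
`J ^ 2 = -1`. Smoothness of the endomorphism field `J` means that it preserves smooth sections. -/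
structure IsAlmostGeneralizedComplex [IsManifold 𝓘(ℝ, E) ∞ M] (J : GenEndField E M) : Prop where
  smooth : ∀ e : GenSection E M, IsSmoothGenSection e → IsSmoothGenSection fun x => J x (e x)
  orthogonal : ∀ (x : M) (e f : GenTangent E x),
    genPairing x (J x e) (J x f) = genPairing x e f
  det_eq_one : ∀ x : M, LinearMap.det (J x) = 1
  sq_eq_neg_one : ∀ (x : M) (e : GenTangent E x), J x (J x e) = -e

/-- An `H`-twisted generalized complex structure, for a smooth closed three-form `H`: the
`-i`-eigenbundle is involutive for the `H`-twisted Courant bracket. -/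
structure IsTwistedGeneralizedComplex [IsManifold 𝓘(ℝ, E) ∞ M] (H : ThreeForm E M)
    (J : GenEndField E M) : Prop extends IsAlmostGeneralizedComplex J where
  smooth_closed : H.IsSmoothClosed
  involutive : ∀ e f : GenSectionC E M, IsSmoothGenSectionC e → IsSmoothGenSectionC f →
    (∀ x, e x ∈ negIEigenspace J x) → (∀ x, f x ∈ negIEigenspace J x) →
    ∀ x, courantC H e f x ∈ negIEigenspace J x

/-- An `H`-twisted generalized Kähler structure: commuting `H`-twisted generalized complex
structures `J₁`, `J₂` such that `⟨-J₁ J₂ ·, ·⟩` is symmetric and positive definite. -/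
structure IsTwistedGeneralizedKahler [IsManifold 𝓘(ℝ, E) ∞ M] (H : ThreeForm E M)
    (J₁ J₂ : GenEndField E M) : Prop where
  left : IsTwistedGeneralizedComplex H J₁
  right : IsTwistedGeneralizedComplex H J₂
  comm : ∀ (x : M) (e : GenTangent E x), J₁ x (J₂ x e) = J₂ x (J₁ x e)
  symm : ∀ (x : M) (e f : GenTangent E x),
    genPairing x (-J₁ x (J₂ x e)) f = genPairing x (-J₁ x (J₂ x f)) e
  pos : ∀ (x : M) (e : GenTangent E x), e ≠ 0 → 0 < genPairing x (-J₁ x (J₂ x e)) e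

end GeneralizedGeometry

/-! ### Lie groups -/

section LieGroups

instance lieGroup_minSmoothness_three {E : Type*} [NormedAddCommGroup E] [NormedSpace ℝ E]
    {G : Type*} [TopologicalSpace G] [ChartedSpace E G] [Group G] [LieGroup 𝓘(ℝ, E) ∞ G] :
    LieGroup 𝓘(ℝ, E) (minSmoothness ℝ 3) G :=
  LieGroup.of_le (n := ∞) (by simpa using (inferInstance : ENat.LEInfty 3).out)

variable {E : Type*} [NormedAddCommGroup E] [NormedSpace ℝ E]
  {G : Type*} [TopologicalSpace G] [ChartedSpace E G] [Group G]

instance finiteDimensional_tangentSpace [FiniteDimensional ℝ E] (x : G) :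
    FiniteDimensional ℝ (TangentSpace 𝓘(ℝ, E) x) :=
  inferInstanceAs (FiniteDimensional ℝ E)

instance t2Space_tangentSpace (x : G) : T2Space (TangentSpace 𝓘(ℝ, E) x) :=
  inferInstanceAs (T2Space E)

variable (E G) in
/-- The Lie algebra `𝔤` of `G` (the bracket is that of left-invariant vector fields). -/
abbrev LieAlg : Type _ := GroupLieAlgebra 𝓘(ℝ, E) G

theorem continuous_bilin_comp_bilin {F : Type*} [NormedAddCommGroup F] [NormedSpace ℝ F]
    [FiniteDimensional ℝ F] (B : F →ₗ[ℝ] F →ₗ[ℝ] ℝ) (b : F →ₗ[ℝ] F →ₗ[ℝ] F) :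
    Continuous fun v : Fin 3 → F => B (v 0) (b (v 1) (v 2)) := by
  have hB : Continuous fun p : F × F => B p.1 p.2 :=
    (LinearMap.toContinuousBilinearMap B).continuous₂
  have hb : Continuous fun p : F × F => b p.1 p.2 :=
    (LinearMap.toContinuousBilinearMap b).continuous₂
  exact hB.comp ((continuous_apply (A := fun _ : Fin 3 => F) 0).prodMk
    (hb.comp ((continuous_apply (A := fun _ : Fin 3 => F) 1).prodMk (continuous_apply 2))))

/-- The left Maurer-Cartan form. -/
def thetaL (g : G) : TangentSpace 𝓘(ℝ, E) g →L[ℝ] LieAlg E G :=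
  mfderiv 𝓘(ℝ, E) 𝓘(ℝ, E) (fun h : G => g⁻¹ * h) g

/-- The right Maurer-Cartan form. -/
def thetaR (g : G) : TangentSpace 𝓘(ℝ, E) g →L[ℝ] LieAlg E G :=
  mfderiv 𝓘(ℝ, E) 𝓘(ℝ, E) (fun h : G => h * g⁻¹) g

/-- The value at `g` of the left-invariant vector field `ξ^L`, as a linear function of `ξ`. -/
def leftField (g : G) : LieAlg E G →L[ℝ] TangentSpace 𝓘(ℝ, E) g :=
  mfderiv 𝓘(ℝ, E) 𝓘(ℝ, E) (fun h : G => g * h) 1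

/-- The value at `g` of the right-invariant vector field `ξ^R`, as a linear function of `ξ`. -/
def rightField (g : G) : LieAlg E G →L[ℝ] TangentSpace 𝓘(ℝ, E) g :=
  mfderiv 𝓘(ℝ, E) 𝓘(ℝ, E) (fun h : G => h * g) 1

/-- The adjoint action of `G` on its Lie algebra. -/
def adjointAction (g : G) : LieAlg E G →L[ℝ] LieAlg E G :=
  mfderiv 𝓘(ℝ, E) 𝓘(ℝ, E) (fun h : G => g * h * g⁻¹) 1

/-- `B` is a bi-invariant metric: an `Ad`-invariant positive definite symmetric form on `𝔤`. -/
structure IsBiinvariantMetric (B : LinearMap.BilinForm ℝ (LieAlg E G)) : Prop where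
  symm : ∀ x y, B x y = B y x
  pos : ∀ x, x ≠ 0 → 0 < B x x
  invariant : ∀ (g : G) (x y), B (adjointAction g x) (adjointAction g y) = B x y

variable [FiniteDimensional ℝ E]

/-- The map `𝔡 = 𝔤 ⊕ 𝔤 → T_g G ⊕ T_g^* G`,
`s(ξ, ξ') = (ξ^L - ξ'^R) ⊕ (B(θ^L, ξ) + B(θ^R, ξ'))`. -/
def sMap (B : LinearMap.BilinForm ℝ (LieAlg E G)) (g : G) :
    LieAlg E G × LieAlg E G →ₗ[ℝ] GenTangent E g where
  toFun ζ := (leftField g ζ.1 - rightField g ζ.2,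
    (LinearMap.toContinuousLinearMap (B.flip ζ.1)).comp (thetaL g)
      + (LinearMap.toContinuousLinearMap (B.flip ζ.2)).comp (thetaR g))
  map_add' ζ ζ' := by
    ext v
    · simp; abel
    · simp; abel
  map_smul' c ζ := by
    ext v
    · simp [smul_sub]
    · simp

/-- The form `B_𝔡 = B ⊕ (-B)` on `𝔡 = 𝔤 ⊕ 𝔤`. -/
def doubleForm {V : Type*} [AddCommGroup V] [Module ℝ V] (B : LinearMap.BilinForm ℝ V) :
    LinearMap.BilinForm ℝ (V × V) :=
  B.compl₁₂ (LinearMap.fst ℝ V V) (LinearMap.fst ℝ V V)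
    - B.compl₁₂ (LinearMap.snd ℝ V V) (LinearMap.snd ℝ V V)

variable [CompleteSpace E] [LieGroup 𝓘(ℝ, E) ∞ G]

/-- The bracket of `𝔤`, as a bilinear map. -/
def bracketMap : LieAlg E G →ₗ[ℝ] LieAlg E G →ₗ[ℝ] LieAlg E G :=
  LinearMap.mk₂ ℝ (fun x y => ⁅x, y⁆) add_lie smul_lie lie_add (fun c x y => lie_smul c x y)

/-- The trilinear form `(x, y, z) ↦ B(x, [y, z])` on `𝔤`. -/
def trilinearBracketForm (B : LinearMap.BilinForm ℝ (LieAlg E G)) :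
    ContinuousMultilinearMap ℝ (fun _ : Fin 3 => LieAlg E G) ℝ where
  toFun v := B (v 0) ⁅v 1, v 2⁆
  map_update_add' v i x y := by
    rename_i inst
    obtain rfl := Subsingleton.elim inst (instDecidableEqFin 3)
    fin_cases i <;> simp [Function.update]
  map_update_smul' v i c x := by
    rename_i inst
    obtain rfl := Subsingleton.elim inst (instDecidableEqFin 3)
    fin_cases i <;> simp [Function.update]
  cont := continuous_bilin_comp_bilin (F := E) B bracketMap

/-- The Cartan three-form `H = B(θ^L, [θ^L, θ^L]) / 6` on `G`, where `B(θ^L, [θ^L, θ^L])` is the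
wedge product of `𝔤`-valued forms, i.e. the sum over all permutations of the arguments, with signs,
of `B(θ^L(u), [θ^L(v), θ^L(w)])`. -/
def cartanThreeForm (B : LinearMap.BilinForm ℝ (LieAlg E G)) : ThreeForm E G := fun g =>
  (1 / 6 : ℝ) • (ContinuousMultilinearMap.alternatization
    (trilinearBracketForm B)).compContinuousLinearMap (thetaL g)

end LieGroups

/-! ### Root data -/

section Roots

/-- A positive system: a set `P` of roots of `𝔥` such that exactly one of `α`, `-α` lies in `P` for
every root `α`, and such that every root which is a sum of two elements of `P` lies in `P`. -/
structure IsPositiveSystem {L : Type*} [LieRing L] [LieAlgebra ℂ L] (h : LieSubalgebra ℂ L)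
    [LieRing.IsNilpotent h] (P : Set (h → ℂ)) : Prop where
  isRoot : ∀ α ∈ P, α ≠ 0 ∧ LieAlgebra.rootSpace h α ≠ ⊥
  mem_or_neg_mem : ∀ α : h → ℂ, α ≠ 0 → LieAlgebra.rootSpace h α ≠ ⊥ → α ∈ P ∨ -α ∈ P
  neg_notMem : ∀ α ∈ P, -α ∉ P
  add_mem : ∀ α ∈ P, ∀ β ∈ P, α + β ≠ 0 → LieAlgebra.rootSpace h (α + β) ≠ ⊥ → α + β ∈ P

variable {V : Type*} [LieRing V] [LieAlgebra ℝ V]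

/-- The real part `𝔥^ℝ = 𝔤 ∩ 𝔥` of a subalgebra `𝔥` of `𝔤^ℂ`. -/
def realSubspace (h : LieSubalgebra ℂ (ℂ ⊗[ℝ] V)) : Submodule ℝ V :=
  (h.toSubmodule.restrictScalars ℝ).comap (TensorProduct.mk ℝ ℂ V 1)

/-- `𝔥^{1,0}`: the `i`-eigenspace of the complexification of `I_𝔥`, inside `𝔤^ℂ`. -/
def h10 (h : LieSubalgebra ℂ (ℂ ⊗[ℝ] V)) (J : Module.End ℝ (realSubspace h)) :
    Submodule ℂ (ℂ ⊗[ℝ] V) :=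
  (Module.End.eigenspace (J.baseChange ℂ) Complex.I).map ((realSubspace h).subtype.baseChange ℂ)

/-- `𝔥^{0,1}`: the `-i`-eigenspace of the complexification of `I_𝔥`, inside `𝔤^ℂ`. -/
def h01 (h : LieSubalgebra ℂ (ℂ ⊗[ℝ] V)) (J : Module.End ℝ (realSubspace h)) :
    Submodule ℂ (ℂ ⊗[ℝ] V) :=
  (Module.End.eigenspace (J.baseChange ℂ) (-Complex.I)).map ((realSubspace h).subtype.baseChange ℂ)

/-- `𝔤^{1,0} = 𝔥^{1,0} ⊕ ⨁_{α > 0} 𝔤_α`. -/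
def g10 (h : LieSubalgebra ℂ (ℂ ⊗[ℝ] V)) [LieRing.IsNilpotent h] (P : Set (h → ℂ))
    (J : Module.End ℝ (realSubspace h)) : Submodule ℂ (ℂ ⊗[ℝ] V) :=
  h10 h J ⊔ ⨆ α ∈ P, (LieAlgebra.rootSpace h α).toSubmodule

/-- `𝔤^{0,1} = 𝔥^{0,1} ⊕ ⨁_{α < 0} 𝔤_α`. -/
def g01 (h : LieSubalgebra ℂ (ℂ ⊗[ℝ] V)) [LieRing.IsNilpotent h] (P : Set (h → ℂ))
    (J : Module.End ℝ (realSubspace h)) : Submodule ℂ (ℂ ⊗[ℝ] V) :=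
  h01 h J ⊔ ⨆ α ∈ P, (LieAlgebra.rootSpace h (-α)).toSubmodule

/-- The subspace `A ⊕ A'` of `𝔡^ℂ = ℂ ⊗ (𝔤 ⊕ 𝔤)`, for subspaces `A`, `A'` of `𝔤^ℂ`. -/
def directSumC (A A' : Submodule ℂ (ℂ ⊗[ℝ] V)) : Submodule ℂ (ℂ ⊗[ℝ] (V × V)) :=
  A.comap ((LinearMap.fst ℝ V V).baseChange ℂ) ⊓ A'.comap ((LinearMap.snd ℝ V V).baseChange ℂ)

/-- `L_φ = 𝔤^{1,0} ⊕ 𝔤^{1,0}`. -/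
def Lphi (h : LieSubalgebra ℂ (ℂ ⊗[ℝ] V)) [LieRing.IsNilpotent h] (P : Set (h → ℂ))
    (J : Module.End ℝ (realSubspace h)) : Submodule ℂ (ℂ ⊗[ℝ] (V × V)) :=
  directSumC (g10 h P J) (g10 h P J)

/-- `L_ψ = 𝔤^{1,0} ⊕ 𝔤^{0,1}`. -/
def Lpsi (h : LieSubalgebra ℂ (ℂ ⊗[ℝ] V)) [LieRing.IsNilpotent h] (P : Set (h → ℂ))
    (J : Module.End ℝ (realSubspace h)) : Submodule ℂ (ℂ ⊗[ℝ] (V × V)) :=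
  directSumC (g10 h P J) (g01 h P J)

/-- `L` is maximal isotropic in `𝔡^ℂ` for `B_𝔡`, satisfies `𝔡^ℂ = L ⊕ conj L`, and is closed under
the bracket of `𝔡^ℂ`. -/
structure IsIsotropicSplittingSubalgebra (B : LinearMap.BilinForm ℝ V)
    (L : Submodule ℂ (ℂ ⊗[ℝ] (V × V))) : Prop where
  maximalIsotropic : IsMaximalIsotropic ((doubleForm B).baseChange ℂ) L
  isCompl_conj : IsCompl L (L.map conjC)
  lie_mem : ∀ x ∈ L, ∀ y ∈ L, ⁅x, y⁆ ∈ L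

end Roots

/-- The endomorphism field `J` on `G` is induced by the subspace `L` of `𝔡^ℂ`: its `-i`-eigenspace
at every point `g` is the image of `L` under the complexification of `s` at `g`. -/
def IsInducedBy {E : Type*} [NormedAddCommGroup E] [NormedSpace ℝ E] [FiniteDimensional ℝ E]
    {G : Type*} [TopologicalSpace G] [ChartedSpace E G] [Group G]
    (B : LinearMap.BilinForm ℝ (LieAlg E G)) (L : Submodule ℂ (ℂ ⊗[ℝ] (LieAlg E G × LieAlg E G)))
    (J : GenEndField E G) : Prop :=
  ∀ g : G, negIEigenspace J g = L.map ((sMap B g).baseChange ℂ)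

end

/-!
Conjugation exchanges the positive and the negative roots, so `𝔤^{0,1}` is the conjugate of
`𝔤^{1,0}`; both are isotropic subalgebras. Hence `𝔤^{0,1}` and `𝔤^{1,0}` are the `-i`-eigenspaces of
`I` and `-I`, for a `B`-orthogonal complex structure `I` on the real vector space `𝔤` that is
integrable, and `L_φ`, `L_ψ` are those of `(-I) ⊕ (-I)` and `(-I) ⊕ I` on `𝔡`, which have the same
properties with respect to `B_𝔡`.

At every point `s` is an isometry of `𝔡` with `TG ⊕ T^*G`, so it transports endomorphisms of `𝔡` to
fields of endomorphisms of `TG ⊕ T^*G`. Let `ρ` be the vector field component of `s`. The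
Maurer-Cartan equation gives, for functions `a` and `b` on `G` with values in `𝔡`,
`[s(a), s(b)]_H = s(D_{ρ(a)} b - D_{ρ(b)} a + [a, b]) + B_𝔡(da, b) - B_𝔡(a, db)`.
If `a` and `b` take values in an isotropic subalgebra, the one-form vanishes and the argument of `s`
stays in the subalgebra, which is involutivity. In the Kähler condition, `-J_φ J_ψ` corresponds to
`1 ⊕ (-1)`, which turns `B ⊕ (-B)` into the positive definite form `B ⊕ B`. Finally `dH = 0` is the
Jacobi identity, again by the Maurer-Cartan equation.
-/

noncomputable section

section ComplexificationLemmas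

variable {V W : Type*} [AddCommGroup V] [Module ℝ V] [AddCommGroup W] [Module ℝ W]

@[simp] theorem reC_mkC (a b : V) : reC (mkC a b) = a := by simp [reC, mkC]

@[simp] theorem imC_mkC (a b : V) : imC (mkC a b) = b := by simp [imC, mkC]

theorem exists_mkC_eq (z : ℂ ⊗[ℝ] V) : ∃ a b, mkC a b = z := ⟨_, _, mkC_reC_imC z⟩

theorem mkC_inj {a b c d : V} : mkC a b = mkC c d ↔ a = c ∧ b = d :=
  ⟨fun h => ⟨by simpa using congrArg reC h, by simpa using congrArg imC h⟩,
    fun ⟨hac, hbd⟩ => by rw [hac, hbd]⟩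

theorem mkC_add_mkC (a b c d : V) : mkC a b + mkC c d = mkC (a + c) (b + d) := by
  simp only [mkC, TensorProduct.tmul_add]; abel

theorem mkC_eq_zero {a b : V} : mkC a b = 0 ↔ a = 0 ∧ b = 0 := by
  rw [← mkC_inj, show mkC (0 : V) 0 = 0 by simp [mkC]]

theorem I_smul_mkC (a b : V) : Complex.I • mkC a b = mkC (-b) a := by
  simp only [mkC, smul_add, TensorProduct.smul_tmul', smul_eq_mul, mul_one, Complex.I_mul_I,
    TensorProduct.neg_tmul, TensorProduct.tmul_neg]
  abel

theorem neg_mkC (a b : V) : -mkC a b = mkC (-a) (-b) := by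
  simp only [mkC, TensorProduct.tmul_neg]; abel

theorem neg_I_smul_mkC (a b : V) : (-Complex.I) • mkC a b = mkC b (-a) := by
  rw [neg_smul, I_smul_mkC, neg_mkC, neg_neg]

theorem mkC_eq_add_I_smul (a b : V) : mkC a b = mkC a 0 + Complex.I • mkC b 0 := by
  rw [I_smul_mkC, mkC_add_mkC, neg_zero, add_zero, zero_add]

@[simp] theorem conjC_mkC (a b : V) : conjC (mkC a b) = mkC a (-b) := by
  have conjC_tmul (c : ℂ) (v : V) : conjC (c ⊗ₜ[ℝ] v) = (starRingEnd ℂ c) ⊗ₜ[ℝ] v := by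
    change Complex.conjAe.toLinearMap.rTensor V (c ⊗ₜ[ℝ] v) = _
    simp
  simp [mkC, conjC_tmul, TensorProduct.neg_tmul, TensorProduct.tmul_neg]

@[simp] theorem reC_conjC (z : ℂ ⊗[ℝ] V) : reC (conjC z) = reC z := by
  obtain ⟨a, b, rfl⟩ := exists_mkC_eq z
  simp

@[simp] theorem conjC_conjC (z : ℂ ⊗[ℝ] V) : conjC (conjC z) = z := by
  obtain ⟨a, b, rfl⟩ := exists_mkC_eq z
  simp

theorem conjC_eq_zero {z : ℂ ⊗[ℝ] V} : conjC z = 0 ↔ z = 0 :=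
  ⟨fun h => by rw [← conjC_conjC z, h, map_zero], fun h => by rw [h, map_zero]⟩

theorem mem_map_conjC {L : Submodule ℂ (ℂ ⊗[ℝ] V)} {z : ℂ ⊗[ℝ] V} :
    z ∈ L.map conjC ↔ conjC z ∈ L :=
  ⟨fun ⟨w, hw, hwz⟩ => by rwa [← hwz, conjC_conjC], fun h => ⟨_, h, conjC_conjC z⟩⟩

theorem two_smul_mkC_reC (z : ℂ ⊗[ℝ] V) : (2 : ℂ) • mkC (reC z) 0 = z + conjC z := by
  obtain ⟨a, b, rfl⟩ := exists_mkC_eq z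
  rw [reC_mkC, conjC_mkC, mkC_add_mkC, two_smul, mkC_add_mkC, add_neg_cancel, add_zero]

theorem reC_neg_I_smul (z : ℂ ⊗[ℝ] V) : reC ((-Complex.I) • z) = imC z := by
  obtain ⟨a, b, rfl⟩ := exists_mkC_eq z
  rw [neg_I_smul_mkC, reC_mkC, imC_mkC]

@[simp] theorem baseChange_mkC (f : V →ₗ[ℝ] W) (a b : V) :
    f.baseChange ℂ (mkC a b) = mkC (f a) (f b) := by
  simp [mkC]

theorem baseChange_conjC (f : V →ₗ[ℝ] W) (z : ℂ ⊗[ℝ] V) :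
    f.baseChange ℂ (conjC z) = conjC (f.baseChange ℂ z) := by
  obtain ⟨a, b, rfl⟩ := exists_mkC_eq z
  simp

theorem map_conjC_map_baseChange (f : V →ₗ[ℝ] W) (L : Submodule ℂ (ℂ ⊗[ℝ] V)) :
    (L.map (f.baseChange ℂ)).map conjC = (L.map conjC).map (f.baseChange ℂ) := by
  ext z
  simp only [Submodule.mem_map, exists_exists_and_eq_and, baseChange_conjC]

theorem map_conjC_eigenspace_baseChange (T : Module.End ℝ V) (μ : ℂ) :
    (Module.End.eigenspace (T.baseChange ℂ) μ).map conjC =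
      Module.End.eigenspace (T.baseChange ℂ) (starRingEnd ℂ μ) := by
  ext z
  rw [mem_map_conjC, Module.End.mem_eigenspace_iff, Module.End.mem_eigenspace_iff,
    baseChange_conjC, ← sub_eq_zero, ← conjC_eq_zero, map_sub, conjC_conjC,
    LinearMap.map_smulₛₗ, conjC_conjC, sub_eq_zero]

theorem bilinBaseChange_mkC (B : LinearMap.BilinForm ℝ V) (a b c d : V) :
    B.baseChange ℂ (mkC a b) (mkC c d) =
      ((B a c - B b d : ℝ) : ℂ) + ((B a d + B b c : ℝ) : ℂ) * Complex.I := by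
  simp only [mkC, map_add, LinearMap.add_apply, LinearMap.BilinForm.baseChange_tmul, one_mul,
    mul_one, Complex.I_mul_I, Complex.real_smul]
  push_cast
  ring

theorem bilinBaseChange_mkC_eq_zero_iff {B : LinearMap.BilinForm ℝ V} {a b c d : V} :
    B.baseChange ℂ (mkC a b) (mkC c d) = 0 ↔ B a c = B b d ∧ B a d = -B b c := by
  rw [bilinBaseChange_mkC, Complex.ext_iff]
  simp [sub_eq_zero, add_eq_zero_iff_eq_neg]

theorem bilinBaseChange_baseChange (B : LinearMap.BilinForm ℝ W) (f : V →ₗ[ℝ] W)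
    (z w : ℂ ⊗[ℝ] V) :
    B.baseChange ℂ (f.baseChange ℂ z) (f.baseChange ℂ w) =
      LinearMap.BilinForm.baseChange ℂ (B.compl₁₂ f f) z w := by
  obtain ⟨a, b, rfl⟩ := exists_mkC_eq z
  obtain ⟨c, d, rfl⟩ := exists_mkC_eq w
  simp only [baseChange_mkC, bilinBaseChange_mkC, LinearMap.compl₁₂_apply]

theorem separatingLeft_baseChange {B : LinearMap.BilinForm ℝ V} (hB : B.SeparatingLeft) :
    (B.baseChange ℂ).SeparatingLeft := by
  intro z hz
  obtain ⟨a, b, rfl⟩ := exists_mkC_eq z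
  have h (x : V) : B a x = 0 ∧ B b x = 0 := by
    simpa [eq_comm] using bilinBaseChange_mkC_eq_zero_iff.1 (hz (mkC x 0))
  exact mkC_eq_zero.2 ⟨hB a fun x => (h x).1, hB b fun x => (h x).2⟩

theorem lie_mkC {V : Type*} [LieRing V] [LieAlgebra ℝ V] (a b c d : V) :
    ⁅mkC a b, mkC c d⁆ = mkC (⁅a, c⁆ - ⁅b, d⁆) (⁅a, d⁆ + ⁅b, c⁆) := by
  simp only [mkC, add_lie, lie_add, LieAlgebra.ExtendScalars.bracket_tmul, mul_one, one_mul,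
    Complex.I_mul_I, TensorProduct.tmul_sub, TensorProduct.tmul_add, TensorProduct.neg_tmul]
  abel

theorem conjC_lie {V : Type*} [LieRing V] [LieAlgebra ℝ V] (z w : ℂ ⊗[ℝ] V) :
    conjC ⁅z, w⁆ = ⁅conjC z, conjC w⁆ := by
  obtain ⟨a, b, rfl⟩ := exists_mkC_eq z
  obtain ⟨c, d, rfl⟩ := exists_mkC_eq w
  simp only [lie_mkC, conjC_mkC, neg_lie, lie_neg, neg_neg, neg_add]

end ComplexificationLemmas

/-! ### Root decompositions and integrable isometries -/

section InnerProducts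

/-- Real inner products, as bilinear forms: symmetric and positive definite. -/
structure IsInnerProduct {V : Type*} [AddCommGroup V] [Module ℝ V]
    (B : LinearMap.BilinForm ℝ V) : Prop where
  symm : ∀ x y, B x y = B y x
  pos : ∀ x, x ≠ 0 → 0 < B x x

/-- Inner products on a Lie algebra `V` for which every `ad x` is skew. -/
structure IsInvariantInnerProduct {V : Type*} [LieRing V] [LieAlgebra ℝ V]
    (B : LinearMap.BilinForm ℝ V) : Prop extends IsInnerProduct B where
  lie_left : ∀ x y z : V, B ⁅x, y⁆ z = -B y ⁅x, z⁆

namespace IsInnerProduct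

variable {V : Type*} [AddCommGroup V] [Module ℝ V] {B : LinearMap.BilinForm ℝ V}

theorem nonneg (hB : IsInnerProduct B) (x : V) : 0 ≤ B x x := by
  rcases eq_or_ne x 0 with rfl | hx
  · simp
  · exact (hB.pos x hx).le

theorem eq_zero_of_self_eq_zero (hB : IsInnerProduct B) {x : V} (hx : B x x = 0) : x = 0 :=
  by_contra fun hne => (hB.pos x hne).ne' hx

theorem separatingLeft_doubleForm (hB : IsInnerProduct B) : (doubleForm B).SeparatingLeft :=
  fun x hx => Prod.ext
    (hB.eq_zero_of_self_eq_zero (by simpa [doubleForm] using hx (x.1, 0)))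
    (hB.eq_zero_of_self_eq_zero (by simpa [doubleForm] using hx (0, x.2)))

theorem eq_zero_of_baseChange_conjC_self (hB : IsInnerProduct B) {z : ℂ ⊗[ℝ] V}
    (hz : B.baseChange ℂ z (conjC z) = 0) : z = 0 := by
  obtain ⟨a, b, rfl⟩ := exists_mkC_eq z
  have hab : B a a + B b b = 0 := by
    rw [conjC_mkC, bilinBaseChange_mkC_eq_zero_iff, map_neg, eq_neg_iff_add_eq_zero] at hz
    exact hz.1
  rw [add_eq_zero_iff_of_nonneg (hB.nonneg a) (hB.nonneg b)] at hab
  exact mkC_eq_zero.2 (hab.imp hB.eq_zero_of_self_eq_zero hB.eq_zero_of_self_eq_zero)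

end IsInnerProduct

section Skew

variable {V : Type*} [AddCommGroup V] [Module ℝ V] {B : LinearMap.BilinForm ℝ V}
  {T : Module.End ℝ V}

theorem bilinBaseChange_skew (hT : ∀ x y, B (T x) y = -B x (T y)) (z w : ℂ ⊗[ℝ] V) :
    B.baseChange ℂ (T.baseChange ℂ z) w = -B.baseChange ℂ z (T.baseChange ℂ w) := by
  obtain ⟨a, b, rfl⟩ := exists_mkC_eq z
  obtain ⟨c, d, rfl⟩ := exists_mkC_eq w
  simp only [baseChange_mkC, bilinBaseChange_mkC, hT]
  push_cast
  ring

theorem conj_eigenvalue_eq_neg_of_skew (hB : IsInnerProduct B)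
    (hT : ∀ x y, B (T x) y = -B x (T y)) {μ : ℂ} {u : ℂ ⊗[ℝ] V} (hu : u ≠ 0)
    (hTu : T.baseChange ℂ u = μ • u) : starRingEnd ℂ μ = -μ := by
  have h := bilinBaseChange_skew hT u (conjC u)
  rw [baseChange_conjC, hTu, LinearMap.map_smulₛₗ conjC, map_smul, map_smul, LinearMap.smul_apply,
    smul_eq_mul, smul_eq_mul, ← neg_mul] at h
  exact neg_eq_iff_eq_neg.1 (mul_right_cancel₀ (mt hB.eq_zero_of_baseChange_conjC_self hu) h).symm

theorem maxGenEigenspace_le_eigenspace_of_skew (hB : IsInnerProduct B)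
    (hT : ∀ x y, B (T x) y = -B x (T y)) (μ : ℂ) :
    Module.End.maxGenEigenspace (T.baseChange ℂ) μ ≤
      Module.End.eigenspace (T.baseChange ℂ) μ := by
  intro v hv
  obtain ⟨k, hk⟩ := Module.End.mem_maxGenEigenspace _ _ _ |>.1 hv
  rw [Module.End.mem_eigenspace_iff]
  induction k generalizing v with
  | zero => simp_all
  | succ k ih =>
    set u := T.baseChange ℂ v - μ • v with hu
    rw [pow_succ, Module.End.mul_apply,
      show (T.baseChange ℂ - μ • 1) v = u by simp [hu]] at hk
    have hTu : T.baseChange ℂ u = μ • u :=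
      ih (Module.End.mem_maxGenEigenspace _ _ _ |>.2 ⟨k, hk⟩) hk
    rw [← sub_eq_zero, ← hu]
    by_contra hu0
    refine hu0 (hB.eq_zero_of_baseChange_conjC_self ?_)
    calc B.baseChange ℂ u (conjC u)
        = -B.baseChange ℂ v (T.baseChange ℂ (conjC u)) - μ • B.baseChange ℂ v (conjC u) := by
          conv_lhs => rw [hu]
          rw [map_sub, LinearMap.sub_apply, bilinBaseChange_skew hT, map_smul,
            LinearMap.smul_apply]
      _ = 0 := by
          rw [baseChange_conjC, hTu, LinearMap.map_smulₛₗ conjC,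
            conj_eigenvalue_eq_neg_of_skew hB hT hu0 hTu]
          simp

end Skew

end InnerProducts

section RootSpaces

variable {V : Type*} [LieRing V] [LieAlgebra ℝ V] {h : LieSubalgebra ℂ (ℂ ⊗[ℝ] V)}

theorem mem_realSubspace {a : V} : a ∈ realSubspace h ↔ mkC a 0 ∈ h := by
  simp [realSubspace, mkC]

theorem reC_mem_realSubspace (hconj : ∀ z ∈ h, conjC z ∈ h) {z : ℂ ⊗[ℝ] V} (hz : z ∈ h) :
    reC z ∈ realSubspace h := by
  have hmem := h.smul_mem (2⁻¹ : ℂ) (h.add_mem hz (hconj z hz))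
  rwa [← two_smul_mkC_reC, inv_smul_smul₀ two_ne_zero, ← mem_realSubspace] at hmem

theorem imC_mem_realSubspace (hconj : ∀ z ∈ h, conjC z ∈ h) {z : ℂ ⊗[ℝ] V} (hz : z ∈ h) :
    imC z ∈ realSubspace h :=
  reC_neg_I_smul z ▸ reC_mem_realSubspace hconj (h.smul_mem _ hz)

theorem map_top_baseChange_subtype_realSubspace (hconj : ∀ z ∈ h, conjC z ∈ h) :
    (⊤ : Submodule ℂ (ℂ ⊗[ℝ] realSubspace h)).map ((realSubspace h).subtype.baseChange ℂ) =
      h.toSubmodule := by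
  refine le_antisymm ?_ fun z hz => ?_
  · rintro _ ⟨w, -, rfl⟩
    obtain ⟨a, b, rfl⟩ := exists_mkC_eq w
    rw [baseChange_mkC, mkC_eq_add_I_smul]
    exact h.add_mem (mem_realSubspace.1 a.2) (h.smul_mem _ (mem_realSubspace.1 b.2))
  · exact ⟨mkC ⟨reC z, reC_mem_realSubspace hconj hz⟩ ⟨imC z, imC_mem_realSubspace hconj hz⟩,
      trivial, by simp [mkC_reC_imC]⟩

theorem lie_mkC_zero (a : V) (v : ℂ ⊗[ℝ] V) :
    ⁅mkC a 0, v⁆ = (LieAlgebra.ad ℝ V a).baseChange ℂ v := by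
  obtain ⟨c, d, rfl⟩ := exists_mkC_eq v
  simp [lie_mkC]

variable {B : LinearMap.BilinForm ℝ V} (hB : IsInvariantInnerProduct B)

include hB

theorem bilinBaseChange_lie_left (x y z : ℂ ⊗[ℝ] V) :
    B.baseChange ℂ ⁅x, y⁆ z = -B.baseChange ℂ y ⁅x, z⁆ := by
  obtain ⟨a, b, rfl⟩ := exists_mkC_eq x
  obtain ⟨c, d, rfl⟩ := exists_mkC_eq y
  obtain ⟨e, f, rfl⟩ := exists_mkC_eq z
  simp only [lie_mkC, bilinBaseChange_mkC, map_add, map_sub, LinearMap.add_apply,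
    LinearMap.sub_apply, hB.lie_left]
  push_cast
  ring

variable [LieRing.IsNilpotent h] {α β : h → ℂ} {v w : ℂ ⊗[ℝ] V}

theorem lie_mkC_zero_of_mem_rootSpace (hv : v ∈ LieAlgebra.rootSpace h α) {a : V}
    (ha : mkC a 0 ∈ h) : ⁅mkC a 0, v⁆ = α ⟨mkC a 0, ha⟩ • v := by
  have had : (LieAlgebra.ad ℝ V a).baseChange ℂ =
      LieModule.toEnd ℂ h (ℂ ⊗[ℝ] V) ⟨mkC a 0, ha⟩ :=
    LinearMap.ext fun z => (lie_mkC_zero a z).symm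
  rw [lie_mkC_zero, ← Module.End.mem_eigenspace_iff]
  refine maxGenEigenspace_le_eigenspace_of_skew hB.toIsInnerProduct (hB.lie_left a) _ ?_
  rw [Module.End.mem_maxGenEigenspace, had]
  exact (LieModule.mem_genWeightSpace _ _ _).1 hv _

variable (hconj : ∀ z ∈ h, conjC z ∈ h)

include hconj

variable [FiniteDimensional ℝ V]

theorem lie_of_mem_rootSpace (hv : v ∈ LieAlgebra.rootSpace h α) (x : h) :
    ⁅(x : ℂ ⊗[ℝ] V), v⁆ = α x • v := by
  rcases eq_or_ne v 0 with rfl | hv0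
  · rw [lie_zero (L := ℂ ⊗[ℝ] V), smul_zero]
  have hα : LieModule.genWeightSpace (ℂ ⊗[ℝ] V) α ≠ ⊥ := fun hbot =>
    hv0 ((LieSubmodule.mem_bot (R := ℂ) (L := h) v).1 (hbot ▸ hv))
  have hre := mem_realSubspace.1 (reC_mem_realSubspace hconj x.2)
  have him := mem_realSubspace.1 (imC_mem_realSubspace hconj x.2)
  have hx : x = ⟨_, hre⟩ + Complex.I • (⟨_, him⟩ : h) :=
    Subtype.ext ((mkC_reC_imC _).symm.trans (mkC_eq_add_I_smul _ _))
  conv_rhs => rw [hx]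
  rw [LieModule.LinearWeights.map_add α hα, LieModule.LinearWeights.map_smul α hα, add_smul,
    smul_assoc, ← lie_mkC_zero_of_mem_rootSpace hB hv, ← lie_mkC_zero_of_mem_rootSpace hB hv,
    ← smul_lie (L := ℂ ⊗[ℝ] V), ← add_lie (L := ℂ ⊗[ℝ] V), ← mkC_eq_add_I_smul,
    mkC_reC_imC]

theorem conj_root_conjC (hv : v ∈ LieAlgebra.rootSpace h α) (hv0 : v ≠ 0) (x : h) :
    starRingEnd ℂ (α ⟨conjC x, hconj x x.2⟩) = -α x := by
  have key := bilinBaseChange_lie_left hB (x : ℂ ⊗[ℝ] V) v (conjC v)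
  have hlie : ⁅(x : ℂ ⊗[ℝ] V), conjC v⁆ =
      starRingEnd ℂ (α ⟨conjC x, hconj x x.2⟩) • conjC v := by
    rw [← LinearMap.map_smulₛₗ, ← lie_of_mem_rootSpace hB hconj hv, conjC_lie, conjC_conjC]
  rw [lie_of_mem_rootSpace hB hconj hv, hlie, map_smul, map_smul, LinearMap.smul_apply,
    smul_eq_mul, smul_eq_mul, ← neg_mul] at key
  exact (neg_eq_iff_eq_neg.2
    (mul_right_cancel₀ (mt hB.eq_zero_of_baseChange_conjC_self hv0) key)).symm

theorem conjC_mem_rootSpace_neg (hv : v ∈ LieAlgebra.rootSpace h α) :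
    conjC v ∈ LieAlgebra.rootSpace h (-α) := by
  rcases eq_or_ne v 0 with rfl | hv0
  · simp
  refine LieModule.weightSpace_le_genWeightSpace _ _ ((LieModule.mem_weightSpace _ _).2 fun x => ?_)
  change ⁅(x : ℂ ⊗[ℝ] V), conjC v⁆ = (-α x) • conjC v
  rw [← conj_root_conjC hB hconj hv hv0, ← LinearMap.map_smulₛₗ,
    ← lie_of_mem_rootSpace hB hconj hv, conjC_lie, conjC_conjC]

theorem map_conjC_rootSpace (α : h → ℂ) :
    (LieAlgebra.rootSpace h α).toSubmodule.map conjC =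
      (LieAlgebra.rootSpace h (-α)).toSubmodule := by
  ext z
  rw [mem_map_conjC]
  exact ⟨fun hz => conjC_conjC z ▸ conjC_mem_rootSpace_neg hB hconj hz,
    fun hz => neg_neg α ▸ conjC_mem_rootSpace_neg hB hconj hz⟩

theorem bilinBaseChange_eq_zero_of_mem_rootSpace (hv : v ∈ LieAlgebra.rootSpace h α)
    (hw : w ∈ LieAlgebra.rootSpace h β) (hαβ : α + β ≠ 0) : B.baseChange ℂ v w = 0 := by
  obtain ⟨x, hx⟩ := Function.ne_iff.1 hαβ
  have key := bilinBaseChange_lie_left hB (x : ℂ ⊗[ℝ] V) v w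
  rw [lie_of_mem_rootSpace hB hconj hv, lie_of_mem_rootSpace hB hconj hw, map_smul, map_smul,
    LinearMap.smul_apply, ← add_eq_zero_iff_eq_neg, ← add_smul] at key
  exact (smul_eq_zero.1 key).resolve_left hx

end RootSpaces

section ComplexStructures

/-- The `-i`-eigenspace, in `ℂ ⊗ V`, of the complexification of an endomorphism of `V`; for a
complex structure `J` on `V` it is `V^{0,1}`, and `negIEigenspaceC (-J)` is `V^{1,0}`. -/
abbrev negIEigenspaceC {V : Type*} [AddCommGroup V] [Module ℝ V] (J : Module.End ℝ V) :
    Submodule ℂ (ℂ ⊗[ℝ] V) :=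
  Module.End.eigenspace (J.baseChange ℂ) (-Complex.I)

variable {V : Type*} [AddCommGroup V] [Module ℝ V] {J : Module.End ℝ V}

theorem mkC_mem_negIEigenspaceC_iff {a b : V} :
    mkC a b ∈ negIEigenspaceC J ↔ J a = b ∧ J b = -a := by
  rw [Module.End.mem_eigenspace_iff, baseChange_mkC, neg_I_smul_mkC, mkC_inj]

theorem eigenspace_I_eq_negIEigenspaceC_neg (J : Module.End ℝ V) :
    Module.End.eigenspace (J.baseChange ℂ) Complex.I = negIEigenspaceC (-J) := by
  ext z
  rw [Module.End.mem_eigenspace_iff, Module.End.mem_eigenspace_iff, LinearMap.baseChange_neg,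
    LinearMap.neg_apply, neg_smul, neg_inj]

theorem map_conjC_negIEigenspaceC (J : Module.End ℝ V) :
    (negIEigenspaceC J).map conjC = negIEigenspaceC (-J) := by
  rw [map_conjC_eigenspace_baseChange, map_neg, Complex.conj_I, neg_neg,
    eigenspace_I_eq_negIEigenspaceC_neg]

theorem map_negIEigenspaceC_baseChange {W : Type*} [AddCommGroup W] [Module ℝ W] (e : V ≃ₗ[ℝ] W)
    (J : Module.End ℝ V) :
    (negIEigenspaceC J).map ((e : V →ₗ[ℝ] W).baseChange ℂ) = negIEigenspaceC (e.conj J) := by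
  ext z
  obtain ⟨a, b, rfl⟩ := exists_mkC_eq z
  rw [mkC_mem_negIEigenspaceC_iff, Submodule.mem_map]
  constructor
  · rintro ⟨w, hw, hwab⟩
    obtain ⟨c, d, rfl⟩ := exists_mkC_eq w
    rw [mkC_mem_negIEigenspaceC_iff] at hw
    rw [baseChange_mkC, mkC_inj] at hwab
    obtain ⟨rfl, rfl⟩ := hwab
    simp [LinearEquiv.conj_apply, hw]
  · rintro ⟨ha, hb⟩
    refine ⟨mkC (e.symm a) (e.symm b), mkC_mem_negIEigenspaceC_iff.2 ⟨?_, ?_⟩, by simp⟩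
    · simp [← ha, LinearEquiv.conj_apply]
    · rw [← map_neg, ← hb, LinearEquiv.conj_apply]
      simp

theorem directSumC_negIEigenspaceC {V : Type*} [LieRing V] [LieAlgebra ℝ V]
    (J K : Module.End ℝ V) :
    directSumC (negIEigenspaceC J) (negIEigenspaceC K) = negIEigenspaceC (J.prodMap K) := by
  ext z
  obtain ⟨a, b, rfl⟩ := exists_mkC_eq z
  simp only [directSumC, Submodule.mem_inf, Submodule.mem_comap, baseChange_mkC,
    mkC_mem_negIEigenspaceC_iff, LinearMap.prodMap_apply, Prod.ext_iff, LinearMap.fst_apply,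
    LinearMap.snd_apply, Prod.fst_neg, Prod.snd_neg]
  tauto

section SquareNegOne

variable (hJ : ∀ x, J (J x) = -x)

include hJ

theorem mkC_mem_negIEigenspaceC {a b : V} : mkC a b ∈ negIEigenspaceC J ↔ J a = b := by
  rw [mkC_mem_negIEigenspaceC_iff]
  exact ⟨And.left, fun h => ⟨h, by rw [← h, hJ]⟩⟩

theorem forall_mem_negIEigenspaceC {p : ℂ ⊗[ℝ] V → Prop} :
    (∀ z ∈ negIEigenspaceC J, p z) ↔ ∀ a, p (mkC a (J a)) := by
  refine ⟨fun h a => h _ ((mkC_mem_negIEigenspaceC hJ).2 rfl), fun h z hz => ?_⟩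
  obtain ⟨a, b, rfl⟩ := exists_mkC_eq z
  exact (mkC_mem_negIEigenspaceC hJ).1 hz ▸ h a

theorem negIEigenspaceC_eq_iff {J' : Module.End ℝ V} :
    negIEigenspaceC J' = negIEigenspaceC J ↔ J' = J := by
  refine ⟨fun h => LinearMap.ext fun x => ?_, fun h => h ▸ rfl⟩
  have hx : mkC x (J x) ∈ negIEigenspaceC J' := h ▸ (mkC_mem_negIEigenspaceC hJ).2 rfl
  exact (mkC_mem_negIEigenspaceC_iff.1 hx).1

theorem isCompl_negIEigenspaceC_neg : IsCompl (negIEigenspaceC J) (negIEigenspaceC (-J)) := by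
  have hJ' : ∀ x, (-J) ((-J) x) = -x := by simpa using hJ
  refine ⟨Submodule.disjoint_def.2 ?_, codisjoint_iff.2 (eq_top_iff.2 fun z _ => ?_)⟩
  · rw [forall_mem_negIEigenspaceC hJ]
    intro a ha
    have hJJ : -J a = J a := (mkC_mem_negIEigenspaceC hJ').1 ha
    have hJa : J a = 0 := by linear_combination (norm := module) (-1 / 2 : ℝ) • hJJ
    rw [mkC_eq_zero, ← neg_eq_zero, ← hJ, hJa, map_zero]
    exact ⟨rfl, rfl⟩
  · obtain ⟨a, b, rfl⟩ := exists_mkC_eq z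
    refine Submodule.mem_sup.2
      ⟨mkC ((1 / 2 : ℝ) • (a - J b)) ((1 / 2 : ℝ) • (J a + b)), (mkC_mem_negIEigenspaceC hJ).2 ?_,
        mkC ((1 / 2 : ℝ) • (a + J b)) ((1 / 2 : ℝ) • (b - J a)), (mkC_mem_negIEigenspaceC hJ').2 ?_,
        mkC_add_mkC _ _ _ _ |>.trans (mkC_inj.2 ⟨by module, by module⟩)⟩ <;>
    simp only [LinearMap.neg_apply, map_smul, map_sub, map_add, hJ] <;> module

theorem isCompl_map_conjC_negIEigenspaceC :
    IsCompl (negIEigenspaceC J) ((negIEigenspaceC J).map conjC) :=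
  map_conjC_negIEigenspaceC J ▸ isCompl_negIEigenspaceC_neg hJ

theorem isotropic_negIEigenspaceC_iff {B : LinearMap.BilinForm ℝ V} :
    (∀ z ∈ negIEigenspaceC J, ∀ w ∈ negIEigenspaceC J, B.baseChange ℂ z w = 0) ↔
      ∀ x y, B (J x) (J y) = B x y := by
  simp only [forall_mem_negIEigenspaceC hJ, bilinBaseChange_mkC_eq_zero_iff]
  refine ⟨fun h x y => (h x y).1.symm, fun h x y => ⟨(h x y).symm, ?_⟩⟩
  rw [← h, hJ, map_neg]

end SquareNegOne

theorem lie_mem_negIEigenspaceC_iff {V : Type*} [LieRing V] [LieAlgebra ℝ V]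
    {J : Module.End ℝ V} (hJ : ∀ x, J (J x) = -x) :
    (∀ z ∈ negIEigenspaceC J, ∀ w ∈ negIEigenspaceC J, ⁅z, w⁆ ∈ negIEigenspaceC J) ↔
      ∀ x y, J (⁅x, y⁆ - ⁅J x, J y⁆) = ⁅x, J y⁆ + ⁅J x, y⁆ := by
  simp only [forall_mem_negIEigenspaceC hJ, lie_mkC, mkC_mem_negIEigenspaceC hJ]

section OfIsCompl

variable {L : Submodule ℂ (ℂ ⊗[ℝ] V)}

theorem bijective_reC_of_isCompl_map_conjC (hL : IsCompl L (L.map conjC)) :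
    Function.Bijective (reC ∘ₗ (L.restrictScalars ℝ).subtype) := by
  refine ⟨LinearMap.ker_eq_bot.1 (LinearMap.ker_eq_bot'.2 ?_), fun a => ?_⟩
  · rintro ⟨z, hz⟩ hz0
    have hconj : conjC z = -z := by
      rw [eq_neg_iff_add_eq_zero, add_comm, ← two_smul_mkC_reC, show reC z = 0 from hz0,
        mkC_eq_zero.2 ⟨rfl, rfl⟩, smul_zero]
    exact Subtype.ext (Submodule.disjoint_def.1 hL.disjoint z hz
      (mem_map_conjC.2 (hconj ▸ L.neg_mem hz)))
  · obtain ⟨z, hz, w, hw, hzw⟩ := Submodule.mem_sup.1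
      (hL.sup_eq_top ▸ Submodule.mem_top : mkC a 0 ∈ L ⊔ L.map conjC)
    refine ⟨⟨z + conjC w, L.add_mem hz (mem_map_conjC.1 hw)⟩, ?_⟩
    change reC (z + conjC w) = a
    rw [map_add, reC_conjC, ← map_add, hzw, reC_mkC]

theorem exists_negIEigenspaceC_eq (hL : IsCompl L (L.map conjC)) :
    ∃ J : Module.End ℝ V, (∀ x, J (J x) = -x) ∧ negIEigenspaceC J = L := by
  let e := LinearEquiv.ofBijective _ (bijective_reC_of_isCompl_map_conjC hL)
  let J : Module.End ℝ V := imC ∘ₗ (L.restrictScalars ℝ).subtype ∘ₗ e.symm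
  have hmem (a : V) : mkC a (J a) ∈ L := by
    have hre : reC (e.symm a : ℂ ⊗[ℝ] V) = a := e.apply_symm_apply a
    have hmk : mkC a (J a) = e.symm a :=
      (mkC_inj.2 ⟨hre.symm, rfl⟩).trans (mkC_reC_imC (e.symm a : ℂ ⊗[ℝ] V))
    exact hmk ▸ (e.symm a).2
  have hJ {a b : V} (hab : mkC a b ∈ L) : J a = b := by
    have he : e.symm a = ⟨mkC a b, hab⟩ := e.symm_apply_eq.2 (reC_mkC a b).symm
    simp [J, he]
  have hsq (x : V) : J (J x) = -x :=
    hJ (neg_I_smul_mkC x (J x) ▸ L.smul_mem _ (hmem x))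
  refine ⟨J, hsq, le_antisymm ((forall_mem_negIEigenspaceC hsq).2 hmem) fun z hz => ?_⟩
  obtain ⟨a, b, rfl⟩ := exists_mkC_eq z
  exact (mkC_mem_negIEigenspaceC hsq).2 (hJ hz)

end OfIsCompl

end ComplexStructures

section SamelsonStructure

variable {V : Type*} [LieRing V] [LieAlgebra ℝ V] {h : LieSubalgebra ℂ (ℂ ⊗[ℝ] V)}
  {Ih : Module.End ℝ (realSubspace h)}

theorem h10_sup_h01 (hI : ∀ x, Ih (Ih x) = -x) (hconj : ∀ z ∈ h, conjC z ∈ h) :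
    h10 h Ih ⊔ h01 h Ih = h.toSubmodule := by
  rw [h10, h01, ← Submodule.map_sup, eigenspace_I_eq_negIEigenspaceC_neg, sup_comm,
    (isCompl_negIEigenspaceC_neg hI).sup_eq_top, map_top_baseChange_subtype_realSubspace hconj]

theorem map_conjC_h01 : (h01 h Ih).map conjC = h10 h Ih := by
  rw [h10, h01, map_conjC_map_baseChange, map_conjC_negIEigenspaceC,
    eigenspace_I_eq_negIEigenspaceC_neg]

theorem bilinBaseChange_h10 {B : LinearMap.BilinForm ℝ V} (hI : ∀ x, Ih (Ih x) = -x)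
    (hIB : ∀ x y : realSubspace h, B (Ih x) (Ih y) = B x y) {z w : ℂ ⊗[ℝ] V}
    (hz : z ∈ h10 h Ih) (hw : w ∈ h10 h Ih) : B.baseChange ℂ z w = 0 := by
  rw [h10, eigenspace_I_eq_negIEigenspaceC_neg] at hz hw
  obtain ⟨z, hz, rfl⟩ := hz
  obtain ⟨w, hw, rfl⟩ := hw
  rw [bilinBaseChange_baseChange]
  exact (isotropic_negIEigenspaceC_iff (by simpa using hI)).2 (by simpa using hIB) z hz w hw

section Generators

variable [LieRing.IsNilpotent h] {P : Set (h → ℂ)}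

theorem g10_eq_span : g10 h P Ih =
    Submodule.span ℂ ((h10 h Ih : Set (ℂ ⊗[ℝ] V)) ∪ ⋃ α ∈ P, LieAlgebra.rootSpace h α) := by
  simp only [g10, Submodule.span_union, Submodule.span_iUnion, Submodule.span_eq,
    ← LieSubmodule.coe_toSubmodule]

theorem rootSpace_le_g10 {α : h → ℂ} (hα : α ∈ P) :
    (LieAlgebra.rootSpace h α).toSubmodule ≤ g10 h P Ih :=
  (le_iSup₂_of_le (f := fun α (_ : α ∈ P) => (LieAlgebra.rootSpace h α).toSubmodule)
    α hα le_rfl).trans le_sup_right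

theorem apply_mem_of_mem_g10 {N : Type*} [AddCommGroup N] [Module ℂ N]
    (f : ℂ ⊗[ℝ] V →ₗ[ℂ] ℂ ⊗[ℝ] V →ₗ[ℂ] N) (M : Submodule ℂ N)
    (hh : ∀ z ∈ h10 h Ih, ∀ w ∈ h10 h Ih, f z w ∈ M)
    (hP : ∀ z ∈ h10 h Ih, ∀ α ∈ P, ∀ w ∈ LieAlgebra.rootSpace h α, f z w ∈ M ∧ f w z ∈ M)
    (hPP : ∀ α ∈ P, ∀ β ∈ P, ∀ z ∈ LieAlgebra.rootSpace h α, ∀ w ∈ LieAlgebra.rootSpace h β,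
      f z w ∈ M)
    {z w : ℂ ⊗[ℝ] V} (hz : z ∈ g10 h P Ih) (hw : w ∈ g10 h P Ih) : f z w ∈ M := by
  suffices Submodule.map₂ f (g10 h P Ih) (g10 h P Ih) ≤ M from
    this (Submodule.apply_mem_map₂ f hz hw)
  rw [g10_eq_span, Submodule.map₂_span_span, Submodule.span_le, Set.image2_subset_iff]
  simp only [Set.mem_union, Set.mem_iUnion, SetLike.mem_coe, exists_prop]
  rintro z (hz | ⟨α, hα, hz⟩) w (hw | ⟨β, hβ, hw⟩)
  · exact hh z hz w hw
  · exact (hP z hz β hβ w hw).1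
  · exact (hP w hw α hα z hz).2
  · exact hPP α hα β hβ z hz w hw

end Generators

variable [h.IsCartanSubalgebra] {P : Set (h → ℂ)} [FiniteDimensional ℝ V]

theorem h10_le_rootSpace_zero (hI : ∀ x, Ih (Ih x) = -x) (hconj : ∀ z ∈ h, conjC z ∈ h) :
    h10 h Ih ≤ (LieAlgebra.rootSpace h (0 : h → ℂ)).toSubmodule := by
  rw [LieAlgebra.rootSpace_zero_eq]
  exact le_sup_left.trans (h10_sup_h01 hI hconj).le

theorem g10_sup_g01 (hI : ∀ x, Ih (Ih x) = -x) (hconj : ∀ z ∈ h, conjC z ∈ h)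
    (hP : IsPositiveSystem h P) : g10 h P Ih ⊔ g01 h P Ih = ⊤ := by
  have htop := congrArg LieSubmodule.toSubmodule
    (LieModule.iSup_genWeightSpace_eq_top ℂ h (ℂ ⊗[ℝ] V))
  rw [LieSubmodule.iSup_toSubmodule, LieSubmodule.top_toSubmodule] at htop
  refine eq_top_iff.2 (htop ▸ iSup_le fun α => ?_)
  change (LieAlgebra.rootSpace h α).toSubmodule ≤ _
  rcases eq_or_ne α 0 with rfl | hα0
  · have hzero : (LieAlgebra.rootSpace h (0 : h → ℂ)).toSubmodule = h.toSubmodule := by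
      rw [LieAlgebra.rootSpace_zero_eq]; rfl
    exact (hzero.trans (h10_sup_h01 hI hconj).symm).le.trans (sup_le_sup le_sup_left le_sup_left)
  rcases eq_or_ne (LieAlgebra.rootSpace h α) ⊥ with hbot | hbot
  · simp [hbot]
  rcases hP.mem_or_neg_mem α hα0 hbot with hα | hα
  · exact (rootSpace_le_g10 hα).trans le_sup_left
  · refine le_trans ?_ (le_sup_right.trans (le_sup_right : g01 h P Ih ≤ _))
    exact le_iSup₂_of_le (-α) hα (by rw [neg_neg])

variable {B : LinearMap.BilinForm ℝ V} (hB : IsInvariantInnerProduct B)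

include hB

theorem map_conjC_g01 (hconj : ∀ z ∈ h, conjC z ∈ h) : (g01 h P Ih).map conjC = g10 h P Ih := by
  simp only [g01, g10, Submodule.map_sup, Submodule.map_iSup, map_conjC_h01,
    map_conjC_rootSpace hB hconj, neg_neg]

theorem bilinBaseChange_g10 (hI : ∀ x, Ih (Ih x) = -x) (hconj : ∀ z ∈ h, conjC z ∈ h)
    (hP : IsPositiveSystem h P) (hIB : ∀ x y : realSubspace h, B (Ih x) (Ih y) = B x y)
    {z w : ℂ ⊗[ℝ] V} (hz : z ∈ g10 h P Ih) (hw : w ∈ g10 h P Ih) :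
    B.baseChange ℂ z w = 0 := by
  have hh0 := h10_le_rootSpace_zero hI hconj
  rw [← Submodule.mem_bot ℂ]
  refine apply_mem_of_mem_g10 (B.baseChange ℂ) ⊥ (fun z hz w hw => ?_)
    (fun z hz α hα w hw => ⟨?_, ?_⟩) (fun α hα β hβ z hz w hw => ?_) hz hw
  · exact bilinBaseChange_h10 hI hIB hz hw
  · exact bilinBaseChange_eq_zero_of_mem_rootSpace hB hconj (hh0 hz) hw
      (by simpa using (hP.isRoot α hα).1)
  · exact bilinBaseChange_eq_zero_of_mem_rootSpace hB hconj hw (hh0 hz)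
      (by simpa using (hP.isRoot α hα).1)
  · exact bilinBaseChange_eq_zero_of_mem_rootSpace hB hconj hz hw
      fun h0 => hP.neg_notMem α hα (eq_neg_of_add_eq_zero_right h0 ▸ hβ)

theorem lie_mem_g10 (hI : ∀ x, Ih (Ih x) = -x) (hconj : ∀ z ∈ h, conjC z ∈ h)
    (hP : IsPositiveSystem h P) {z w : ℂ ⊗[ℝ] V} (hz : z ∈ g10 h P Ih) (hw : w ∈ g10 h P Ih) :
    ⁅z, w⁆ ∈ g10 h P Ih := by
  have hh0 := h10_le_rootSpace_zero hI hconj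
  have hh : h10 h Ih ≤ h.toSubmodule := le_sup_left.trans (h10_sup_h01 hI hconj).le
  refine apply_mem_of_mem_g10 (LieModule.toEnd ℂ (ℂ ⊗[ℝ] V) (ℂ ⊗[ℝ] V) : _ →ₗ[ℂ] _) (g10 h P Ih)
    (fun z hz w hw => ?_) (fun z hz α hα w hw => ?_) (fun α hα β hβ z hz w hw => ?_) hz hw
  · change ⁅z, w⁆ ∈ _
    rw [lie_of_mem_rootSpace hB hconj (hh0 hw) ⟨z, hh hz⟩, Pi.zero_apply, zero_smul]
    exact Submodule.zero_mem _
  · have hzw : ⁅z, w⁆ ∈ g10 h P Ih := by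
      rw [lie_of_mem_rootSpace hB hconj hw ⟨z, hh hz⟩]
      exact Submodule.smul_mem _ _ (rootSpace_le_g10 hα hw)
    exact ⟨hzw, show ⁅w, z⁆ ∈ _ from lie_skew w z ▸ Submodule.neg_mem _ hzw⟩
  · have hmem : ⁅z, w⁆ ∈ LieAlgebra.rootSpace h (α + β) :=
      LieAlgebra.lie_mem_genWeightSpace_of_mem_genWeightSpace hz hw
    change ⁅z, w⁆ ∈ _
    rcases eq_or_ne (LieAlgebra.rootSpace h (α + β)) ⊥ with hbot | hbot
    · have hzero : ⁅z, w⁆ = 0 := by rwa [hbot, LieSubmodule.mem_bot] at hmem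
      exact hzero ▸ Submodule.zero_mem _
    · refine rootSpace_le_g10 (hP.add_mem α hα β hβ (fun h0 => ?_) hbot) hmem
      exact hP.neg_notMem α hα (eq_neg_of_add_eq_zero_right h0 ▸ hβ)

theorem isCompl_map_conjC_g01 (hI : ∀ x, Ih (Ih x) = -x) (hconj : ∀ z ∈ h, conjC z ∈ h)
    (hP : IsPositiveSystem h P) (hIB : ∀ x y : realSubspace h, B (Ih x) (Ih y) = B x y) :
    IsCompl (g01 h P Ih) ((g01 h P Ih).map conjC) := by
  refine ⟨Submodule.disjoint_def.2 fun z hz hz' => ?_, codisjoint_iff.2 ?_⟩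
  · have hconjz : conjC z ∈ g10 h P Ih :=
      map_conjC_g01 hB hconj ▸ Submodule.mem_map_of_mem hz
    rw [map_conjC_g01 hB hconj] at hz'
    exact hB.eq_zero_of_baseChange_conjC_self (bilinBaseChange_g10 hB hI hconj hP hIB hz' hconjz)
  · rw [map_conjC_g01 hB hconj, sup_comm, g10_sup_g01 hI hconj hP]

end SamelsonStructure

section IntegrableStructures

/-- Integrable complex structures on a real Lie algebra (the Nijenhuis tensor of `J` vanishes)
which are isometries of a bilinear form. -/
structure IsIntegrableIsometry {D : Type*} [LieRing D] [LieAlgebra ℝ D]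
    (Q : LinearMap.BilinForm ℝ D) (J : Module.End ℝ D) : Prop where
  sq : ∀ x, J (J x) = -x
  isometry : ∀ x y, Q (J x) (J y) = Q x y
  integrable : ∀ x y, J (⁅x, y⁆ - ⁅J x, J y⁆) = ⁅x, J y⁆ + ⁅J x, y⁆

namespace IsIntegrableIsometry

variable {D : Type*} [LieRing D] [LieAlgebra ℝ D] {Q : LinearMap.BilinForm ℝ D}
  {J J' : Module.End ℝ D}

theorem of_negIEigenspaceC (hJ : ∀ x, J (J x) = -x)
    (hQ : ∀ z ∈ negIEigenspaceC J, ∀ w ∈ negIEigenspaceC J, Q.baseChange ℂ z w = 0)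
    (hlie : ∀ z ∈ negIEigenspaceC J, ∀ w ∈ negIEigenspaceC J, ⁅z, w⁆ ∈ negIEigenspaceC J) :
    IsIntegrableIsometry Q J where
  sq := hJ
  isometry := (isotropic_negIEigenspaceC_iff hJ).1 hQ
  integrable := (lie_mem_negIEigenspaceC_iff hJ).1 hlie

theorem skew (h : IsIntegrableIsometry Q J) (x y : D) : Q (J x) y = -Q x (J y) := by
  rw [← h.isometry x (J y), h.sq, map_neg, neg_neg]

theorem neg (h : IsIntegrableIsometry Q J) : IsIntegrableIsometry Q (-J) where
  sq x := by simp [h.sq]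
  isometry x y := by simp [h.isometry]
  integrable x y := by
    simp only [LinearMap.neg_apply, lie_neg, neg_lie, neg_neg, h.integrable, neg_add]

theorem prodMap (h : IsIntegrableIsometry Q J) (h' : IsIntegrableIsometry Q J') :
    IsIntegrableIsometry (doubleForm Q) (J.prodMap J') where
  sq x := Prod.ext (h.sq x.1) (h'.sq x.2)
  isometry x y := by simp [doubleForm, h.isometry, h'.isometry]
  integrable x y := Prod.ext (h.integrable x.1 y.1) (h'.integrable x.2 y.2)

end IsIntegrableIsometry

theorem isMaximalIsotropic_of_sup_eq_top {W : Type*} [AddCommGroup W] [Module ℂ W]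
    {Q : LinearMap.BilinForm ℂ W} (hQ : Q.SeparatingLeft) {L L' : Submodule ℂ W}
    (hL : ∀ x ∈ L, ∀ y ∈ L, Q x y = 0) (hL' : ∀ x ∈ L', ∀ y ∈ L', Q x y = 0)
    (htop : L ⊔ L' = ⊤) : IsMaximalIsotropic Q L := by
  refine ⟨hL, fun U hU hLU u hu => ?_⟩
  obtain ⟨l, hl, l', hl', rfl⟩ := Submodule.mem_sup.1 (htop ▸ Submodule.mem_top : u ∈ L ⊔ L')
  have hl'U : l' ∈ U := (U.add_mem_iff_right (hLU hl)).1 hu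
  have hl'0 : l' = 0 := hQ l' fun w => by
    obtain ⟨m, hm, m', hm', rfl⟩ := Submodule.mem_sup.1 (htop ▸ Submodule.mem_top : w ∈ L ⊔ L')
    rw [map_add, hU l' hl'U m (hLU hm), hL' l' hl' m' hm', add_zero]
  simpa [hl'0] using hl

variable {V : Type*} [LieRing V] [LieAlgebra ℝ V] {B : LinearMap.BilinForm ℝ V}

theorem IsIntegrableIsometry.isIsotropicSplittingSubalgebra (hB : IsInnerProduct B)
    {J : Module.End ℝ (V × V)} (hJ : IsIntegrableIsometry (doubleForm B) J) :
    IsIsotropicSplittingSubalgebra B (negIEigenspaceC J) where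
  maximalIsotropic :=
    isMaximalIsotropic_of_sup_eq_top (separatingLeft_baseChange hB.separatingLeft_doubleForm)
      ((isotropic_negIEigenspaceC_iff hJ.sq).2 hJ.isometry)
      ((isotropic_negIEigenspaceC_iff hJ.neg.sq).2 hJ.neg.isometry)
      (isCompl_negIEigenspaceC_neg hJ.sq).sup_eq_top
  isCompl_conj := isCompl_map_conjC_negIEigenspaceC hJ.sq
  lie_mem := (lie_mem_negIEigenspaceC_iff hJ.sq).2 hJ.integrable

theorem exists_isIntegrableIsometry_negIEigenspaceC_eq_g01 [FiniteDimensional ℝ V]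
    {h : LieSubalgebra ℂ (ℂ ⊗[ℝ] V)} [h.IsCartanSubalgebra] (hB : IsInvariantInnerProduct B)
    (hconj : ∀ z ∈ h, conjC z ∈ h) {P : Set (h → ℂ)} (hP : IsPositiveSystem h P)
    {Ih : Module.End ℝ (realSubspace h)} (hI : ∀ x, Ih (Ih x) = -x)
    (hIB : ∀ x y : realSubspace h, B (Ih x) (Ih y) = B x y) :
    ∃ J : Module.End ℝ V, IsIntegrableIsometry B J ∧
      negIEigenspaceC (-J) = g10 h P Ih ∧ negIEigenspaceC J = g01 h P Ih := by
  obtain ⟨J, hJ, hJ01⟩ := exists_negIEigenspaceC_eq (isCompl_map_conjC_g01 hB hI hconj hP hIB)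
  have hJ10 : negIEigenspaceC (-J) = g10 h P Ih := by
    rw [← map_conjC_negIEigenspaceC, hJ01, map_conjC_g01 hB hconj]
  have hnegJ : IsIntegrableIsometry B (-J) := .of_negIEigenspaceC (by simpa using hJ)
    (hJ10 ▸ fun z hz w hw => bilinBaseChange_g10 hB hI hconj hP hIB hz hw)
    (hJ10 ▸ fun z hz w hw => lie_mem_g10 hB hI hconj hP hz hw)
  exact ⟨J, neg_neg J ▸ hnegJ.neg, hJ10, hJ01⟩

end IntegrableStructures

/-! ### The Maurer-Cartan equation -/

section ModelDerivative

variable {E : Type*} [NormedAddCommGroup E] [NormedSpace ℝ E]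
  {E' : Type*} [NormedAddCommGroup E'] [NormedSpace ℝ E']
  {E'' : Type*} [NormedAddCommGroup E''] [NormedSpace ℝ E'']
  {M : Type*} [TopologicalSpace M] [ChartedSpace E M]
  {M' : Type*} [TopologicalSpace M'] [ChartedSpace E' M']
  {M'' : Type*} [TopologicalSpace M''] [ChartedSpace E'' M'']

variable (E E') in
/-- The manifold derivative as a map between the model spaces. Unlike the tangent spaces, these
carry norms, and they do not change when a point is replaced by a propositionally equal one. -/
def modelDeriv (f : M → M') (x : M) : E →L[ℝ] E' := mfderiv 𝓘(ℝ, E) 𝓘(ℝ, E') f x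

theorem modelDeriv_comp {g : M' → M''} {f : M → M'} {x : M} {y : M'} (hy : f x = y)
    (hg : MDiffAt g y) (hf : MDiffAt f x) :
    modelDeriv E E'' (fun z => g (f z)) x = (modelDeriv E' E'' g y).comp (modelDeriv E E' f x) := by
  subst hy
  exact mfderiv_comp x hg hf

theorem modelDeriv_id (x : M) : modelDeriv E E (fun z : M => z) x = .id ℝ E := mfderiv_id

theorem modelDeriv_congr {f g : M → M'} {x : M} (h : f =ᶠ[nhds x] g) :
    modelDeriv E E' f x = modelDeriv E E' g x := h.mfderiv_eq

theorem modelDeriv_eq_fderiv (f : E → E') (x : E) : modelDeriv E E' f x = fderiv ℝ f x :=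
  mfderiv_eq_fderiv

theorem modelDeriv_clm_apply (L : E' →L[ℝ] E'') {f : M → E'} {x : M} (hf : MDiffAt f x) :
    modelDeriv E E'' (fun y => L (f y)) x = L.comp (modelDeriv E E' f x) :=
  (modelDeriv_comp rfl L.differentiableAt.mdifferentiableAt hf).trans
    (congrArg (ContinuousLinearMap.comp · _) ((modelDeriv_eq_fderiv L _).trans L.fderiv))

theorem mdifferentiableAt_bilin_apply (b : E' →L[ℝ] E' →L[ℝ] E'') {f g : M → E'} {x : M}
    (hf : MDiffAt f x) (hg : MDiffAt g x) : MDiffAt (fun y => b (f y) (g y)) x :=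
  (b.differentiableAt.mdifferentiableAt.comp x hf).clm_apply hg

section Prod

variable {f : M → E' × E''} {x : M} (hf : MDifferentiableAt 𝓘(ℝ, E) 𝓘(ℝ, E' × E'') f x)
include hf

theorem mdifferentiableAt_fst_comp : MDiffAt (fun g => (f g).1) x :=
  (ContinuousLinearMap.fst ℝ E' E'').differentiableAt.mdifferentiableAt.comp x hf

theorem mdifferentiableAt_snd_comp : MDiffAt (fun g => (f g).2) x :=
  (ContinuousLinearMap.snd ℝ E' E'').differentiableAt.mdifferentiableAt.comp x hf

theorem modelDeriv_fst_apply (v : E) :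
    modelDeriv E E' (fun g => (f g).1) x v = (modelDeriv E (E' × E'') f x v).1 :=
  DFunLike.congr_fun (modelDeriv_clm_apply (.fst ℝ E' E'') hf) v

theorem modelDeriv_snd_apply (v : E) :
    modelDeriv E E'' (fun g => (f g).2) x v = (modelDeriv E (E' × E'') f x v).2 :=
  DFunLike.congr_fun (modelDeriv_clm_apply (.snd ℝ E' E'') hf) v

end Prod

variable [IsManifold 𝓘(ℝ, E) ∞ M]

theorem mdifferentiableAt_chart {x₀ x : M} (hx : x ∈ (extChartAt 𝓘(ℝ, E) x₀).source) :
    MDiffAt (extChartAt 𝓘(ℝ, E) x₀) x :=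
  haveI : IsManifold 𝓘(ℝ, E) 1 M := IsManifold.of_le (n := ∞) (by simp)
  mdifferentiableAt_extChartAt (by simpa using hx)

theorem contMDiffAt_chart_symm {x₀ : M} {y : E} (hy : y ∈ (extChartAt 𝓘(ℝ, E) x₀).target) :
    CMDiffAt ∞ (extChartAt 𝓘(ℝ, E) x₀).symm y :=
  (contMDiffOn_extChartAt_symm x₀).contMDiffAt ((isOpen_extChartAt_target x₀).mem_nhds hy)

theorem mdifferentiableAt_chart_symm {x₀ : M} {y : E}
    (hy : y ∈ (extChartAt 𝓘(ℝ, E) x₀).target) : MDiffAt (extChartAt 𝓘(ℝ, E) x₀).symm y :=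
  (contMDiffAt_chart_symm hy).mdifferentiableAt (by simp)

theorem modelDeriv_chart_comp_symm {x₀ : M} {y : E} (hy : y ∈ (extChartAt 𝓘(ℝ, E) x₀).target) :
    (modelDeriv E E (extChartAt 𝓘(ℝ, E) x₀) ((extChartAt 𝓘(ℝ, E) x₀).symm y)).comp
      (modelDeriv E E (extChartAt 𝓘(ℝ, E) x₀).symm y) = .id ℝ E := by
  rw [← modelDeriv_comp rfl (mdifferentiableAt_chart ((extChartAt 𝓘(ℝ, E) x₀).map_target hy))
    (mdifferentiableAt_chart_symm hy), ← modelDeriv_id (M := E) y]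
  apply modelDeriv_congr
  filter_upwards [(isOpen_extChartAt_target x₀).mem_nhds hy] with z hz
  exact (extChartAt 𝓘(ℝ, E) x₀).right_inv hz

theorem modelDeriv_symm_comp_chart {x₀ : M} {y : E} (hy : y ∈ (extChartAt 𝓘(ℝ, E) x₀).target) :
    (modelDeriv E E (extChartAt 𝓘(ℝ, E) x₀).symm y).comp
      (modelDeriv E E (extChartAt 𝓘(ℝ, E) x₀) ((extChartAt 𝓘(ℝ, E) x₀).symm y)) = .id ℝ E := by
  have hx := (extChartAt 𝓘(ℝ, E) x₀).map_target hy
  rw [← modelDeriv_comp ((extChartAt 𝓘(ℝ, E) x₀).right_inv hy) (mdifferentiableAt_chart_symm hy)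
    (mdifferentiableAt_chart hx), ← modelDeriv_id (M := M) ((extChartAt 𝓘(ℝ, E) x₀).symm y)]
  apply modelDeriv_congr
  filter_upwards [(isOpen_extChartAt_source x₀).mem_nhds hx] with z hz
  exact (extChartAt 𝓘(ℝ, E) x₀).left_inv hz

theorem modelDeriv_chart_self (x₀ : M) :
    modelDeriv E E (extChartAt 𝓘(ℝ, E) x₀) x₀ = .id ℝ E :=
  haveI : IsManifold 𝓘(ℝ, E) 1 M := IsManifold.of_le (n := ∞) (by simp)
  mfderiv_extChartAt_self

theorem modelDeriv_chart_symm_self (x₀ : M) :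
    modelDeriv E E (extChartAt 𝓘(ℝ, E) x₀).symm (extChartAt 𝓘(ℝ, E) x₀ x₀) = .id ℝ E := by
  have h := modelDeriv_symm_comp_chart (mem_extChartAt_target (I := 𝓘(ℝ, E)) x₀)
  rwa [extChartAt_to_inv, modelDeriv_chart_self] at h

theorem differentiableAt_comp_chart_symm {x₀ : M} {f : M → E'} (hf : MDiffAt f x₀) :
    DifferentiableAt ℝ (fun y => f ((extChartAt 𝓘(ℝ, E) x₀).symm y))
      (extChartAt 𝓘(ℝ, E) x₀ x₀) := by
  rw [← extChartAt_to_inv (I := 𝓘(ℝ, E)) x₀] at hf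
  exact (hf.comp _ (mdifferentiableAt_chart_symm (mem_extChartAt_target x₀))).differentiableAt

theorem fderiv_comp_chart_symm {x₀ : M} {f : M → E'} (hf : MDiffAt f x₀) :
    fderiv ℝ (fun y => f ((extChartAt 𝓘(ℝ, E) x₀).symm y)) (extChartAt 𝓘(ℝ, E) x₀ x₀) =
      modelDeriv E E' f x₀ := by
  rw [← modelDeriv_eq_fderiv, modelDeriv_comp (extChartAt_to_inv x₀) hf
    (mdifferentiableAt_chart_symm (mem_extChartAt_target x₀)), modelDeriv_chart_symm_self,
    ContinuousLinearMap.comp_id]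

theorem modelDeriv_bilin_apply (b : E' →L[ℝ] E' →L[ℝ] E'') {f g : M → E'} {x : M}
    (hf : MDiffAt f x) (hg : MDiffAt g x) (v : E) :
    modelDeriv E E'' (fun y => b (f y) (g y)) x v =
      b (modelDeriv E E' f x v) (g x) + b (f x) (modelDeriv E E' g x v) := by
  have h := ((b.hasFDerivAt.comp _ (differentiableAt_comp_chart_symm hf).hasFDerivAt).clm_apply
    (differentiableAt_comp_chart_symm hg).hasFDerivAt).fderiv
  rw [← fderiv_comp_chart_symm (mdifferentiableAt_bilin_apply b hf hg),
    ← fderiv_comp_chart_symm hf, ← fderiv_comp_chart_symm hg]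
  refine (DFunLike.congr_fun h v).trans ?_
  simp [add_comm]

theorem contMDiffAt_modelDeriv [IsManifold 𝓘(ℝ, E') ∞ M'] {f : M → E'' → M'} {u : M → E''} {x : M}
    {c : M'} (hf : CMDiffAt ∞ f.uncurry (x, u x)) (hu : CMDiffAt ∞ u x) (hc : ∀ z, f z (u z) = c) :
    CMDiffAt ∞ (fun z => modelDeriv E'' E' (f z) (u z)) x := by
  have : IsManifold 𝓘(ℝ, E) 1 M := IsManifold.of_le (n := ∞) (by simp)
  have : IsManifold 𝓘(ℝ, E') 1 M' := IsManifold.of_le (n := ∞) (by simp)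
  refine (ContMDiffAt.mfderiv f u hf hu (by simp)).congr_of_eventuallyEq (.of_forall fun z => ?_)
  have hchart : modelDeriv E' E' (extChartAt 𝓘(ℝ, E') (f x (u x))) (f z (u z)) = .id ℝ E' := by
    rw [hc, hc, modelDeriv_chart_self]
  have hsource : mfderiv[Set.range 𝓘(ℝ, E'')] (extChartAt 𝓘(ℝ, E'') (u x)).symm
      (extChartAt 𝓘(ℝ, E'') (u x) (u z)) = ContinuousLinearMap.id ℝ E'' := by
    rw [ModelWithCorners.range_eq_univ, mfderivWithin_univ]
    exact mfderiv_id
  rw [inTangentCoordinates_eq_mfderiv_comp (Set.mem_univ _)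
    (by simp only [hc]; exact mem_chart_source _ _), hsource]
  exact (congrArg (fun A => A.comp (modelDeriv E'' E' (f z) (u z))) hchart).symm

end ModelDerivative

section GroupDerivatives

variable {E : Type*} [NormedAddCommGroup E] [NormedSpace ℝ E]
  {G : Type*} [TopologicalSpace G] [ChartedSpace E G] [Group G]

variable (E)

/-- `leftField`, as an endomorphism of the model space. -/
def leftFieldE (g : G) : E →L[ℝ] E := leftField g

/-- `rightField`, as an endomorphism of the model space. -/
def rightFieldE (g : G) : E →L[ℝ] E := rightField g

/-- `thetaL`, as an endomorphism of the model space. -/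
def thetaLE (g : G) : E →L[ℝ] E := thetaL g

/-- `thetaR`, as an endomorphism of the model space. -/
def thetaRE (g : G) : E →L[ℝ] E := thetaR g

/-- `adjointAction`, as an endomorphism of the model space. -/
def adjointE (g : G) : E →L[ℝ] E := adjointAction g

variable {E}

theorem adjointE_one : adjointE E (1 : G) = .id ℝ E := by
  change modelDeriv E E _ 1 = _
  simpa using modelDeriv_id (1 : G)

variable [LieGroup 𝓘(ℝ, E) ∞ G]

theorem mdifferentiableAt_conj (g x : G) : MDiffAt (fun h : G => g * h * g⁻¹) x :=
  (((contMDiff_const.mul contMDiff_id).mul contMDiff_const).contMDiffAt (n := ∞)).mdifferentiableAt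
    (by simp)

theorem thetaLE_comp_leftFieldE (g : G) : (thetaLE E g).comp (leftFieldE E g) = .id ℝ E := by
  refine (modelDeriv_comp (mul_one g) mdifferentiableAt_mul_left
    mdifferentiableAt_mul_left).symm.trans ?_
  simpa using modelDeriv_id (1 : G)

theorem leftFieldE_comp_thetaLE (g : G) : (leftFieldE E g).comp (thetaLE E g) = .id ℝ E := by
  refine (modelDeriv_comp (inv_mul_cancel g) mdifferentiableAt_mul_left
    mdifferentiableAt_mul_left).symm.trans ?_
  simpa using modelDeriv_id g

theorem thetaRE_comp_leftFieldE (g : G) : (thetaRE E g).comp (leftFieldE E g) = adjointE E g :=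
  (modelDeriv_comp (mul_one g) mdifferentiableAt_mul_right
    mdifferentiableAt_mul_left).symm

theorem thetaLE_comp_rightFieldE (g : G) :
    (thetaLE E g).comp (rightFieldE E g) = adjointE E g⁻¹ := by
  refine (modelDeriv_comp (f := fun h : G => h * g) (one_mul g)
    mdifferentiableAt_mul_left mdifferentiableAt_mul_right).symm.trans ?_
  change _ = modelDeriv E E _ 1
  simp only [mul_assoc, inv_inv]

theorem adjointE_mul (g k : G) : adjointE E (g * k) = (adjointE E g).comp (adjointE E k) := by
  refine Eq.trans ?_ (modelDeriv_comp (by simp) (mdifferentiableAt_conj g 1)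
    (mdifferentiableAt_conj k 1))
  change modelDeriv E E _ 1 = _
  simp only [mul_assoc, mul_inv_rev]

@[simp] theorem thetaLE_leftFieldE (g : G) (x : E) : thetaLE E g (leftFieldE E g x) = x :=
  DFunLike.congr_fun (thetaLE_comp_leftFieldE g) x

@[simp] theorem leftFieldE_thetaLE (g : G) (x : E) : leftFieldE E g (thetaLE E g x) = x :=
  DFunLike.congr_fun (leftFieldE_comp_thetaLE g) x

theorem rightFieldE_apply (g : G) (x : E) :
    rightFieldE E g x = leftFieldE E g (adjointE E g⁻¹ x) := by
  rw [← thetaLE_comp_rightFieldE, ContinuousLinearMap.comp_apply, leftFieldE_thetaLE]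

theorem thetaRE_apply (g : G) (x : E) : thetaRE E g x = adjointE E g (thetaLE E g x) := by
  rw [← thetaRE_comp_leftFieldE, ContinuousLinearMap.comp_apply, leftFieldE_thetaLE]

@[simp] theorem adjointE_inv_adjointE (g : G) (x : E) : adjointE E g⁻¹ (adjointE E g x) = x := by
  rw [← ContinuousLinearMap.comp_apply, ← adjointE_mul, inv_mul_cancel, adjointE_one]
  rfl

@[simp] theorem adjointE_adjointE_inv (g : G) (x : E) : adjointE E g (adjointE E g⁻¹ x) = x := by
  simpa using adjointE_inv_adjointE g⁻¹ x

theorem contMDiff_adjointE : CMDiff ∞ (fun g : G => adjointE E g) := by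
  intro g₀
  let p : E := extChartAt 𝓘(ℝ, E) (1 : G) 1
  let σ : E → G := ↑(extChartAt 𝓘(ℝ, E) (1 : G)).symm
  have hp1 : σ p = 1 := extChartAt_to_inv _
  have hσp : CMDiffAt ∞ σ p := contMDiffAt_chart_symm (mem_extChartAt_target _)
  have hconj : CMDiffAt ∞ (Function.uncurry fun g x => g * σ x * g⁻¹) (g₀, p) :=
    (contMDiffAt_fst.mul (hσp.comp (g₀, p) contMDiffAt_snd)).mul contMDiffAt_fst.inv
  refine (contMDiffAt_modelDeriv (u := fun _ => p) (c := 1) hconj contMDiffAt_const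
    fun g => by simp [hp1]).congr_of_eventuallyEq (.of_forall fun g => ?_)
  refine Eq.trans ?_ (modelDeriv_comp hp1 (mdifferentiableAt_conj g 1)
    (hσp.mdifferentiableAt (by simp))).symm
  exact (congrArg (adjointE E g).comp (modelDeriv_chart_symm_self (1 : G))).symm

end GroupDerivatives

theorem fderiv_apply_comp {E F V W : Type*} [NormedAddCommGroup E] [NormedSpace ℝ E]
    [NormedAddCommGroup F] [NormedSpace ℝ F] [NormedAddCommGroup V] [NormedSpace ℝ V]
    [NormedAddCommGroup W] [NormedSpace ℝ W] {f : F → V →L[ℝ] W} {ι : E → F} {ι' : E →L[ℝ] F}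
    {y : E} (hf : DifferentiableAt ℝ f (ι y)) (hι : HasFDerivAt ι ι' y) (u : E) (v : V) :
    fderiv ℝ f (ι y) (ι' u) v = fderiv ℝ (fun z => f (ι z) v) y u := by
  have h : HasFDerivAt (fun z => f (ι z)) ((fderiv ℝ f (ι y)).comp ι') y :=
    hf.hasFDerivAt.comp y hι
  simp [(h.clm_apply (hasFDerivAt_const v y)).fderiv]

section LeftLogDeriv

variable {E : Type*} [NormedAddCommGroup E] [NormedSpace ℝ E]
  {F : Type*} [NormedAddCommGroup F] [NormedSpace ℝ F]
  {F' : Type*} [NormedAddCommGroup F'] [NormedSpace ℝ F']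
  {G : Type*} [TopologicalSpace G] [ChartedSpace E G] [Group G]

variable (E) in
/-- The left logarithmic derivative `f⁻¹ df` of a map `f` into a Lie group, i.e. the pullback
`f^* θ^L` of the left Maurer-Cartan form. -/
def leftLogDeriv (f : F → G) (y : F) : F →L[ℝ] E := modelDeriv F E (fun z => (f y)⁻¹ * f z) y

@[simp] theorem leftLogDeriv_const (g : G) (y : F) : leftLogDeriv E (fun _ => g) y = 0 :=
  mfderiv_const

theorem leftLogDeriv_congr {f k : F → G} {y : F} (h : f =ᶠ[nhds y] k) :
    leftLogDeriv E f y = leftLogDeriv E k y := by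
  rw [leftLogDeriv, leftLogDeriv, h.self_of_nhds]
  exact modelDeriv_congr (h.mono fun z hz => congrArg _ hz)

variable [LieGroup 𝓘(ℝ, E) ∞ G]

theorem leftLogDeriv_eq {f : F → G} {y : F} (hf : MDiffAt f y) :
    leftLogDeriv E f y = (thetaLE E (f y)).comp (modelDeriv F E f y) :=
  modelDeriv_comp rfl mdifferentiableAt_mul_left hf

theorem leftLogDeriv_comp {f : F → G} {ψ : F' → F} {y : F'} (hf : MDiffAt f (ψ y))
    (hψ : DifferentiableAt ℝ ψ y) :
    leftLogDeriv E (fun z => f (ψ z)) y = (leftLogDeriv E f (ψ y)).comp (fderiv ℝ ψ y) := by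
  rw [← modelDeriv_eq_fderiv]
  exact modelDeriv_comp (f := ψ) rfl
    (MDifferentiableAt.comp (ψ y) mdifferentiableAt_mul_left hf) hψ.mdifferentiableAt

theorem contDiffAt_leftLogDeriv {f : F → G} {y : F} (hf : CMDiffAt ∞ f y) :
    ContDiffAt ℝ ∞ (leftLogDeriv E f) y := by
  have hq : ContMDiffAt (𝓘(ℝ, F).prod 𝓘(ℝ, F)) 𝓘(ℝ, E) ∞
      (Function.uncurry fun y z => (f y)⁻¹ * f z) (y, y) :=
    (hf.comp (y, y) contMDiffAt_fst).inv.mul (hf.comp (y, y) contMDiffAt_snd)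
  exact contMDiffAt_iff_contDiffAt.mp
    (contMDiffAt_modelDeriv (u := id) (c := 1) hq contMDiffAt_id fun z => inv_mul_cancel (f z))

theorem modelDeriv_mul {f k : F → G} {y : F} (hf : MDiffAt f y) (hk : MDiffAt k y) :
    modelDeriv F E (fun z => f z * k z) y =
      (modelDeriv E E (fun g => g * k y) (f y)).comp (modelDeriv F E f y) +
        (modelDeriv E E (fun g => f y * g) (k y)).comp (modelDeriv F E k y) := by
  have hmul : MDiffAt (fun p : G × G => p.1 * p.2) (f y, k y) :=
    (contMDiff_mul 𝓘(ℝ, E) ∞).contMDiffAt.mdifferentiableAt (by simp)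
  have hprod : mfderiv% (fun z => (f z, k z)) y = (mfderiv% f y).prod (mfderiv% k y) :=
    mfderiv_prodMk hf hk
  ext v
  refine (congrArg (· v) (mfderiv_comp (f := fun z => (f z, k z)) y hmul (hf.prodMk hk))).trans ?_
  refine (mfderiv_prod_eq_add_apply hmul).trans ?_
  rw [hprod]
  rfl

theorem leftLogDeriv_mul {f k : F → G} {y : F} (hf : MDiffAt f y) (hk : MDiffAt k y) :
    leftLogDeriv E (fun z => f z * k z) y =
      (adjointE E (k y)⁻¹).comp (leftLogDeriv E f y) + leftLogDeriv E k y := by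
  let conj (g : G) : G := (k y)⁻¹ * g * (k y)⁻¹⁻¹
  let f₀ (z : F) : G := (f y)⁻¹ * f z
  have hf₀ : MDiffAt f₀ y := MDifferentiableAt.comp y mdifferentiableAt_mul_left hf
  have hk₀ : MDiffAt (fun z => (k y)⁻¹ * k z) y :=
    MDifferentiableAt.comp y mdifferentiableAt_mul_left hk
  have hconj : MDiffAt (fun z => conj (f₀ z)) y :=
    MDifferentiableAt.comp y (mdifferentiableAt_conj _ _) hf₀
  have hsplit : (fun z => (f y * k y)⁻¹ * (f z * k z)) =
      fun z => conj (f₀ z) * ((k y)⁻¹ * k z) := by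
    funext z
    simp only [conj, f₀]
    group
  have hchain : modelDeriv F E (fun z => conj (f₀ z)) y =
      (adjointE E (k y)⁻¹).comp (leftLogDeriv E f y) :=
    modelDeriv_comp (inv_mul_cancel (f y)) (mdifferentiableAt_conj _ _) hf₀
  have hconj_y : conj (f₀ y) = 1 := by simp [conj, f₀]
  rw [leftLogDeriv, hsplit, modelDeriv_mul hconj hk₀, hconj_y, hchain]
  simp only [inv_mul_cancel, mul_one, one_mul, modelDeriv_id, ContinuousLinearMap.id_comp]
  rfl

theorem leftLogDeriv_conj (g : G) {f : F → G} {y : F} (hf : MDiffAt f y) :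
    leftLogDeriv E (fun z => g * f z * g⁻¹) y = (adjointE E g).comp (leftLogDeriv E f y) := by
  have hgf : MDiffAt (fun z => g * f z) y :=
    MDifferentiableAt.comp y mdifferentiableAt_mul_left hf
  rw [leftLogDeriv_mul hgf mdifferentiableAt_const, leftLogDeriv_mul mdifferentiableAt_const hf]
  simp

theorem leftLogDeriv_mul_prod {f : F → G}
    {k : F' → G} {q : F × F'} (hf : MDiffAt f q.1) (hk : MDiffAt k q.2) :
    leftLogDeriv E (fun q : F × F' => f q.1 * k q.2) q =
      (adjointE E (k q.2)⁻¹).comp ((leftLogDeriv E f q.1).comp (.fst ℝ F F')) +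
        (leftLogDeriv E k q.2).comp (.snd ℝ F F') := by
  have hfst := leftLogDeriv_comp hf (differentiableAt_fst (p := q))
  have hsnd := leftLogDeriv_comp hk (differentiableAt_snd (p := q))
  have hf' : MDifferentiableAt 𝓘(ℝ, F × F') 𝓘(ℝ, E) (fun q : F × F' => f q.1) q :=
    hf.comp q differentiableAt_fst.mdifferentiableAt
  have hk' : MDifferentiableAt 𝓘(ℝ, F × F') 𝓘(ℝ, E) (fun q : F × F' => k q.2) q :=
    hk.comp q differentiableAt_snd.mdifferentiableAt
  rw [leftLogDeriv_mul hf' hk', hfst, hsnd, fderiv_fst, fderiv_snd]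

end LeftLogDeriv

section ChartMaurerCartan

variable {E : Type*} [NormedAddCommGroup E] [NormedSpace ℝ E]
  {G : Type*} [TopologicalSpace G] [ChartedSpace E G] [Group G]

/-- A vector field written in the chart at `x₀`. -/
def chartField {M : Type*} [TopologicalSpace M] [ChartedSpace E M] (x₀ : M)
    (V : ∀ x : M, TangentSpace 𝓘(ℝ, E) x) : E → E :=
  VectorField.mpullback 𝓘(ℝ, E) 𝓘(ℝ, E) (extChartAt 𝓘(ℝ, E) x₀).symm V

/-- The left Maurer-Cartan form written in the chart at `x₀`. -/
def chartThetaL (x₀ : G) : E → E →L[ℝ] E := leftLogDeriv E (extChartAt 𝓘(ℝ, E) x₀).symm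

theorem mlieBracket_eq_lieBracket_chartField {M : Type*} [TopologicalSpace M] [ChartedSpace E M]
    [IsManifold 𝓘(ℝ, E) ∞ M] (V W : ∀ x : M, TangentSpace 𝓘(ℝ, E) x) (x₀ : M) :
    VectorField.mlieBracket 𝓘(ℝ, E) V W x₀ =
      VectorField.lieBracket ℝ (chartField x₀ V) (chartField x₀ W) (extChartAt 𝓘(ℝ, E) x₀ x₀) := by
  rw [← VectorField.mlieBracketWithin_univ, VectorField.mlieBracketWithin_apply,
    ModelWithCorners.range_eq_univ, VectorField.mpullbackWithin_univ,
    VectorField.mpullbackWithin_univ, Set.preimage_univ, Set.univ_inter]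
  have h : (modelDeriv E E (extChartAt 𝓘(ℝ, E) x₀) x₀).inverse = .id ℝ E := by
    rw [modelDeriv_chart_self, ContinuousLinearMap.inverse_id]
  refine (DFunLike.congr_fun h _).trans ?_
  exact congrFun VectorField.lieBracketWithin_univ _

theorem chartField_self {M : Type*} [TopologicalSpace M] [ChartedSpace E M]
    [IsManifold 𝓘(ℝ, E) ∞ M] (V : ∀ x : M, TangentSpace 𝓘(ℝ, E) x) (x₀ : M) :
    chartField x₀ V (extChartAt 𝓘(ℝ, E) x₀ x₀) = V x₀ := by
  have h (x : M) (hx : x = x₀) :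
      (modelDeriv E E (extChartAt 𝓘(ℝ, E) x₀).symm (extChartAt 𝓘(ℝ, E) x₀ x₀)).inverse (V x) =
        V x₀ := by
    rw [modelDeriv_chart_symm_self, ContinuousLinearMap.inverse_id, hx]
    rfl
  exact h _ (extChartAt_to_inv x₀)

variable [LieGroup 𝓘(ℝ, E) ∞ G]

theorem chartThetaL_eq {x₀ : G} {y : E} (hy : y ∈ (extChartAt 𝓘(ℝ, E) x₀).target) :
    chartThetaL x₀ y =
      (thetaLE E ((extChartAt 𝓘(ℝ, E) x₀).symm y)).comp
        (modelDeriv E E (extChartAt 𝓘(ℝ, E) x₀).symm y) :=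
  leftLogDeriv_eq (mdifferentiableAt_chart_symm hy)

theorem differentiableAt_chartThetaL {x₀ : G} {y : E}
    (hy : y ∈ (extChartAt 𝓘(ℝ, E) x₀).target) : DifferentiableAt ℝ (chartThetaL x₀) y :=
  (contDiffAt_leftLogDeriv (contMDiffAt_chart_symm hy)).differentiableAt (by simp)

theorem chartThetaL_self (x₀ : G) :
    chartThetaL x₀ (extChartAt 𝓘(ℝ, E) x₀ x₀) = thetaLE E x₀ := by
  rw [chartThetaL_eq (mem_extChartAt_target x₀), modelDeriv_chart_symm_self,
    extChartAt_to_inv, ContinuousLinearMap.comp_id]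

theorem chartThetaL_one :
    chartThetaL (1 : G) (extChartAt 𝓘(ℝ, E) (1 : G) 1) = .id ℝ E := by
  rw [chartThetaL_self]
  change modelDeriv E E _ (1 : G) = _
  simpa using modelDeriv_id (1 : G)

theorem isInvertible_modelDeriv_chart_symm {x₀ : G} {y : E}
    (hy : y ∈ (extChartAt 𝓘(ℝ, E) x₀).target) :
    (modelDeriv E E (extChartAt 𝓘(ℝ, E) x₀).symm y).IsInvertible :=
  .of_inverse (modelDeriv_symm_comp_chart hy) (modelDeriv_chart_comp_symm hy)

theorem isInvertible_chartThetaL {x₀ : G} {y : E}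
    (hy : y ∈ (extChartAt 𝓘(ℝ, E) x₀).target) :
    (chartThetaL x₀ y).IsInvertible := by
  rw [chartThetaL_eq hy]
  exact .comp (.of_inverse (thetaLE_comp_leftFieldE _) (leftFieldE_comp_thetaLE _))
    (isInvertible_modelDeriv_chart_symm hy)

theorem chartThetaL_chartField {x₀ : G} {y : E}
    (hy : y ∈ (extChartAt 𝓘(ℝ, E) x₀).target) (V : ∀ g : G, TangentSpace 𝓘(ℝ, E) g) :
    chartThetaL x₀ y (chartField x₀ V y) =
      thetaLE E ((extChartAt 𝓘(ℝ, E) x₀).symm y) (V ((extChartAt 𝓘(ℝ, E) x₀).symm y)) := by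
  rw [chartThetaL_eq hy]
  exact congrArg (thetaLE E _) ((isInvertible_modelDeriv_chart_symm hy).self_apply_inverse _)

theorem differentiableAt_chartField [CompleteSpace E] {x₀ : G} {y : E}
    (hy : y ∈ (extChartAt 𝓘(ℝ, E) x₀).target) {V : ∀ g : G, TangentSpace 𝓘(ℝ, E) g}
    (hV : MDiffAt (fun g => thetaLE E g (V g)) ((extChartAt 𝓘(ℝ, E) x₀).symm y)) :
    DifferentiableAt ℝ (chartField x₀ V) y := by
  have hinv : DifferentiableAt ℝ (fun z => (chartThetaL x₀ z).inverse) y :=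
    ((isInvertible_chartThetaL hy).contDiffAt_map_inverse.comp y
      (contDiffAt_leftLogDeriv (contMDiffAt_chart_symm hy))).differentiableAt (by simp)
  have hX : DifferentiableAt ℝ (fun z => thetaLE E ((extChartAt 𝓘(ℝ, E) x₀).symm z)
      (V ((extChartAt 𝓘(ℝ, E) x₀).symm z))) y :=
    (hV.comp y (mdifferentiableAt_chart_symm hy)).differentiableAt
  refine (hinv.clm_apply hX).congr_of_eventuallyEq ?_
  filter_upwards [(isOpen_extChartAt_target x₀).mem_nhds hy] with z hz
  exact ((isInvertible_chartThetaL hz).inverse_apply_eq.mpr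
    (chartThetaL_chartField hz V).symm).symm

theorem clm_apply_lieBracket {Θ : E → E →L[ℝ] E} {v w : E → E} {y : E}
    (hΘ : DifferentiableAt ℝ Θ y) (hv : DifferentiableAt ℝ v y) (hw : DifferentiableAt ℝ w y) :
    Θ y (VectorField.lieBracket ℝ v w y) =
      fderiv ℝ (fun z => Θ z (w z)) y (v y) - fderiv ℝ (fun z => Θ z (v z)) y (w y) -
        (fderiv ℝ Θ y (v y) (w y) - fderiv ℝ Θ y (w y) (v y)) := by
  rw [fderiv_clm_apply hΘ hw, fderiv_clm_apply hΘ hv]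
  simp only [VectorField.lieBracket, map_sub, add_apply, ContinuousLinearMap.comp_apply,
    ContinuousLinearMap.flip_apply]
  abel

end ChartMaurerCartan

section MaurerCartan

variable {E : Type*} [NormedAddCommGroup E] [NormedSpace ℝ E]
  {F : Type*} [NormedAddCommGroup F] [NormedSpace ℝ F]
  {G : Type*} [TopologicalSpace G] [ChartedSpace E G] [Group G] [LieGroup 𝓘(ℝ, E) ∞ G]

theorem fderiv_chartThetaL_chartField {x₀ : G} {V : ∀ g : G, TangentSpace 𝓘(ℝ, E) g}
    (hV : MDiffAt (fun g => thetaLE E g (V g)) x₀) :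
    fderiv ℝ (fun y => chartThetaL x₀ y (chartField x₀ V y)) (extChartAt 𝓘(ℝ, E) x₀ x₀) =
      modelDeriv E E (fun g => thetaLE E g (V g)) x₀ := by
  rw [← fderiv_comp_chart_symm hV]
  apply Filter.EventuallyEq.fderiv_eq
  filter_upwards [(isOpen_extChartAt_target x₀).mem_nhds (mem_extChartAt_target x₀)] with y hy
  exact chartThetaL_chartField hy V

theorem mdifferentiableAt_adjointE_inv_apply {x₀ : G} {U : G → E} (hU : MDiffAt U x₀) :
    MDiffAt (fun g => adjointE E g⁻¹ (U g)) x₀ :=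
  ((contMDiff_adjointE.comp (contMDiff_inv 𝓘(ℝ, E) ∞)).mdifferentiable (by simp) x₀).clm_apply hU

theorem mdifferentiableAt_fst_add_adjointE_inv_snd {a : G → E × E} {x : G}
    (ha : MDifferentiableAt 𝓘(ℝ, E) 𝓘(ℝ, E × E) a x) :
    MDiffAt (fun g => (a g).1 + adjointE E g⁻¹ (a g).2) x :=
  (mdifferentiableAt_fst_comp ha).add
    (mdifferentiableAt_adjointE_inv_apply (mdifferentiableAt_snd_comp ha))

theorem mdifferentiableAt_fst_sub_adjointE_inv_snd {a : G → E × E} {x : G}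
    (ha : MDifferentiableAt 𝓘(ℝ, E) 𝓘(ℝ, E × E) a x) :
    MDiffAt (fun g => (a g).1 - adjointE E g⁻¹ (a g).2) x :=
  (mdifferentiableAt_fst_comp ha).sub
    (mdifferentiableAt_adjointE_inv_apply (mdifferentiableAt_snd_comp ha))

variable [CompleteSpace E]

theorem thetaLE_mlieBracket_chart {x₀ : G} {V W : ∀ g : G, TangentSpace 𝓘(ℝ, E) g}
    (hV : MDiffAt (fun g => thetaLE E g (V g)) x₀) (hW : MDiffAt (fun g => thetaLE E g (W g)) x₀) :
    thetaLE E x₀ (VectorField.mlieBracket 𝓘(ℝ, E) V W x₀) =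
      modelDeriv E E (fun g => thetaLE E g (W g)) x₀ (V x₀) -
        modelDeriv E E (fun g => thetaLE E g (V g)) x₀ (W x₀) -
      (fderiv ℝ (chartThetaL x₀) (extChartAt 𝓘(ℝ, E) x₀ x₀) (V x₀) (W x₀) -
        fderiv ℝ (chartThetaL x₀) (extChartAt 𝓘(ℝ, E) x₀ x₀) (W x₀) (V x₀)) := by
  have hx := mem_extChartAt_target (I := 𝓘(ℝ, E)) x₀
  have hdiff {V : ∀ g : G, TangentSpace 𝓘(ℝ, E) g} (hV : MDiffAt (fun g => thetaLE E g (V g)) x₀) :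
      DifferentiableAt ℝ (chartField x₀ V) (extChartAt 𝓘(ℝ, E) x₀ x₀) :=
    differentiableAt_chartField hx (by rwa [extChartAt_to_inv])
  have h := clm_apply_lieBracket (differentiableAt_chartThetaL hx) (hdiff hV) (hdiff hW)
  rw [fderiv_chartThetaL_chartField hV, fderiv_chartThetaL_chartField hW, chartField_self,
    chartField_self, chartThetaL_self] at h
  rw [← h, mlieBracket_eq_lieBracket_chartField]

variable [FiniteDimensional ℝ E]

variable (E G) in
/-- The bracket of `𝔤`, as a continuous bilinear map on the model space. -/
def lieE : E →L[ℝ] E →L[ℝ] E :=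
  LinearMap.toContinuousBilinearMap (𝕜 := ℝ) (E := E) (F := E) (G := E)
    (bracketMap (E := E) (G := G))

theorem lieE_skew (x y : E) : -lieE E G y x = lieE E G x y := lie_skew (L := LieAlg E G) x y

theorem maurerCartan_chartThetaL (x₀ : G) (v w : E) :
    fderiv ℝ (chartThetaL x₀) (extChartAt 𝓘(ℝ, E) x₀ x₀) v w -
        fderiv ℝ (chartThetaL x₀) (extChartAt 𝓘(ℝ, E) x₀ x₀) w v =
      -lieE E G (thetaLE E x₀ v) (thetaLE E x₀ w) := by
  let X : E := thetaLE E x₀ v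
  let Y : E := thetaLE E x₀ w
  have hconst (Z : E) :
      (fun g : G => thetaLE E g (mulInvariantVectorField (I := 𝓘(ℝ, E)) Z g)) = fun _ => Z :=
    funext fun g => thetaLE_leftFieldE g Z
  have hderiv (Z : E) : modelDeriv E E (fun _ : G => Z) x₀ = 0 := mfderiv_const
  have hbracket : VectorField.mlieBracket 𝓘(ℝ, E) (mulInvariantVectorField X)
      (mulInvariantVectorField Y) x₀ = leftFieldE E x₀ (lieE E G X Y) :=
    (congrFun (mulInvariantVector_mlieBracket (I := 𝓘(ℝ, E)) (G := G) X Y) x₀).symm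
  have h := thetaLE_mlieBracket_chart (x₀ := x₀) (V := mulInvariantVectorField X)
    (W := mulInvariantVectorField Y) (by rw [hconst]; exact mdifferentiableAt_const)
    (by rw [hconst]; exact mdifferentiableAt_const)
  have hv : mulInvariantVectorField (I := 𝓘(ℝ, E)) X x₀ = v := leftFieldE_thetaLE x₀ v
  have hw : mulInvariantVectorField (I := 𝓘(ℝ, E)) Y x₀ = w := leftFieldE_thetaLE x₀ w
  rw [hbracket, thetaLE_leftFieldE, hconst, hconst, hderiv, hderiv, hv, hw] at h
  rw [h]
  simp

theorem thetaLE_mlieBracket {x₀ : G} {V W : ∀ g : G, TangentSpace 𝓘(ℝ, E) g}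
    (hV : MDiffAt (fun g => thetaLE E g (V g)) x₀) (hW : MDiffAt (fun g => thetaLE E g (W g)) x₀) :
    thetaLE E x₀ (VectorField.mlieBracket 𝓘(ℝ, E) V W x₀) =
      modelDeriv E E (fun g => thetaLE E g (W g)) x₀ (V x₀) -
        modelDeriv E E (fun g => thetaLE E g (V g)) x₀ (W x₀) +
      lieE E G (thetaLE E x₀ (V x₀)) (thetaLE E x₀ (W x₀)) := by
  have h := maurerCartan_chartThetaL (E := E) x₀ (V x₀) (W x₀)
  exact (thetaLE_mlieBracket_chart hV hW).trans ((congrArg _ h).trans (sub_neg_eq_add (α := E) _ _))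

theorem maurerCartan_leftLogDeriv {f : F → G} {y : F} (hf : CMDiffAt ∞ f y) (v w : F) :
    fderiv ℝ (leftLogDeriv E f) y v w - fderiv ℝ (leftLogDeriv E f) y w v =
      -lieE E G (leftLogDeriv E f y v) (leftLogDeriv E f y w) := by
  let ψ : F → E := fun z => extChartAt 𝓘(ℝ, E) (f y) (f z)
  have hψ : ContDiffAt ℝ ∞ ψ y :=
    contMDiffAt_iff_contDiffAt.mp ((contMDiffAt_extChartAt (x := f y)).comp y hf)
  have htarget : ∀ᶠ z in nhds y, ψ z ∈ (extChartAt 𝓘(ℝ, E) (f y)).target :=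
    hψ.continuousAt (extChartAt_target_mem_nhds (f y))
  have hsource : ∀ᶠ z in nhds y, f z ∈ (extChartAt 𝓘(ℝ, E) (f y)).source :=
    hf.continuousAt (extChartAt_source_mem_nhds (f y))
  have hδ : leftLogDeriv E f =ᶠ[nhds y]
      fun z => (chartThetaL (f y) (ψ z)).comp (fderiv ℝ ψ z) := by
    filter_upwards [htarget, hsource.eventually_nhds,
      (hψ.of_le (m := 1) ENat.LEInfty.out).eventually (by simp)] with z hz hfz hψz
    rw [leftLogDeriv_congr
      (hfz.mono fun _ h => ((extChartAt 𝓘(ℝ, E) (f y)).left_inv h).symm)]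
    exact leftLogDeriv_comp (mdifferentiableAt_chart_symm hz) (hψz.differentiableAt (by simp))
  have hψ' : DifferentiableAt ℝ (fderiv ℝ ψ) y :=
    (hψ.fderiv_right (m := ∞) (by simp)).differentiableAt (by simp)
  have hΘ : DifferentiableAt ℝ (chartThetaL (E := E) (f y)) (ψ y) :=
    differentiableAt_chartThetaL (mem_extChartAt_target (f y))
  have hΘψ := hΘ.hasFDerivAt.comp y (hψ.differentiableAt (by simp)).hasFDerivAt
  have hsymm : fderiv ℝ (fderiv ℝ ψ) y v w = fderiv ℝ (fderiv ℝ ψ) y w v :=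
    (hψ.isSymmSndFDerivAt (by simpa using ENat.LEInfty.out)).eq v w
  have hfirst : leftLogDeriv E f y = (thetaLE E (f y)).comp (fderiv ℝ ψ y) := by
    rw [hδ.eq_of_nhds, chartThetaL_self]
  have hfderiv : fderiv ℝ (leftLogDeriv E f) y = _ :=
    hδ.fderiv_eq.trans (hΘψ.clm_comp hψ'.hasFDerivAt).fderiv
  rw [hfderiv, hfirst]
  simp only [add_apply, ContinuousLinearMap.comp_apply, ContinuousLinearMap.compL_apply,
    ContinuousLinearMap.flip_apply, hsymm, add_sub_add_left_eq_sub]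
  exact maurerCartan_chartThetaL (f y) (fderiv ℝ ψ y v) (fderiv ℝ ψ y w)

theorem adjointE_lieE (g : G) (x y : E) :
    adjointE E g (lieE E G x y) = lieE E G (adjointE E g x) (adjointE E g y) := by
  let p : E := extChartAt 𝓘(ℝ, E) (1 : G) 1
  let σ : E → G := (extChartAt 𝓘(ℝ, E) (1 : G)).symm
  have hp : p ∈ (extChartAt 𝓘(ℝ, E) (1 : G)).target := mem_extChartAt_target 1
  have hσ : CMDiffAt ∞ σ p := contMDiffAt_chart_symm hp
  have hconj : leftLogDeriv E (fun z => g * σ z * g⁻¹) =ᶠ[nhds p]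
      fun z => (adjointE E g).comp (leftLogDeriv E σ z) := by
    filter_upwards [(isOpen_extChartAt_target (1 : G)).mem_nhds hp] with z hz
    exact leftLogDeriv_conj g (mdifferentiableAt_chart_symm hz)
  have hdiff : DifferentiableAt ℝ (leftLogDeriv E σ) p := differentiableAt_chartThetaL hp
  have hfderiv (v w : E) : fderiv ℝ (leftLogDeriv E fun z => g * σ z * g⁻¹) p v w =
      adjointE E g (fderiv ℝ (leftLogDeriv E σ) p v w) := by
    rw [hconj.fderiv_eq, ((hasFDerivAt_const (adjointE E g) p).clm_comp
      hdiff.hasFDerivAt).fderiv]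
    simp
  have hσg : CMDiffAt ∞ (fun z => g * σ z * g⁻¹) p :=
    (contMDiffAt_const.mul hσ).mul contMDiffAt_const
  have h := maurerCartan_leftLogDeriv hσg x y
  have hone : leftLogDeriv E σ p = .id ℝ E := chartThetaL_one
  rw [hfderiv, hfderiv, ← map_sub, maurerCartan_leftLogDeriv hσ, hconj.eq_of_nhds, hone,
    map_neg] at h
  exact neg_injective h

/- This is the mixed component of the Maurer-Cartan equation of `(p, z) ↦ σ p * k z`, where `σ` is
the inverse of a chart at `1`. -/
theorem fderiv_adjointE_inv {k : F → G} {y : F} (hk : CMDiffAt ∞ k y) (x : E) (w : F) :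
    fderiv ℝ (fun z => adjointE E (k z)⁻¹ x) y w =
      -lieE E G (leftLogDeriv E k y w) (adjointE E (k y)⁻¹ x) := by
  let σ : E → G := (extChartAt 𝓘(ℝ, E) (1 : G)).symm
  let p : E := extChartAt 𝓘(ℝ, E) (1 : G) 1
  let f (q : E × F) : G := σ q.1 * k q.2
  have hp : p ∈ (extChartAt 𝓘(ℝ, E) (1 : G)).target := mem_extChartAt_target 1
  have hσ : CMDiffAt ∞ σ p := contMDiffAt_chart_symm hp
  have hone : leftLogDeriv E σ p = .id ℝ E := chartThetaL_one
  have hf : ContMDiffAt 𝓘(ℝ, E × F) 𝓘(ℝ, E) ∞ f (p, y) :=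
    (hσ.comp (p, y) contDiffAt_fst.contMDiffAt).mul (hk.comp (p, y) contDiffAt_snd.contMDiffAt)
  have hδf : DifferentiableAt ℝ (leftLogDeriv E f) (p, y) :=
    (contDiffAt_leftLogDeriv hf).differentiableAt (by simp)
  have hk_diff : ∀ᶠ z in nhds y, MDiffAt k z :=
    ((contMDiffAt_iff_contMDiffAt_nhds (by simp)).mp (hk.of_le (m := 1) ENat.LEInfty.out)).mono
      fun z hz => hz.mdifferentiableAt (by simp)
  have hleft : fderiv ℝ (leftLogDeriv E f) (p, y) (x, 0) (0, w) = 0 := by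
    have h : (fun z => leftLogDeriv E f (z, y) (0, w)) =ᶠ[nhds p]
        fun _ => leftLogDeriv E k y w := by
      filter_upwards [(isOpen_extChartAt_target (1 : G)).mem_nhds hp] with z hz
      rw [leftLogDeriv_mul_prod (q := (z, y)) (mdifferentiableAt_chart_symm hz)
        (hk.mdifferentiableAt (by simp))]
      simp
    have hx := fderiv_apply_comp (ι := fun z => (z, y)) hδf (hasFDerivAt_prodMk_left p y) x (0, w)
    rw [h.fderiv_eq] at hx
    simpa using hx
  have hright : fderiv ℝ (leftLogDeriv E f) (p, y) (0, w) (x, 0) =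
      fderiv ℝ (fun z => adjointE E (k z)⁻¹ x) y w := by
    have h : (fun z => leftLogDeriv E f (p, z) (x, 0)) =ᶠ[nhds y]
        fun z => adjointE E (k z)⁻¹ x := by
      filter_upwards [hk_diff] with z hz
      rw [leftLogDeriv_mul_prod (q := (p, z)) (mdifferentiableAt_chart_symm hp) hz, hone]
      simp
    rw [← h.fderiv_eq,
      ← fderiv_apply_comp (ι := fun z => (p, z)) hδf (hasFDerivAt_prodMk_right p y) w (x, 0)]
    rfl
  have h := maurerCartan_leftLogDeriv hf (x, 0) (0, w)
  rw [hleft, hright, leftLogDeriv_mul_prod (mdifferentiableAt_chart_symm hp)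
    (hk.mdifferentiableAt (by simp)), hone] at h
  simpa [← lieE_skew (leftLogDeriv E k y w)] using h

theorem modelDeriv_adjointE_inv_apply {x₀ : G} {U : G → E} (hU : MDiffAt U x₀) (v : E) :
    modelDeriv E E (fun g => adjointE E g⁻¹ (U g)) x₀ v =
      adjointE E x₀⁻¹ (modelDeriv E E U x₀ v) -
        lieE E G (thetaLE E x₀ v) (adjointE E x₀⁻¹ (U x₀)) := by
  let p : E := extChartAt 𝓘(ℝ, E) x₀ x₀
  let σ : E → G := (extChartAt 𝓘(ℝ, E) x₀).symm
  have hp : p ∈ (extChartAt 𝓘(ℝ, E) x₀).target := mem_extChartAt_target x₀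
  have hσ : CMDiffAt ∞ σ p := contMDiffAt_chart_symm hp
  have hσp : σ p = x₀ := extChartAt_to_inv x₀
  have hδσ : leftLogDeriv E σ p = thetaLE E x₀ := chartThetaL_self x₀
  have hAd : DifferentiableAt ℝ (fun y => adjointE E (σ y)⁻¹) p :=
    ((contMDiff_adjointE.contMDiffAt.comp p hσ.inv).mdifferentiableAt (by simp)).differentiableAt
  have hUσ : DifferentiableAt ℝ (fun y => U (σ y)) p := differentiableAt_comp_chart_symm hU
  have hAd_apply (x : E) : fderiv ℝ (fun y => adjointE E (σ y)⁻¹) p v x =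
      -lieE E G (thetaLE E x₀ v) (adjointE E x₀⁻¹ x) := by
    rw [← hδσ, ← congrArg (fun g => adjointE E g⁻¹) hσp, ← fderiv_adjointE_inv hσ]
    exact fderiv_apply_comp (ι := id) hAd (hasFDerivAt_id p) v x
  rw [← fderiv_comp_chart_symm (mdifferentiableAt_adjointE_inv_apply hU), fderiv_clm_apply hAd hUσ,
    add_apply, ContinuousLinearMap.comp_apply, ContinuousLinearMap.flip_apply, hAd_apply,
    fderiv_comp_chart_symm hU, hσp]
  exact (sub_eq_add_neg _ _).symm

end MaurerCartan

/-! ### Courant brackets of the sections `s(a)` -/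

namespace IsInvariantInnerProduct

variable {V : Type*} [LieRing V] [LieAlgebra ℝ V] {B : LinearMap.BilinForm ℝ V}

theorem apply_lie_right (hB : IsInvariantInnerProduct B) (x y z : V) :
    B x ⁅y, z⁆ = B ⁅x, y⁆ z := by
  rw [← lie_skew x y, map_neg, LinearMap.neg_apply, hB.lie_left, neg_neg]

theorem apply_lie_right_eq_zero (hB : IsInvariantInnerProduct B) {v : Fin 3 → V} {i j : Fin 3}
    (hv : v i = v j) (hij : i ≠ j) : B (v 0) ⁅v 1, v 2⁆ = 0 := by
  have h01 (x z : V) : B x ⁅x, z⁆ = 0 := by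
    rw [hB.apply_lie_right, lie_self, map_zero, LinearMap.zero_apply]
  have h02 (x y : V) : B x ⁅y, x⁆ = 0 := by
    rw [← lie_skew, map_neg, h01, neg_zero]
  fin_cases i <;> fin_cases j <;> simp_all

end IsInvariantInnerProduct

section BiinvariantMetric

variable {E : Type*} [NormedAddCommGroup E] [NormedSpace ℝ E] [FiniteDimensional ℝ E]
  {G : Type*} [TopologicalSpace G] [ChartedSpace E G] [Group G]

/-- The bilinear form `B`, as a continuous bilinear form on the model space. -/
def formE (B : LinearMap.BilinForm ℝ (LieAlg E G)) : E →L[ℝ] E →L[ℝ] ℝ :=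
  LinearMap.toContinuousBilinearMap (𝕜 := ℝ) (E := E) (F := E) (G := ℝ) B

variable {B : LinearMap.BilinForm ℝ (LieAlg E G)}

namespace IsBiinvariantMetric

theorem formE_symm (hB : IsBiinvariantMetric B) (x y : E) : formE B x y = formE B y x :=
  hB.symm x y

theorem formE_adjointE (hB : IsBiinvariantMetric B) (g : G) (x y : E) :
    formE B (adjointE E g x) (adjointE E g y) = formE B x y :=
  hB.invariant g x y

variable [LieGroup 𝓘(ℝ, E) ∞ G]

theorem formE_adjointE_left (hB : IsBiinvariantMetric B) (g : G) (x y : E) :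
    formE B (adjointE E g x) y = formE B x (adjointE E g⁻¹ y) := by
  rw [← hB.formE_adjointE g x, adjointE_adjointE_inv]

variable [CompleteSpace E]

theorem formE_lieE_left (hB : IsBiinvariantMetric B) (x y z : E) :
    formE B (lieE E G x y) z = -formE B y (lieE E G x z) := by
  let p : E := extChartAt 𝓘(ℝ, E) (1 : G) 1
  let σ : E → G := (extChartAt 𝓘(ℝ, E) (1 : G)).symm
  have hσ : CMDiffAt ∞ σ p := contMDiffAt_chart_symm (mem_extChartAt_target 1)
  have hσp : σ p = 1 := extChartAt_to_inv 1
  have hone : leftLogDeriv E σ p = .id ℝ E := chartThetaL_one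
  have hAd (x : E) : DifferentiableAt ℝ (fun z => adjointE E (σ z)⁻¹ x) p :=
    (((contMDiff_adjointE.contMDiffAt.comp p hσ.inv).clm_apply
      contMDiffAt_const).mdifferentiableAt (by simp)).differentiableAt
  have hconst : (fun w => formE B (adjointE E (σ w)⁻¹ y) (adjointE E (σ w)⁻¹ z)) =
      fun _ => formE B y z := funext fun w => hB.formE_adjointE (σ w)⁻¹ y z
  have hderiv := (((hasFDerivAt_const (formE B) p).clm_apply (hAd y).hasFDerivAt).clm_apply
    (hAd z).hasFDerivAt).fderiv
  rw [hconst] at hderiv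
  have hx := DFunLike.congr_fun hderiv x
  simp [fderiv_adjointE_inv hσ, hσp, hone, adjointE_one] at hx
  linarith

theorem isInvariantInnerProduct (hB : IsBiinvariantMetric B) : IsInvariantInnerProduct B where
  symm := hB.symm
  pos := hB.pos
  lie_left := hB.formE_lieE_left

theorem alternatization_trilinearBracketForm (hB : IsBiinvariantMetric B)
    (v : Fin 3 → LieAlg E G) :
    ContinuousMultilinearMap.alternatization (trilinearBracketForm B) v =
      6 * B ⁅v 0, v 1⁆ (v 2) := by
  let A : LieAlg E G [⋀^Fin 3]→ₗ[ℝ] ℝ :=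
    { (trilinearBracketForm B).toMultilinearMap with
      map_eq_zero_of_eq' := fun _ _ _ hv hij =>
        hB.isInvariantInnerProduct.apply_lie_right_eq_zero hv hij }
  have h : (ContinuousMultilinearMap.alternatization (trilinearBracketForm B)).toAlternatingMap =
      Nat.factorial 3 • A := by
    rw [ContinuousMultilinearMap.alternatization_apply_toAlternatingMap]
    exact A.coe_alternatization
  refine (DFunLike.congr_fun h v).trans ?_
  rw [← hB.isInvariantInnerProduct.apply_lie_right]
  exact (nsmul_eq_mul _ _).trans (by norm_num [Nat.factorial]; rfl)

theorem cartanThreeForm_apply (hB : IsBiinvariantMetric B) (g : G) (m : Fin 3 → E) :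
    cartanThreeForm B g m =
      formE B (lieE E G (thetaLE E g (m 0)) (thetaLE E g (m 1))) (thetaLE E g (m 2)) := by
  refine (congrArg ((1 / 6 : ℝ) * ·)
    (hB.alternatization_trilinearBracketForm fun i => thetaL g (m i))).trans ?_
  exact (mul_assoc _ _ _).symm.trans (by norm_num; rfl)

end IsBiinvariantMetric

end BiinvariantMetric

section CourantBracket

variable {E : Type*} [NormedAddCommGroup E] [NormedSpace ℝ E]
  {F : Type*} [NormedAddCommGroup F] [NormedSpace ℝ F]
  {F' : Type*} [NormedAddCommGroup F'] [NormedSpace ℝ F']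
  {G : Type*} [TopologicalSpace G] [ChartedSpace E G]

theorem fderiv_clm_comp_apply {E' E'' : Type*} [NormedAddCommGroup E'] [NormedSpace ℝ E']
    [NormedAddCommGroup E''] [NormedSpace ℝ E''] (b : F →L[ℝ] E'' →L[ℝ] F') {f : E → F}
    {Θ : E → E' →L[ℝ] E''} {y : E} (hf : DifferentiableAt ℝ f y) (hΘ : DifferentiableAt ℝ Θ y)
    (v : E) (w : E') :
    fderiv ℝ (fun z => (b (f z)).comp (Θ z)) y v w =
      b (f y) (fderiv ℝ Θ y v w) + b (fderiv ℝ f y v) (Θ y w) := by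
  have h := ((b.hasFDerivAt.comp y hf.hasFDerivAt).clm_comp hΘ.hasFDerivAt).fderiv
  exact DFunLike.congr_fun (DFunLike.congr_fun h v) w

theorem dFun_bilin_apply_sub [IsManifold 𝓘(ℝ, E) ∞ G] (b : F →L[ℝ] F →L[ℝ] ℝ)
    {f f' k k' : G → F} {x : G} (hf : MDiffAt f x) (hf' : MDiffAt f' x) (hk : MDiffAt k x)
    (hk' : MDiffAt k' x) (v : E) :
    dFun (E := E) (fun y => b (f y) (k y) - b (f' y) (k' y)) x v =
      b (modelDeriv E F f x v) (k x) + b (f x) (modelDeriv E F k x v) -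
        (b (modelDeriv E F f' x v) (k' x) + b (f' x) (modelDeriv E F k' x v)) := by
  rw [← modelDeriv_bilin_apply b hf hk, ← modelDeriv_bilin_apply b hf' hk']
  exact DFunLike.congr_fun (mfderiv_sub (mdifferentiableAt_bilin_apply b hf hk)
    (mdifferentiableAt_bilin_apply b hf' hk')) v

variable [Group G] [FiniteDimensional ℝ E] {B : LinearMap.BilinForm ℝ (LieAlg E G)}

/-- The section `X^L + B(θ^L, Y)` of `TG ⊕ T^*G`, for functions `X` and `Y` with values in `𝔤`. -/
def leftSection (B : LinearMap.BilinForm ℝ (LieAlg E G)) (X Y : G → E) : GenSection E G :=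
  fun g => (leftFieldE E g (X g), ((formE B).flip (Y g)).comp (thetaLE E g))

variable [LieGroup 𝓘(ℝ, E) ∞ G] [CompleteSpace E]

theorem thetaLE_fderiv_chartField {x₀ : G} {u : ∀ g : G, TangentSpace 𝓘(ℝ, E) g}
    (hu : MDiffAt (fun g => thetaLE E g (u g)) x₀) (v : E) :
    thetaLE E x₀ (fderiv ℝ (chartField x₀ u) (extChartAt 𝓘(ℝ, E) x₀ x₀) v) +
        fderiv ℝ (chartThetaL x₀) (extChartAt 𝓘(ℝ, E) x₀ x₀) (u x₀) v =
      modelDeriv E E (fun g => thetaLE E g (u g)) x₀ v -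
        lieE E G (thetaLE E x₀ (u x₀)) (thetaLE E x₀ v) := by
  have hp := mem_extChartAt_target (I := 𝓘(ℝ, E)) x₀
  have hfield : DifferentiableAt ℝ (chartField x₀ u) (extChartAt 𝓘(ℝ, E) x₀ x₀) :=
    differentiableAt_chartField hp (by rwa [extChartAt_to_inv])
  have hmc := maurerCartan_chartThetaL (E := E) x₀ (u x₀) v
  have hderiv := DFunLike.congr_fun (fderiv_chartThetaL_chartField hu) v
  rw [fderiv_clm_apply (differentiableAt_chartThetaL hp) hfield, chartThetaL_self,
    chartField_self] at hderiv
  rw [← hderiv, sub_eq_add_neg _ (lieE E G _ _), ← hmc]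
  exact (add_add_sub_cancel _ _ _).symm

theorem lieDerivOneForm_formE_thetaLE {x₀ : G} {u : ∀ g : G, TangentSpace 𝓘(ℝ, E) g} {Y : G → E}
    (hu : MDiffAt (fun g => thetaLE E g (u g)) x₀) (hY : MDiffAt Y x₀) (v : E) :
    lieDerivOneForm u (fun g => ((formE B).flip (Y g)).comp (thetaLE E g)) x₀ v =
      formE B (thetaLE E x₀ v) (modelDeriv E E Y x₀ (u x₀)) +
        formE B (modelDeriv E E (fun g => thetaLE E g (u g)) x₀ v -
          lieE E G (thetaLE E x₀ (u x₀)) (thetaLE E x₀ v)) (Y x₀) := by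
  let p : E := extChartAt 𝓘(ℝ, E) x₀ x₀
  let σ : E → G := (extChartAt 𝓘(ℝ, E) x₀).symm
  have hp : p ∈ (extChartAt 𝓘(ℝ, E) x₀).target := mem_extChartAt_target x₀
  have hσp : σ p = x₀ := extChartAt_to_inv x₀
  let η (y : E) : E →L[ℝ] ℝ :=
    (((formE B).flip (Y (σ y))).comp (thetaLE E (σ y))).comp (modelDeriv E E σ y)
  have hη : η =ᶠ[nhds p] fun y => ((formE B).flip (Y (σ y))).comp (chartThetaL x₀ y) := by
    filter_upwards [(isOpen_extChartAt_target x₀).mem_nhds hp] with y hy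
    rw [chartThetaL_eq hy]
    rfl
  have hYσ : DifferentiableAt ℝ (fun y => Y (σ y)) p := differentiableAt_comp_chart_symm hY
  have hunfold : lieDerivOneForm u (fun g => ((formE B).flip (Y g)).comp (thetaLE E g)) x₀ v =
      fderiv ℝ η p (chartField x₀ u p) (modelDeriv E E (extChartAt 𝓘(ℝ, E) x₀) x₀ v) +
        η p (fderiv ℝ (chartField x₀ u) p (modelDeriv E E (extChartAt 𝓘(ℝ, E) x₀) x₀ v)) := rfl
  have hηderiv := fderiv_clm_comp_apply (formE B).flip hYσ (differentiableAt_chartThetaL hp)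
    (u x₀) v
  rw [fderiv_comp_chart_symm hY, chartThetaL_self, hσp] at hηderiv
  rw [hunfold, hη.fderiv_eq, hη.eq_of_nhds, modelDeriv_chart_self, chartField_self,
    ContinuousLinearMap.id_apply, chartThetaL_self, hσp, ← thetaLE_fderiv_chartField hu]
  refine (congrArg (· + _) hηderiv).trans ?_
  simp only [ContinuousLinearMap.flip_apply, ContinuousLinearMap.comp_apply, map_add, add_apply]
  ring

theorem IsBiinvariantMetric.contractTwo_cartanThreeForm (hB : IsBiinvariantMetric B) (g : G)
    (u v w : E) : contractTwo (cartanThreeForm B) g u v w =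
      formE B (lieE E G (thetaLE E g u) (thetaLE E g v)) (thetaLE E g w) :=
  hB.cartanThreeForm_apply g (Function.update ![u, v, 0] 2 w)

theorem thetaLE_courant_leftSection_fst (H : ThreeForm E G) {x₀ : G} {X X' Y Y' : G → E}
    (hX : MDiffAt X x₀) (hX' : MDiffAt X' x₀) :
    thetaLE E x₀ (courant H (leftSection B X Y) (leftSection B X' Y') x₀).1 =
      modelDeriv E E X' x₀ (leftFieldE E x₀ (X x₀)) -
        modelDeriv E E X x₀ (leftFieldE E x₀ (X' x₀)) + lieE E G (X x₀) (X' x₀) := by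
  have h (X : G → E) : (fun g => thetaLE E g (leftFieldE E g (X g))) = X :=
    funext fun g => thetaLE_leftFieldE g (X g)
  have hmain := thetaLE_mlieBracket (x₀ := x₀) (V := fun g => leftFieldE E g (X g))
    (W := fun g => leftFieldE E g (X' g)) (by rwa [h]) (by rwa [h])
  rw [h, h, thetaLE_leftFieldE, thetaLE_leftFieldE] at hmain
  exact hmain

theorem IsBiinvariantMetric.courant_leftSection_snd_apply (hB : IsBiinvariantMetric B) {x₀ : G}
    {X X' Y Y' : G → E} (hX : MDiffAt X x₀) (hX' : MDiffAt X' x₀) (hY : MDiffAt Y x₀)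
    (hY' : MDiffAt Y' x₀) (w : E) :
    (courant (cartanThreeForm B) (leftSection B X Y) (leftSection B X' Y') x₀).2 w =
      formE B (thetaLE E x₀ w) (modelDeriv E E Y' x₀ (leftFieldE E x₀ (X x₀)) -
        modelDeriv E E Y x₀ (leftFieldE E x₀ (X' x₀)) + lieE E G (X x₀) (Y' x₀) -
        lieE E G (X' x₀) (Y x₀) - lieE E G (X x₀) (X' x₀)) +
      (1 / 2) * (formE B (modelDeriv E E X x₀ w) (Y' x₀) - formE B (X x₀) (modelDeriv E E Y' x₀ w) -
        (formE B (modelDeriv E E X' x₀ w) (Y x₀) - formE B (X' x₀) (modelDeriv E E Y x₀ w))) := by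
  have hθ (X : G → E) : (fun g => thetaLE E g (leftFieldE E g (X g))) = X :=
    funext fun g => thetaLE_leftFieldE g (X g)
  have hlie {X Y : G → E} (hX : MDiffAt X x₀) (hY : MDiffAt Y x₀) :
      lieDerivOneForm (fun g => leftFieldE E g (X g)) (fun g => (leftSection B X Y g).2) x₀ w = _ :=
    lieDerivOneForm_formE_thetaLE (u := fun g => leftFieldE E g (X g)) (by rwa [hθ]) hY w
  have hLie := hlie hX hY'
  have hLie' := hlie hX' hY
  have hH := hB.contractTwo_cartanThreeForm x₀ (leftFieldE E x₀ (X x₀)) (leftFieldE E x₀ (X' x₀)) w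
  have hd := dFun_bilin_apply_sub (formE B) hX hX' hY' hY w
  have hunfold : (courant (cartanThreeForm B) (leftSection B X Y) (leftSection B X' Y') x₀).2 w =
      lieDerivOneForm (fun g => leftFieldE E g (X g)) (fun g => (leftSection B X Y' g).2) x₀ w -
      lieDerivOneForm (fun g => leftFieldE E g (X' g)) (fun g => (leftSection B X' Y g).2) x₀ w -
      (1 / 2) * dFun (E := E) (fun g => formE B (thetaLE E g (leftFieldE E g (X g))) (Y' g) -
        formE B (thetaLE E g (leftFieldE E g (X' g))) (Y g)) x₀ w -
      contractTwo (cartanThreeForm B) x₀ (leftFieldE E x₀ (X x₀)) (leftFieldE E x₀ (X' x₀)) w := rfl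
  rw [hθ, thetaLE_leftFieldE] at hLie hLie'
  rw [thetaLE_leftFieldE, thetaLE_leftFieldE] at hH
  simp only [thetaLE_leftFieldE] at hunfold
  rw [hunfold, hLie, hLie', hd, hH]
  simp only [map_sub, map_add, sub_apply, hB.formE_lieE_left (X x₀) (thetaLE E x₀ w),
    hB.formE_lieE_left (X' x₀) (thetaLE E x₀ w), hB.formE_symm (lieE E G _ _)]
  ring

end CourantBracket

section Trivialization

variable {E : Type*} [NormedAddCommGroup E] [NormedSpace ℝ E] [FiniteDimensional ℝ E]
  {G : Type*} [TopologicalSpace G] [ChartedSpace E G] [Group G]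
  {B : LinearMap.BilinForm ℝ (LieAlg E G)}

/-- The form `B_𝔡 = B ⊕ (-B)`, as a continuous bilinear form on the square of the model space. -/
def doubleFormE (B : LinearMap.BilinForm ℝ (LieAlg E G)) : E × E →L[ℝ] E × E →L[ℝ] ℝ :=
  LinearMap.toContinuousBilinearMap (𝕜 := ℝ) (E := E × E) (F := E × E) (G := ℝ) (doubleForm B)

/-- The one-form `B_𝔡(da, b) - B_𝔡(a, db)` at `x`, for functions `a` and `b` with values in `𝔡`. -/
def exchangeForm (B : LinearMap.BilinForm ℝ (LieAlg E G)) (a b : G → E × E) (x : G) : E →L[ℝ] ℝ :=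
  ((doubleFormE B).flip (b x)).comp (modelDeriv E (E × E) a x) -
    (doubleFormE B (a x)).comp (modelDeriv E (E × E) b x)

theorem IsBiinvariantMetric.exchangeForm_apply (hB : IsBiinvariantMetric B) (a b : G → E × E)
    (x : G) (w : E) : exchangeForm B a b x w =
      formE B (modelDeriv E (E × E) a x w).1 (b x).1 -
        formE B (adjointE E x⁻¹ (modelDeriv E (E × E) a x w).2) (adjointE E x⁻¹ (b x).2) -
      (formE B (a x).1 (modelDeriv E (E × E) b x w).1 -
        formE B (adjointE E x⁻¹ (a x).2) (adjointE E x⁻¹ (modelDeriv E (E × E) b x w).2)) := by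
  rw [hB.formE_adjointE, hB.formE_adjointE]
  rfl

variable [LieGroup 𝓘(ℝ, E) ∞ G]

theorem IsBiinvariantMetric.sMap_eq_leftSection (hB : IsBiinvariantMetric B) (a : G → E × E) :
    (fun g => sMap B g (a g)) = leftSection B (fun g => (a g).1 - adjointE E g⁻¹ (a g).2)
      (fun g => (a g).1 + adjointE E g⁻¹ (a g).2) := by
  funext g
  refine Prod.ext ?_ (ContinuousLinearMap.ext fun v : E => ?_)
  · exact (congrArg (leftFieldE E g (a g).1 - ·) (rightFieldE_apply g (a g).2)).trans
      (map_sub (leftFieldE E g) _ _).symm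
  · have h : formE B (thetaRE E g v) (a g).2 =
        formE B (thetaLE E g v) (adjointE E g⁻¹ (a g).2) := by
      rw [thetaRE_apply, hB.formE_adjointE_left]
    exact (congrArg (formE B (thetaLE E g v) (a g).1 + ·) h).trans (map_add _ _ _).symm

theorem IsBiinvariantMetric.sMap_eq (hB : IsBiinvariantMetric B) (g : G) (a : E × E) :
    sMap B g a = (leftFieldE E g (a.1 - adjointE E g⁻¹ a.2),
      ((formE B).flip (a.1 + adjointE E g⁻¹ a.2)).comp (thetaLE E g)) :=
  congrFun (hB.sMap_eq_leftSection fun _ => a) g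

variable [CompleteSpace E]

/-- The bracket `D_{ρ(a)} b - D_{ρ(b)} a + [a, b]` at `x` of functions `a` and `b` with values in
`𝔡`, where `ρ` is the vector field component of `s`: the bracket of the action Lie algebroid of
the infinitesimal action of `𝔡` on `G`. -/
def actionBracket (B : LinearMap.BilinForm ℝ (LieAlg E G)) (a b : G → E × E) (x : G) : E × E :=
  modelDeriv E (E × E) b x (sMap B x (a x)).1 - modelDeriv E (E × E) a x (sMap B x (b x)).1 +
    (lieE E G (a x).1 (b x).1, lieE E G (a x).2 (b x).2)

theorem IsBiinvariantMetric.half_exchange_apply (hB : IsBiinvariantMetric B)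
    (a a' b b' c c' d d' z : E) :
    (1 / 2) * (formE B (a' - (c' - lieE E G z c)) (b + d) -
        formE B (a - c) (b' + (d' - lieE E G z d)) -
      (formE B (b' - (d' - lieE E G z d)) (a + c) -
        formE B (b - d) (a' + (c' - lieE E G z c)))) =
      formE B a' b - formE B c' d - (formE B a b' - formE B c d') +
        2 * formE B z (lieE E G c d) := by
  have hcd : formE B (lieE E G z c) d = formE B z (lieE E G c d) := by
    rw [← lieE_skew, map_neg, neg_apply, hB.formE_lieE_left, neg_neg]
  have hdc : formE B (lieE E G z d) c = -formE B z (lieE E G c d) := by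
    rw [hB.formE_lieE_left, hB.formE_symm, hcd]
  simp only [map_add, map_sub, sub_apply, hB.formE_symm b, hB.formE_symm d,
    hB.formE_symm b', hB.formE_symm d', hB.formE_symm c (lieE E G z d),
    hB.formE_symm a (lieE E G z d), hcd, hdc]
  ring

section Derivatives

variable {a b : G → E × E} {x : G} (ha : MDifferentiableAt 𝓘(ℝ, E) 𝓘(ℝ, E × E) a x)
  (hb : MDifferentiableAt 𝓘(ℝ, E) 𝓘(ℝ, E × E) b x)
include ha

theorem modelDeriv_adjointE_inv_snd (v : E) :
    modelDeriv E E (fun g => adjointE E g⁻¹ (a g).2) x v =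
      adjointE E x⁻¹ (modelDeriv E (E × E) a x v).2 -
        lieE E G (thetaLE E x v) (adjointE E x⁻¹ (a x).2) := by
  rw [modelDeriv_adjointE_inv_apply (mdifferentiableAt_snd_comp ha), modelDeriv_snd_apply ha]

theorem modelDeriv_fst_add_adjointE_inv_snd (v : E) :
    modelDeriv E E (fun g => (a g).1 + adjointE E g⁻¹ (a g).2) x v =
      (modelDeriv E (E × E) a x v).1 + (adjointE E x⁻¹ (modelDeriv E (E × E) a x v).2 -
        lieE E G (thetaLE E x v) (adjointE E x⁻¹ (a x).2)) := by
  rw [← modelDeriv_fst_apply ha, ← modelDeriv_adjointE_inv_snd ha]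
  exact DFunLike.congr_fun (mfderiv_add (mdifferentiableAt_fst_comp ha)
    (mdifferentiableAt_adjointE_inv_apply (mdifferentiableAt_snd_comp ha))) v

theorem modelDeriv_fst_sub_adjointE_inv_snd (v : E) :
    modelDeriv E E (fun g => (a g).1 - adjointE E g⁻¹ (a g).2) x v =
      (modelDeriv E (E × E) a x v).1 - (adjointE E x⁻¹ (modelDeriv E (E × E) a x v).2 -
        lieE E G (thetaLE E x v) (adjointE E x⁻¹ (a x).2)) := by
  rw [← modelDeriv_fst_apply ha, ← modelDeriv_adjointE_inv_snd ha]
  exact DFunLike.congr_fun (mfderiv_sub (mdifferentiableAt_fst_comp ha)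
    (mdifferentiableAt_adjointE_inv_apply (mdifferentiableAt_snd_comp ha))) v

include hb

theorem IsBiinvariantMetric.thetaLE_courant_sMap_fst (hB : IsBiinvariantMetric B)
    (H : ThreeForm E G) :
    thetaLE E x (courant H (fun g => sMap B g (a g)) (fun g => sMap B g (b g)) x).1 =
      (actionBracket B a b x).1 - adjointE E x⁻¹ (actionBracket B a b x).2 := by
  rw [hB.sMap_eq_leftSection, hB.sMap_eq_leftSection, thetaLE_courant_leftSection_fst,
    modelDeriv_fst_sub_adjointE_inv_snd ha, modelDeriv_fst_sub_adjointE_inv_snd hb]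
  · simp only [actionBracket, hB.sMap_eq, thetaLE_leftFieldE, Prod.fst_add, Prod.snd_add,
      Prod.fst_sub, Prod.snd_sub, map_add, map_sub, sub_apply, adjointE_lieE,
      ← lieE_skew (adjointE E x⁻¹ (a x).2) (b x).1,
      ← lieE_skew (adjointE E x⁻¹ (a x).2) (adjointE E x⁻¹ (b x).2)]
    abel
  · exact mdifferentiableAt_fst_sub_adjointE_inv_snd ha
  · exact mdifferentiableAt_fst_sub_adjointE_inv_snd hb

theorem IsBiinvariantMetric.courant_sMap_snd_apply (hB : IsBiinvariantMetric B) (w : E) :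
    (courant (cartanThreeForm B) (fun g => sMap B g (a g)) (fun g => sMap B g (b g)) x).2 w =
      formE B (thetaLE E x w) ((actionBracket B a b x).1 +
        adjointE E x⁻¹ (actionBracket B a b x).2) + exchangeForm B a b x w := by
  rw [hB.sMap_eq_leftSection, hB.sMap_eq_leftSection, hB.courant_leftSection_snd_apply
    (mdifferentiableAt_fst_sub_adjointE_inv_snd ha) (mdifferentiableAt_fst_sub_adjointE_inv_snd hb)
    (mdifferentiableAt_fst_add_adjointE_inv_snd ha) (mdifferentiableAt_fst_add_adjointE_inv_snd hb)]
  simp only [modelDeriv_fst_sub_adjointE_inv_snd ha, modelDeriv_fst_sub_adjointE_inv_snd hb,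
    modelDeriv_fst_add_adjointE_inv_snd ha, modelDeriv_fst_add_adjointE_inv_snd hb,
    hB.half_exchange_apply, hB.exchangeForm_apply]
  simp only [actionBracket, hB.sMap_eq, thetaLE_leftFieldE, Prod.fst_add, Prod.snd_add,
    Prod.fst_sub, Prod.snd_sub, map_add, map_sub, sub_apply, adjointE_lieE,
    ← lieE_skew (adjointE E x⁻¹ (a x).2) (b x).1,
    ← lieE_skew (adjointE E x⁻¹ (a x).2) (adjointE E x⁻¹ (b x).2), ← lieE_skew (a x).1 (b x).1,
    ← lieE_skew (a x).1 (adjointE E x⁻¹ (b x).2), map_neg]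
  ring

theorem IsBiinvariantMetric.courant_sMap (hB : IsBiinvariantMetric B) :
    courant (cartanThreeForm B) (fun g => sMap B g (a g)) (fun g => sMap B g (b g)) x =
      sMap B x (actionBracket (E := E) B a b x) +
        ((0, exchangeForm (E := E) B a b x) : GenTangent E x) := by
  refine Eq.trans ?_ (congrArg (· + _) (hB.sMap_eq x (actionBracket B a b x)).symm)
  refine Prod.ext ?_ (ContinuousLinearMap.ext fun w : E => ?_)
  · refine Eq.trans ?_ ((congrArg (⇑(leftFieldE E x))
      (hB.thetaLE_courant_sMap_fst ha hb (cartanThreeForm B))).trans (add_zero _).symm)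
    exact (leftFieldE_thetaLE (E := E) x _).symm
  · exact hB.courant_sMap_snd_apply ha hb w

end Derivatives

end Trivialization

/-! ### Induced fields of endomorphisms -/

section SmoothSections

variable {E : Type*} [NormedAddCommGroup E] [NormedSpace ℝ E]
  {M : Type*} [TopologicalSpace M] [ChartedSpace E M] [IsManifold 𝓘(ℝ, E) ∞ M]

theorem contMDiffAt_tangent_iff_chart (V : M → E) (x₀ : M) :
    ContMDiffAt 𝓘(ℝ, E) 𝓘(ℝ, E).tangent ∞ (fun x => (⟨x, V x⟩ : TangentBundle 𝓘(ℝ, E) M)) x₀ ↔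
      CMDiffAt ∞ (fun x => modelDeriv E E (extChartAt 𝓘(ℝ, E) x₀) x (V x)) x₀ := by
  refine (contMDiffAt_section (F := E) (E := TangentSpace 𝓘(ℝ, E)) (s := V) x₀).trans
    (Filter.EventuallyEq.contMDiffAt_iff ?_)
  filter_upwards [extChartAt_source_mem_nhds (I := 𝓘(ℝ, E)) x₀] with x hx
  have hx' : x ∈ (chartAt E x₀).source := by simpa using hx
  have h (v : TangentSpace 𝓘(ℝ, E) x) :
      (trivializationAt E (TangentSpace 𝓘(ℝ, E)) x₀ ⟨x, v⟩).2 =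
        (trivializationAt E (TangentSpace 𝓘(ℝ, E)) x₀).continuousLinearMapAt ℝ x v := by
    rw [Trivialization.continuousLinearMapAt_apply, Trivialization.coe_linearMapAt_of_mem]
    simpa using hx'
  exact (h (V x)).trans
    (DFunLike.congr_fun (TangentBundle.continuousLinearMapAt_trivializationAt hx') (V x))

theorem contMDiffAt_cotangent_iff_chart (α : M → E →L[ℝ] ℝ) (x₀ : M) :
    ContMDiffAt 𝓘(ℝ, E) (𝓘(ℝ, E).prod 𝓘(ℝ, E →L[ℝ] ℝ)) ∞
      (fun x => TotalSpace.mk' (E →L[ℝ] ℝ)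
        (E := fun y : M => TangentSpace 𝓘(ℝ, E) y →L[ℝ] Trivial M ℝ y) x (α x)) x₀ ↔
      CMDiffAt ∞ (fun x => (α x).comp (modelDeriv E E (extChartAt 𝓘(ℝ, E) x₀).symm
        (extChartAt 𝓘(ℝ, E) x₀ x))) x₀ := by
  refine ((contMDiffAt_hom_bundle _).trans (and_iff_right contMDiffAt_id)).trans
    (Filter.EventuallyEq.contMDiffAt_iff ?_)
  filter_upwards [extChartAt_source_mem_nhds (I := 𝓘(ℝ, E)) x₀] with x hx
  have hx' : x ∈ (chartAt E x₀).source := by simpa using hx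
  have hsymm : mfderivWithin 𝓘(ℝ, E) 𝓘(ℝ, E) (extChartAt 𝓘(ℝ, E) x₀).symm (Set.range 𝓘(ℝ, E))
      (extChartAt 𝓘(ℝ, E) x₀ x) =
        modelDeriv E E (extChartAt 𝓘(ℝ, E) x₀).symm (extChartAt 𝓘(ℝ, E) x₀ x) := by
    rw [modelDeriv, modelWithCornersSelf_coe, Set.range_id, mfderivWithin_univ]
  have htriv : (trivializationAt ℝ (Trivial M ℝ) x₀).continuousLinearMapAt ℝ x = .id ℝ ℝ :=
    Trivial.continuousLinearMapAt_trivialization ℝ M ℝ x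
  refine ContinuousLinearMap.ext fun w => (DFunLike.congr_fun htriv (α x
    ((trivializationAt E (TangentSpace 𝓘(ℝ, E)) x₀).symmL ℝ x w))).trans ?_
  exact congrArg (α x)
    (DFunLike.congr_fun ((TangentBundle.symmL_trivializationAt hx').trans hsymm) w)

end SmoothSections

section LeftTrivialization

variable {E : Type*} [NormedAddCommGroup E] [NormedSpace ℝ E]
  {G : Type*} [TopologicalSpace G] [ChartedSpace E G] [Group G] [LieGroup 𝓘(ℝ, E) ∞ G]

theorem chartThetaL_chart {x₀ x : G} (hx : x ∈ (extChartAt 𝓘(ℝ, E) x₀).source) :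
    chartThetaL x₀ (extChartAt 𝓘(ℝ, E) x₀ x) = (thetaLE E x).comp
      (modelDeriv E E (extChartAt 𝓘(ℝ, E) x₀).symm (extChartAt 𝓘(ℝ, E) x₀ x)) := by
  rw [chartThetaL_eq ((extChartAt 𝓘(ℝ, E) x₀).map_source hx), (extChartAt 𝓘(ℝ, E) x₀).left_inv hx]

theorem chartThetaL_chart_comp_modelDeriv {x₀ x : G} (hx : x ∈ (extChartAt 𝓘(ℝ, E) x₀).source) :
    (chartThetaL x₀ (extChartAt 𝓘(ℝ, E) x₀ x)).comp
      (modelDeriv E E (extChartAt 𝓘(ℝ, E) x₀) x) = thetaLE E x := by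
  have h := modelDeriv_symm_comp_chart ((extChartAt 𝓘(ℝ, E) x₀).map_source hx)
  rw [(extChartAt 𝓘(ℝ, E) x₀).left_inv hx] at h
  rw [chartThetaL_chart hx, ContinuousLinearMap.comp_assoc, h, ContinuousLinearMap.comp_id]

theorem leftFieldE_comp_chartThetaL_chart {x₀ x : G}
    (hx : x ∈ (extChartAt 𝓘(ℝ, E) x₀).source) :
    (leftFieldE E x).comp (chartThetaL x₀ (extChartAt 𝓘(ℝ, E) x₀ x)) =
      modelDeriv E E (extChartAt 𝓘(ℝ, E) x₀).symm (extChartAt 𝓘(ℝ, E) x₀ x) := by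
  rw [chartThetaL_chart hx, ← ContinuousLinearMap.comp_assoc, leftFieldE_comp_thetaLE,
    ContinuousLinearMap.id_comp]

theorem contMDiffAt_chartThetaL_chart (x₀ : G) :
    CMDiffAt ∞ (fun x => chartThetaL x₀ (extChartAt 𝓘(ℝ, E) x₀ x)) x₀ :=
  ContMDiffAt.comp x₀ (contDiffAt_leftLogDeriv
    (contMDiffAt_chart_symm (mem_extChartAt_target x₀))).contMDiffAt contMDiffAt_extChartAt

variable [CompleteSpace E]

theorem contMDiffAt_chartThetaL_chart_inverse (x₀ : G) :
    CMDiffAt ∞ (fun x => (chartThetaL x₀ (extChartAt 𝓘(ℝ, E) x₀ x)).inverse) x₀ :=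
  ContMDiffAt.comp x₀ (g := ContinuousLinearMap.inverse)
    (isInvertible_chartThetaL (mem_extChartAt_target x₀)).contDiffAt_map_inverse.contMDiffAt
    (contMDiffAt_chartThetaL_chart x₀)

theorem contMDiff_tangent_iff_thetaLE (V : G → E) :
    ContMDiff 𝓘(ℝ, E) 𝓘(ℝ, E).tangent ∞ (fun x => (⟨x, V x⟩ : TangentBundle 𝓘(ℝ, E) G)) ↔
      CMDiff ∞ (fun x => thetaLE E x (V x)) := by
  refine forall_congr' fun x₀ =>
    (contMDiffAt_tangent_iff_chart V x₀).trans ⟨fun h => ?_, fun h => ?_⟩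
  · refine ((contMDiffAt_chartThetaL_chart x₀).clm_apply h).congr_of_eventuallyEq ?_
    filter_upwards [extChartAt_source_mem_nhds (I := 𝓘(ℝ, E)) x₀] with x hx
    exact (DFunLike.congr_fun (chartThetaL_chart_comp_modelDeriv hx) (V x)).symm
  · refine ((contMDiffAt_chartThetaL_chart_inverse x₀).clm_apply h).congr_of_eventuallyEq ?_
    filter_upwards [extChartAt_source_mem_nhds (I := 𝓘(ℝ, E)) x₀] with x hx
    refine ((isInvertible_chartThetaL
      ((extChartAt 𝓘(ℝ, E) x₀).map_source hx)).inverse_apply_eq.mpr ?_).symm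
    exact (DFunLike.congr_fun (chartThetaL_chart_comp_modelDeriv hx) (V x)).symm

theorem contMDiff_cotangent_iff_comp_leftFieldE (α : G → E →L[ℝ] ℝ) :
    ContMDiff 𝓘(ℝ, E) (𝓘(ℝ, E).prod 𝓘(ℝ, E →L[ℝ] ℝ)) ∞
      (fun x => TotalSpace.mk' (E →L[ℝ] ℝ)
        (E := fun y : G => TangentSpace 𝓘(ℝ, E) y →L[ℝ] Trivial G ℝ y) x (α x)) ↔
      CMDiff ∞ (fun x => (α x).comp (leftFieldE E x)) := by
  refine forall_congr' fun x₀ =>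
    (contMDiffAt_cotangent_iff_chart α x₀).trans ⟨fun h => ?_, fun h => ?_⟩
  · refine (h.clm_comp (contMDiffAt_chartThetaL_chart_inverse x₀)).congr_of_eventuallyEq ?_
    filter_upwards [extChartAt_source_mem_nhds (I := 𝓘(ℝ, E)) x₀] with x hx
    rw [← leftFieldE_comp_chartThetaL_chart hx, ContinuousLinearMap.comp_assoc,
      ContinuousLinearMap.comp_assoc, (isInvertible_chartThetaL
        ((extChartAt 𝓘(ℝ, E) x₀).map_source hx)).self_comp_inverse, ContinuousLinearMap.comp_id]
  · refine (h.clm_comp (contMDiffAt_chartThetaL_chart x₀)).congr_of_eventuallyEq ?_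
    filter_upwards [extChartAt_source_mem_nhds (I := 𝓘(ℝ, E)) x₀] with x hx
    rw [ContinuousLinearMap.comp_assoc, leftFieldE_comp_chartThetaL_chart hx]

theorem isSmoothGenSection_iff (e : G → E × (E →L[ℝ] ℝ)) :
    IsSmoothGenSection (E := E) (M := G) e ↔
      CMDiff ∞ (fun x => thetaLE E x (e x).1) ∧ CMDiff ∞ (fun x => (e x).2.comp (leftFieldE E x)) :=
  and_congr (contMDiff_tangent_iff_thetaLE fun x => (e x).1)
    (contMDiff_cotangent_iff_comp_leftFieldE fun x => (e x).2)

end LeftTrivialization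

section SMapEquiv

variable {E : Type*} [NormedAddCommGroup E] [NormedSpace ℝ E] [FiniteDimensional ℝ E]
  {G : Type*} [TopologicalSpace G] [ChartedSpace E G] [Group G]
  {B : LinearMap.BilinForm ℝ (LieAlg E G)}

namespace IsBiinvariantMetric

theorem injective_formE_flip (hB : IsBiinvariantMetric B) :
    Function.Injective (formE B).flip := by
  refine (injective_iff_map_eq_zero _).mpr fun x hx => ?_
  by_contra hx0
  exact (hB.pos x hx0).ne' (DFunLike.congr_fun hx x)

/-- The isomorphism `x ↦ B(·, x)` of the model space with its dual. -/
def flatE (hB : IsBiinvariantMetric B) : E ≃L[ℝ] (E →L[ℝ] ℝ) :=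
  (LinearEquiv.ofInjectiveOfFinrankEq (formE B).flip.toLinearMap hB.injective_formE_flip
    (Subspace.dual_finrank_eq.symm.trans
      (LinearMap.toContinuousLinearMap (𝕜 := ℝ) (E := E) (F' := ℝ)).finrank_eq)
    ).toContinuousLinearEquiv

theorem flip_flatE_symm (hB : IsBiinvariantMetric B) (α : E →L[ℝ] ℝ) :
    (formE B).flip (hB.flatE.symm α) = α :=
  hB.flatE.apply_symm_apply α

variable [LieGroup 𝓘(ℝ, E) ∞ G]

theorem genPairing_sMap (hB : IsBiinvariantMetric B) (g : G) (a b : E × E) :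
    genPairing g (sMap B g a) (sMap B g b) = doubleForm B a b := by
  have h : (1 / 2 : ℝ) * (formE B (b.1 - adjointE E g⁻¹ b.2) (a.1 + adjointE E g⁻¹ a.2) +
      formE B (a.1 - adjointE E g⁻¹ a.2) (b.1 + adjointE E g⁻¹ b.2)) =
        formE B a.1 b.1 - formE B a.2 b.2 := by
    rw [← hB.formE_adjointE g⁻¹ a.2 b.2]
    simp only [map_add, map_sub, sub_apply]
    rw [hB.formE_symm b.1 a.1, hB.formE_symm b.1, hB.formE_symm _ a.1,
      hB.formE_symm (adjointE E g⁻¹ b.2)]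
    ring
  rw [hB.sMap_eq g a, hB.sMap_eq g b]
  refine Eq.trans ?_ h
  change (1 / 2 : ℝ) * (formE B (thetaLE E g (leftFieldE E g _)) _ +
    formE B (thetaLE E g (leftFieldE E g _)) _) = _
  rw [thetaLE_leftFieldE, thetaLE_leftFieldE]

theorem injective_sMap (hB : IsBiinvariantMetric B) (g : G) : Function.Injective (sMap B g) := by
  refine (injective_iff_map_eq_zero _).mpr fun a ha => ?_
  refine IsInnerProduct.separatingLeft_doubleForm ⟨hB.symm, hB.pos⟩ a fun b => ?_
  exact (hB.genPairing_sMap g a b).symm.trans (by rw [ha, map_zero, LinearMap.zero_apply])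

/-- The inverse of `sMap`. -/
def sMapInv (hB : IsBiinvariantMetric B) (g : G) (e : E × (E →L[ℝ] ℝ)) : E × E :=
  ((1 / 2 : ℝ) • (hB.flatE.symm (e.2.comp (leftFieldE E g)) + thetaLE E g e.1),
    adjointE E g ((1 / 2 : ℝ) • (hB.flatE.symm (e.2.comp (leftFieldE E g)) - thetaLE E g e.1)))

theorem sMap_sMapInv (hB : IsBiinvariantMetric B) (g : G) (e : E × (E →L[ℝ] ℝ)) :
    sMap B g (hB.sMapInv g e) = e := by
  have hsub (x y : E) : (1 / 2 : ℝ) • (x + y) - (1 / 2 : ℝ) • (x - y) = y := by module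
  have hadd (x y : E) : (1 / 2 : ℝ) • (x + y) + (1 / 2 : ℝ) • (x - y) = x := by module
  rw [hB.sMap_eq, sMapInv, adjointE_inv_adjointE, hsub, hadd, leftFieldE_thetaLE,
    hB.flip_flatE_symm, ContinuousLinearMap.comp_assoc, leftFieldE_comp_thetaLE,
    ContinuousLinearMap.comp_id]

/-- `sMap`, as a linear equivalence. -/
def sMapEquiv (hB : IsBiinvariantMetric B) (g : G) :
    (LieAlg E G × LieAlg E G) ≃ₗ[ℝ] GenTangent E g :=
  { sMap B g with
    invFun := hB.sMapInv g
    left_inv := fun a => hB.injective_sMap g (hB.sMap_sMapInv g (sMap B g a))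
    right_inv := hB.sMap_sMapInv g }

theorem sMapEquiv_apply (hB : IsBiinvariantMetric B) (g : G) (a : LieAlg E G × LieAlg E G) :
    hB.sMapEquiv g a = sMap B g a := rfl

variable [CompleteSpace E]

theorem contMDiff_sMapInv (hB : IsBiinvariantMetric B) {e : GenSection E G}
    (he : IsSmoothGenSection e) :
    ContMDiff 𝓘(ℝ, E) 𝓘(ℝ, E × E) ∞ (fun g => hB.sMapInv g (e g)) := by
  obtain ⟨hfield, hform⟩ := (isSmoothGenSection_iff (E := E) e).mp he
  have hdual : CMDiff ∞ (fun g => hB.flatE.symm ((e g).2.comp (leftFieldE E g))) :=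
    hB.flatE.symm.contDiff.contMDiff.comp hform
  have hhalf : CMDiff ∞ (fun v : E => (1 / 2 : ℝ) • v) := (contDiff_const_smul _).contMDiff
  exact (hhalf.comp (hdual.add hfield)).prodMk_space
    (contMDiff_adjointE.clm_apply (hhalf.comp (hdual.sub hfield)))

theorem isSmoothGenSection_sMap (hB : IsBiinvariantMetric B) {a : G → E × E}
    (ha : ContMDiff 𝓘(ℝ, E) 𝓘(ℝ, E × E) ∞ a) :
    IsSmoothGenSection (E := E) (fun g => sMap B g (a g)) := by
  have hfst : CMDiff ∞ (fun g => (a g).1) := contDiff_fst.contMDiff.comp ha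
  have hsnd : CMDiff ∞ (fun g => adjointE E g⁻¹ (a g).2) :=
    (contMDiff_adjointE.comp (contMDiff_inv 𝓘(ℝ, E) ∞)).clm_apply (contDiff_snd.contMDiff.comp ha)
  rw [hB.sMap_eq_leftSection]
  refine (isSmoothGenSection_iff _).mpr ⟨?_, ?_⟩
  · simpa only [leftSection, thetaLE_leftFieldE] using hfst.sub hsnd
  · refine ((formE B).flip.contMDiff.comp (hfst.add hsnd)).congr fun g => ?_
    exact (ContinuousLinearMap.comp_assoc _ (thetaLE E g) (leftFieldE E g)).trans
      ((congrArg _ (thetaLE_comp_leftFieldE g)).trans (ContinuousLinearMap.comp_id _))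

end IsBiinvariantMetric

end SMapEquiv

section InducedField

variable {E : Type*} [NormedAddCommGroup E] [NormedSpace ℝ E] [FiniteDimensional ℝ E]
  {G : Type*} [TopologicalSpace G] [ChartedSpace E G] [Group G]
  {B : LinearMap.BilinForm ℝ (LieAlg E G)} {J : Module.End ℝ (LieAlg E G × LieAlg E G)}

/-- An endomorphism of `𝔡`, as a continuous endomorphism of the square of the model space. -/
def endE (J : Module.End ℝ (LieAlg E G × LieAlg E G)) : E × E →L[ℝ] E × E :=
  LinearMap.toContinuousLinearMap (E := E × E) (F' := E × E) J

variable [LieGroup 𝓘(ℝ, E) ∞ G]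

namespace IsBiinvariantMetric

/-- The field of endomorphisms of `TG ⊕ T^*G` corresponding under `sMap` to an endomorphism of
`𝔡`. -/
def inducedField (hB : IsBiinvariantMetric B) (J : Module.End ℝ (LieAlg E G × LieAlg E G)) :
    GenEndField E G := fun g => (hB.sMapEquiv g).conj J

theorem inducedField_sMap (hB : IsBiinvariantMetric B)
    (J : Module.End ℝ (LieAlg E G × LieAlg E G)) (g : G) (a : LieAlg E G × LieAlg E G) :
    hB.inducedField J g (sMap B g a) = sMap B g (J a) := by
  rw [← hB.sMapEquiv_apply, ← hB.sMapEquiv_apply, inducedField, LinearEquiv.conj_apply_apply,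
    LinearEquiv.symm_apply_apply]

theorem forall_genTangent_iff (hB : IsBiinvariantMetric B) {g : G} {p : GenTangent E g → Prop} :
    (∀ e, p e) ↔ ∀ a, p (sMap B g a) :=
  (hB.sMapEquiv g).surjective.forall

theorem inducedField_sq (hB : IsBiinvariantMetric B) (hJ : ∀ a, J (J a) = -a) (g : G) :
    ∀ e : GenTangent E g, hB.inducedField J g (hB.inducedField J g e) = -e := by
  refine hB.forall_genTangent_iff.2 fun a => ?_
  rw [inducedField_sMap, inducedField_sMap, hJ, map_neg]

theorem negIEigenspace_inducedField (hB : IsBiinvariantMetric B)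
    (J : Module.End ℝ (LieAlg E G × LieAlg E G)) (g : G) :
    negIEigenspace (hB.inducedField J) g = (negIEigenspaceC J).map ((sMap B g).baseChange ℂ) :=
  (map_negIEigenspaceC_baseChange (hB.sMapEquiv g) J).symm

theorem isInducedBy_iff (hB : IsBiinvariantMetric B) (hJ : ∀ a, J (J a) = -a)
    (K : GenEndField E G) :
    IsInducedBy B (negIEigenspaceC J) K ↔ K = hB.inducedField J := by
  simp only [IsInducedBy, ← hB.negIEigenspace_inducedField, funext_iff]
  exact forall_congr' fun g => negIEigenspaceC_eq_iff (hB.inducedField_sq hJ g)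

theorem mkC_mem_negIEigenspace_inducedField_iff (hB : IsBiinvariantMetric B)
    (hJ : ∀ a, J (J a) = -a) {g : G} {e f : GenTangent E g} :
    mkC e f ∈ negIEigenspace (hB.inducedField J) g ↔ hB.inducedField J g e = f :=
  mkC_mem_negIEigenspaceC (hB.inducedField_sq hJ g)

end IsBiinvariantMetric

section Involutivity

variable [CompleteSpace E] (hJ : IsIntegrableIsometry (doubleForm B) J)

section Brackets

variable {a b : G → E × E} {x : G}
  (ha : MDifferentiableAt 𝓘(ℝ, E) 𝓘(ℝ, E × E) a x)
  (hb : MDifferentiableAt 𝓘(ℝ, E) 𝓘(ℝ, E × E) b x)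

include hJ ha hb

theorem actionBracket_nijenhuis :
    actionBracket B a (fun g => endE J (b g)) x + actionBracket B (fun g => endE J (a g)) b x =
      endE J (actionBracket B a b x -
        actionBracket B (fun g => endE J (a g)) (fun g => endE J (b g)) x) := by
  have hint : ((lieE E G (a x).1 (endE J (b x)).1, lieE E G (a x).2 (endE J (b x)).2) : E × E) +
      (lieE E G (endE J (a x)).1 (b x).1, lieE E G (endE J (a x)).2 (b x).2) =
      endE J ((lieE E G (a x).1 (b x).1, lieE E G (a x).2 (b x).2) -
        (lieE E G (endE J (a x)).1 (endE J (b x)).1,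
          lieE E G (endE J (a x)).2 (endE J (b x)).2)) :=
    (hJ.integrable (a x) (b x)).symm
  have key (u u' v v' : E) (Da Db : E →L[ℝ] E × E) {p q r s : E × E}
      (h : p + q = endE J (r - s)) :
      (endE J (Db u) - Da v' + p) + (Db u' - endE J (Da v) + q) =
        endE J ((Db u - Da v + r) - (endE J (Db u') - endE J (Da v') + s)) := by
    have hsq (w : E × E) : endE J (endE J w) = -w := hJ.sq w
    simp only [map_sub, map_add, hsq] at h ⊢
    linear_combination (norm := module) h
  simp only [actionBracket, modelDeriv_clm_apply (endE J) ha, modelDeriv_clm_apply (endE J) hb]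
  exact key _ _ _ _ _ _ hint

theorem exchangeForm_sub_exchangeForm_endE :
    exchangeForm B a b x -
      exchangeForm B (fun g => endE J (a g)) (fun g => endE J (b g)) x = 0 := by
  have hisom (v w : E × E) : doubleFormE B (endE J v) (endE J w) = doubleFormE B v w :=
    hJ.isometry v w
  ext v
  simp [exchangeForm, modelDeriv_clm_apply (endE J) ha, modelDeriv_clm_apply (endE J) hb, hisom]

theorem exchangeForm_endE_add_endE_exchangeForm :
    exchangeForm B a (fun g => endE J (b g)) x +
      exchangeForm B (fun g => endE J (a g)) b x = 0 := by
  have hskew (v w : E × E) : doubleFormE B (endE J v) w = -doubleFormE B v (endE J w) :=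
    hJ.skew v w
  ext v
  simp [exchangeForm, modelDeriv_clm_apply (endE J) ha, modelDeriv_clm_apply (endE J) hb, hskew]

variable (hB : IsBiinvariantMetric B)

include hB

theorem courant_sMap_sub_courant_sMap_endE :
    courant (cartanThreeForm B) (fun g => sMap B g (a g)) (fun g => sMap B g (b g)) x -
      courant (cartanThreeForm B) (fun g => sMap B g (endE J (a g)))
        (fun g => sMap B g (endE J (b g))) x =
      sMap B x (actionBracket (E := E) B a b x -
        actionBracket (E := E) B (fun g => endE J (a g)) (fun g => endE J (b g)) x) := by
  refine (congrArg₂ (· - ·) (hB.courant_sMap ha hb) (hB.courant_sMap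
    ((endE J).mdifferentiableAt.comp x ha) ((endE J).mdifferentiableAt.comp x hb))).trans ?_
  refine (add_sub_add_comm _ _ _ _).trans ((congrArg₂ (· + ·) (map_sub (sMap B x) _ _).symm
    (Prod.ext (sub_zero 0) ?_)).trans (add_zero _))
  exact exchangeForm_sub_exchangeForm_endE hJ ha hb

theorem courant_sMap_endE_add_courant_endE_sMap :
    courant (cartanThreeForm B) (fun g => sMap B g (a g)) (fun g => sMap B g (endE J (b g))) x +
      courant (cartanThreeForm B) (fun g => sMap B g (endE J (a g)))
        (fun g => sMap B g (b g)) x =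
      sMap B x (actionBracket (E := E) B a (fun g => endE J (b g)) x +
        actionBracket (E := E) B (fun g => endE J (a g)) b x) := by
  refine (congrArg₂ (· + ·) (hB.courant_sMap ha ((endE J).mdifferentiableAt.comp x hb))
    (hB.courant_sMap ((endE J).mdifferentiableAt.comp x ha) hb)).trans ?_
  refine (add_add_add_comm _ _ _ _).trans ((congrArg₂ (· + ·) (map_add (sMap B x) _ _).symm
    (Prod.ext (add_zero 0) ?_)).trans (add_zero _))
  exact exchangeForm_endE_add_endE_exchangeForm hJ ha hb

end Brackets

end Involutivity

namespace IsBiinvariantMetric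

variable [CompleteSpace E]

theorem isAlmostGeneralizedComplex_inducedField (hB : IsBiinvariantMetric B)
    (hJ : IsIntegrableIsometry (doubleForm B) J)
    (hdet : LinearMap.det J = 1) : IsAlmostGeneralizedComplex (hB.inducedField J) where
  smooth _ he := hB.isSmoothGenSection_sMap ((endE J).contMDiff.comp (hB.contMDiff_sMapInv he))
  orthogonal g := by
    simp only [hB.forall_genTangent_iff, inducedField_sMap]
    intro a b
    exact (hB.genPairing_sMap g (J a) (J b)).trans
      ((hJ.isometry a b).trans (hB.genPairing_sMap g a b).symm)
  det_eq_one g := (LinearMap.det_conj J (hB.sMapEquiv g)).trans hdet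
  sq_eq_neg_one := hB.inducedField_sq hJ.sq

theorem exists_eq_sMap_of_mem_negIEigenspace (hB : IsBiinvariantMetric B)
    (hJ : ∀ a, J (J a) = -a) {e : GenSectionC E G} (he : IsSmoothGenSectionC e)
    (hmem : ∀ g, e g ∈ negIEigenspace (hB.inducedField J) g) :
    ∃ a : G → E × E, ContMDiff 𝓘(ℝ, E) 𝓘(ℝ, E × E) ∞ a ∧
      (fun g => reC (e g)) = (fun g => sMap B g (a g)) ∧
      (fun g => imC (e g)) = (fun g => sMap B g (endE J (a g))) := by
  refine ⟨fun g => hB.sMapInv g (reC (e g)), hB.contMDiff_sMapInv he.1,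
    funext fun g => (hB.sMap_sMapInv g _).symm, funext fun g => ?_⟩
  have h := hmem g
  rw [← mkC_reC_imC (e g), hB.mkC_mem_negIEigenspace_inducedField_iff hJ] at h
  exact h.symm

theorem courantC_mem_negIEigenspace (hB : IsBiinvariantMetric B)
    (hJ : IsIntegrableIsometry (doubleForm B) J) {e f : GenSectionC E G}
    (he : IsSmoothGenSectionC e) (hf : IsSmoothGenSectionC f)
    (heJ : ∀ x, e x ∈ negIEigenspace (hB.inducedField J) x)
    (hfJ : ∀ x, f x ∈ negIEigenspace (hB.inducedField J) x) (x : G) :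
    courantC (cartanThreeForm B) e f x ∈ negIEigenspace (hB.inducedField J) x := by
  obtain ⟨a, ha, hre_e, him_e⟩ := hB.exists_eq_sMap_of_mem_negIEigenspace hJ.sq he heJ
  obtain ⟨b, hb, hre_f, him_f⟩ := hB.exists_eq_sMap_of_mem_negIEigenspace hJ.sq hf hfJ
  replace ha : MDifferentiableAt 𝓘(ℝ, E) 𝓘(ℝ, E × E) a x := ha.mdifferentiableAt (by simp)
  replace hb : MDifferentiableAt 𝓘(ℝ, E) 𝓘(ℝ, E × E) b x := hb.mdifferentiableAt (by simp)
  rw [courantC, hre_e, him_e, hre_f, him_f, courant_sMap_sub_courant_sMap_endE hJ ha hb hB,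
    courant_sMap_endE_add_courant_endE_sMap hJ ha hb hB,
    hB.mkC_mem_negIEigenspace_inducedField_iff hJ.sq, actionBracket_nijenhuis hJ ha hb]
  exact hB.inducedField_sMap J x _

theorem isTwistedGeneralizedComplex_inducedField (hB : IsBiinvariantMetric B)
    (hJ : IsIntegrableIsometry (doubleForm B) J) (hdet : LinearMap.det J = 1)
    (hH : (cartanThreeForm B).IsSmoothClosed) :
    IsTwistedGeneralizedComplex (cartanThreeForm B) (hB.inducedField J) where
  toIsAlmostGeneralizedComplex := hB.isAlmostGeneralizedComplex_inducedField hJ hdet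
  smooth_closed := hH
  involutive _ _ := hB.courantC_mem_negIEigenspace hJ

end IsBiinvariantMetric

section Kahler

theorem det_mul_det_eq_one {V : Type*} [AddCommGroup V] [Module ℝ V] {J : Module.End ℝ V}
    (hJ : ∀ x, J (J x) = -x) : LinearMap.det J * LinearMap.det J = 1 := by
  have hsq : J * J = (-1 : ℝ) • (1 : Module.End ℝ V) := by
    ext x
    simp [hJ]
  have hdet : LinearMap.det J * LinearMap.det J = (-1) ^ Module.finrank ℝ V := by
    rw [← map_mul, hsq, LinearMap.det_smul, map_one, mul_one]
  rcases neg_one_pow_eq_or ℝ (Module.finrank ℝ V) with h | h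
  · rw [hdet, h]
  · linarith [mul_self_nonneg (LinearMap.det J)]

theorem det_neg_mul_det_eq_one {V : Type*} [AddCommGroup V] [Module ℝ V] {J : Module.End ℝ V}
    (hJ : ∀ x, J (J x) = -x) : LinearMap.det (-J) * LinearMap.det J = 1 := by
  rw [← map_mul, show -J * J = 1 from LinearMap.ext fun x => by simp [hJ], map_one]

namespace IsBiinvariantMetric

theorem neg_inducedField_inducedField_sMap (hB : IsBiinvariantMetric B)
    {I : Module.End ℝ (LieAlg E G)} (hI : ∀ x, I (I x) = -x) (g : G)
    (a : LieAlg E G × LieAlg E G) :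
    -hB.inducedField ((-I).prodMap (-I)) g (hB.inducedField ((-I).prodMap I) g (sMap B g a)) =
      sMap B g (a.1, -a.2) := by
  rw [inducedField_sMap, inducedField_sMap, ← map_neg]
  congr 1
  ext <;> simp [hI]

theorem genPairing_neg_inducedField_inducedField_sMap (hB : IsBiinvariantMetric B)
    {I : Module.End ℝ (LieAlg E G)} (hI : ∀ x, I (I x) = -x) (g : G)
    (a b : LieAlg E G × LieAlg E G) :
    genPairing g (-hB.inducedField ((-I).prodMap (-I)) g
      (hB.inducedField ((-I).prodMap I) g (sMap B g a))) (sMap B g b) =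
        B a.1 b.1 + B a.2 b.2 := by
  rw [hB.neg_inducedField_inducedField_sMap hI]
  exact (hB.genPairing_sMap g _ b).trans (by simp [doubleForm])

variable [CompleteSpace E]

theorem isTwistedGeneralizedKahler_inducedField (hB : IsBiinvariantMetric B)
    {I : Module.End ℝ (LieAlg E G)} (hI : IsIntegrableIsometry B I)
    (hH : (cartanThreeForm B).IsSmoothClosed) :
    IsTwistedGeneralizedKahler (cartanThreeForm B) (hB.inducedField ((-I).prodMap (-I)))
      (hB.inducedField ((-I).prodMap I)) where
  left := hB.isTwistedGeneralizedComplex_inducedField (hI.neg.prodMap hI.neg)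
    (by rw [LinearMap.det_prodMap, det_mul_det_eq_one hI.neg.sq]) hH
  right := hB.isTwistedGeneralizedComplex_inducedField (hI.neg.prodMap hI)
    (by rw [LinearMap.det_prodMap, det_neg_mul_det_eq_one hI.sq]) hH
  comm g := hB.forall_genTangent_iff.2 fun a => by
    simp only [inducedField_sMap]
    congr 1
    ext <;> simp
  symm g := by
    simp only [hB.forall_genTangent_iff, hB.genPairing_neg_inducedField_inducedField_sMap hI.sq]
    intro a b
    rw [hB.symm a.1, hB.symm a.2]
  pos g := by
    have hB' : IsInnerProduct B := ⟨hB.symm, hB.pos⟩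
    simp only [hB.forall_genTangent_iff, hB.genPairing_neg_inducedField_inducedField_sMap hI.sq]
    intro a ha
    rcases eq_or_ne a.1 0 with h | h
    · have h' : a.2 ≠ 0 := fun h' => ha (by rw [show a = 0 from Prod.ext h h', map_zero])
      exact add_pos_of_nonneg_of_pos (hB'.nonneg _) (hB.pos _ h')
    · exact add_pos_of_pos_of_nonneg (hB.pos _ h) (hB'.nonneg _)

end IsBiinvariantMetric

end Kahler

end InducedField

/-! ### The Cartan three-form -/

section AlternatingSmooth

variable {E E' F : Type*} [NormedAddCommGroup E] [NormedSpace ℝ E] [FiniteDimensional ℝ E]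
  [NormedAddCommGroup E'] [NormedSpace ℝ E'] [NormedAddCommGroup F] [NormedSpace ℝ F] {n : ℕ}

theorem finiteDimensional_continuousMultilinearMap :
    FiniteDimensional ℝ (ContinuousMultilinearMap ℝ (fun _ : Fin n => E) ℝ) :=
  FiniteDimensional.of_injective
    ({ toFun := ContinuousMultilinearMap.toMultilinearMap
       map_add' := fun _ _ => rfl
       map_smul' := fun _ _ => rfl } : ContinuousMultilinearMap ℝ (fun _ : Fin n => E) ℝ →ₗ[ℝ]
      MultilinearMap ℝ (fun _ : Fin n => E) ℝ)
    ContinuousMultilinearMap.toMultilinearMap_injective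

theorem contDiffAt_of_toContinuousMultilinearMap {η : F → E [⋀^Fin n]→L[ℝ] ℝ} {y : F}
    (h : ContDiffAt ℝ ∞ (fun y => (η y).toContinuousMultilinearMap) y) : ContDiffAt ℝ ∞ η y := by
  have := finiteDimensional_continuousMultilinearMap (E := E) (n := n)
  let ι : (E [⋀^Fin n]→L[ℝ] ℝ) →L[ℝ] ContinuousMultilinearMap ℝ (fun _ : Fin n => E) ℝ :=
    ContinuousAlternatingMap.toContinuousMultilinearMapCLM ℝ
  obtain ⟨L, hL⟩ : ι.HasLeftInverse := .of_injective_of_finiteDimensional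
    ContinuousAlternatingMap.toContinuousMultilinearMap_injective
  exact (L.contDiff.contDiffAt.comp y h).congr_of_eventuallyEq (.of_forall fun z => (hL (η z)).symm)

theorem contDiffAt_compContinuousLinearMap (A : E' [⋀^Fin n]→L[ℝ] ℝ) {f : F → E →L[ℝ] E'} {y : F}
    (hf : ContDiffAt ℝ ∞ f y) : ContDiffAt ℝ ∞ (fun y => A.compContinuousLinearMap (f y)) y :=
  contDiffAt_of_toContinuousMultilinearMap <|
    (ContinuousMultilinearMap.compContinuousLinearMapLRight (E := fun _ : Fin n => E)
      A.toContinuousMultilinearMap).contDiff.contDiffAt.comp y (contDiffAt_pi.mpr fun _ => hf)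

end AlternatingSmooth

namespace IsInvariantInnerProduct

variable {V : Type*} [LieRing V] [LieAlgebra ℝ V] {B : LinearMap.BilinForm ℝ V}

theorem lie_lie_cyclic (hB : IsInvariantInnerProduct B) (x y z w : V) :
    B ⁅x, y⁆ ⁅z, w⁆ - B ⁅x, z⁆ ⁅y, w⁆ + B ⁅x, w⁆ ⁅y, z⁆ = 0 := by
  rw [← hB.apply_lie_right, ← hB.apply_lie_right, ← hB.apply_lie_right, ← map_sub, ← map_add,
    leibniz_lie y z w, ← lie_skew w ⁅y, z⁆]
  simp

theorem alternatization_torsion_eq_zero (hB : IsInvariantInnerProduct B) (x : Fin 4 → V)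
    (d : Fin 4 → Fin 4 → V) (hd : ∀ i j, d i j - d j i = -⁅x i, x j⁆) :
    ∑ i : Fin 4, (-1 : ℝ) ^ (i : ℕ) *
      (B ⁅d i (i.succAbove 0), x (i.succAbove 1)⁆ (x (i.succAbove 2)) +
        B ⁅x (i.succAbove 0), d i (i.succAbove 1)⁆ (x (i.succAbove 2)) +
        B ⁅x (i.succAbove 0), x (i.succAbove 1)⁆ (d i (i.succAbove 2))) = 0 := by
  have hfirst (i j k l : Fin 4) : B ⁅d i j, x k⁆ (x l) = B (d i j) ⁅x k, x l⁆ :=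
    (hB.apply_lie_right _ _ _).symm
  have hmid (i j k l : Fin 4) : B ⁅x k, d i j⁆ (x l) = -B (d i j) ⁅x k, x l⁆ := by
    rw [← lie_skew, map_neg, LinearMap.neg_apply, hB.apply_lie_right]
  have hlast (i j k l : Fin 4) : B ⁅x k, x l⁆ (d i j) = B (d i j) ⁅x k, x l⁆ := hB.symm _ _
  have htorsion (i j k l : Fin 4) :
      B (d i j) ⁅x k, x l⁆ - B (d j i) ⁅x k, x l⁆ = -B ⁅x i, x j⁆ ⁅x k, x l⁆ := by
    rw [← LinearMap.sub_apply, ← map_sub, hd, map_neg, LinearMap.neg_apply]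
  have hcyclic := hB.lie_lie_cyclic (x 0) (x 1) (x 2) (x 3)
  have h01 := htorsion 0 1 2 3
  have h02 := htorsion 0 2 1 3
  have h03 := htorsion 0 3 1 2
  have h12 := htorsion 1 2 0 3
  have h13 := htorsion 1 3 0 2
  have h23 := htorsion 2 3 0 1
  simp only [hfirst, hmid, hlast, Fin.sum_univ_four, Fin.succAbove]
  simp
  linarith [hB.symm ⁅x 0, x 1⁆ ⁅x 2, x 3⁆, hB.symm ⁅x 0, x 2⁆ ⁅x 1, x 3⁆,
    hB.symm ⁅x 0, x 3⁆ ⁅x 1, x 2⁆]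

end IsInvariantInnerProduct

section CartanForm

variable {E : Type*} [NormedAddCommGroup E] [NormedSpace ℝ E] [FiniteDimensional ℝ E]
  [CompleteSpace E]
  {F : Type*} [NormedAddCommGroup F] [NormedSpace ℝ F]
  {G : Type*} [TopologicalSpace G] [ChartedSpace E G] [Group G] [LieGroup 𝓘(ℝ, E) ∞ G]
  {B : LinearMap.BilinForm ℝ (LieAlg E G)}

/-- The value of the Cartan three-form at the identity, on the model space. -/
def cartanE (B : LinearMap.BilinForm ℝ (LieAlg E G)) : E [⋀^Fin 3]→L[ℝ] ℝ := cartanThreeForm B 1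

namespace IsBiinvariantMetric

theorem cartanE_apply (hB : IsBiinvariantMetric B) (m : Fin 3 → E) :
    cartanE B m = formE B (lieE E G (m 0) (m 1)) (m 2) := by
  have hone : thetaLE E (1 : G) = .id ℝ E := (chartThetaL_self (1 : G)).symm.trans chartThetaL_one
  exact (hB.cartanThreeForm_apply 1 m).trans (by rw [hone]; rfl)

theorem cartanThreeForm_inChart_eqOn (hB : IsBiinvariantMetric B) (x₀ : G) :
    Set.EqOn ((cartanThreeForm B).inChart x₀)
      (fun y => (cartanE B).compContinuousLinearMap (chartThetaL x₀ y))
      (extChartAt 𝓘(ℝ, E) x₀).target := by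
  intro y hy
  refine ContinuousAlternatingMap.ext fun m => (hB.cartanThreeForm_apply _ _).trans ?_
  refine Eq.trans ?_ (hB.cartanE_apply _).symm
  rw [chartThetaL_eq hy]
  rfl

theorem extDeriv_cartanE_leftLogDeriv (hB : IsBiinvariantMetric B) {f : F → G} {y : F}
    (hf : CMDiffAt ∞ f y) :
    extDeriv (fun z => (cartanE B).compContinuousLinearMap (leftLogDeriv E f z)) y = 0 := by
  refine ContinuousAlternatingMap.ext fun v => ?_
  have hΘ := ((contDiffAt_leftLogDeriv hf).differentiableAt (by simp)).hasFDerivAt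
  have hω := (hasFDerivAt_const (cartanE B) y).continuousAlternatingMapCompContinuousLinearMap hΘ
  rw [extDeriv, hω.fderiv, ContinuousAlternatingMap.alternatizeUncurryFin_apply]
  refine Eq.trans ?_ (hB.isInvariantInnerProduct.alternatization_torsion_eq_zero
    (fun i => leftLogDeriv E f y (v i)) (fun i j => fderiv ℝ (leftLogDeriv E f) y (v i) (v j))
    fun i j => maurerCartan_leftLogDeriv hf (v i) (v j))
  refine Finset.sum_congr rfl fun i _ => ?_
  simp [Fin.sum_univ_three, hB.cartanE_apply, ← mul_add]
  rfl

theorem isSmoothClosed_cartanThreeForm (hB : IsBiinvariantMetric B) :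
    (cartanThreeForm B).IsSmoothClosed := by
  refine fun x₀ => ⟨ContDiffOn.congr (fun y hy => ?_) (hB.cartanThreeForm_inChart_eqOn x₀),
    fun y hy => ?_⟩
  · exact (contDiffAt_compContinuousLinearMap (cartanE B)
      (contDiffAt_leftLogDeriv (contMDiffAt_chart_symm hy))).contDiffWithinAt
  · rw [((hB.cartanThreeForm_inChart_eqOn x₀).eventuallyEq_of_mem
      ((isOpen_extChartAt_target x₀).mem_nhds hy)).extDeriv_eq]
    exact hB.extDeriv_cartanE_leftLogDeriv (contMDiffAt_chart_symm hy)

end IsBiinvariantMetric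

end CartanForm

end

theorem mainTheorem3_general {E : Type*} [NormedAddCommGroup E] [NormedSpace ℝ E]
    [FiniteDimensional ℝ E] [CompleteSpace E]
    {G : Type*} [TopologicalSpace G] [ChartedSpace E G] [Group G] [LieGroup 𝓘(ℝ, E) ∞ G]
    (B : LinearMap.BilinForm ℝ (LieAlg E G)) (hB : IsBiinvariantMetric B)
    (h : LieSubalgebra ℂ (ℂ ⊗[ℝ] LieAlg E G)) [h.IsCartanSubalgebra]
    (hconj : ∀ z ∈ h, conjC z ∈ h)
    (P : Set (h → ℂ)) (hP : IsPositiveSystem h P)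
    (Ih : Module.End ℝ (realSubspace h)) (hI : ∀ x, Ih (Ih x) = -x)
    (hIB : ∀ x y : realSubspace h, B (Ih x) (Ih y) = B x y) :
    IsIsotropicSplittingSubalgebra B (Lphi h P Ih) ∧
    IsIsotropicSplittingSubalgebra B (Lpsi h P Ih) ∧
    ∃ Jphi Jpsi : GenEndField E G,
      (∀ J, IsInducedBy B (Lphi h P Ih) J ↔ J = Jphi) ∧
      (∀ J, IsInducedBy B (Lpsi h P Ih) J ↔ J = Jpsi) ∧
      IsTwistedGeneralizedKahler (cartanThreeForm B) Jphi Jpsi := by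
  obtain ⟨I, hI, h10, h01⟩ := exists_isIntegrableIsometry_negIEigenspaceC_eq_g01
    hB.isInvariantInnerProduct hconj hP hI hIB
  have hphi := hI.neg.prodMap hI.neg
  have hpsi := hI.neg.prodMap hI
  rw [Lphi, Lpsi, ← h10, ← h01, directSumC_negIEigenspaceC, directSumC_negIEigenspaceC]
  have hB' := hB.isInvariantInnerProduct.toIsInnerProduct
  exact ⟨hphi.isIsotropicSplittingSubalgebra hB', hpsi.isIsotropicSplittingSubalgebra hB', _, _,
    hB.isInducedBy_iff hphi.sq, hB.isInducedBy_iff hpsi.sq,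
    hB.isTwistedGeneralizedKahler_inducedField hI hB.isSmoothClosed_cartanThreeForm⟩

theorem mainTheorem3 {n : ℕ} (hn : Even n)
    {G : Type*} [TopologicalSpace G] [ChartedSpace (EuclideanSpace ℝ (Fin n)) G]
    [Group G] [LieGroup (𝓡 n) ∞ G] [CompactSpace G] [T2Space G]
    (B : LinearMap.BilinForm ℝ (LieAlg (EuclideanSpace ℝ (Fin n)) G))
    (hB : IsBiinvariantMetric B)
    (h : LieSubalgebra ℂ (ℂ ⊗[ℝ] LieAlg (EuclideanSpace ℝ (Fin n)) G)) [h.IsCartanSubalgebra]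
    (hconj : ∀ z ∈ h, conjC z ∈ h)
    (P : Set (h → ℂ)) (hP : IsPositiveSystem h P)
    (Ih : Module.End ℝ (realSubspace h))
    (hI : ∀ x, Ih (Ih x) = -x)
    (hIB : ∀ x y : realSubspace h, B (Ih x) (Ih y) = B x y) :
    IsIsotropicSplittingSubalgebra B (Lphi h P Ih) ∧
    IsIsotropicSplittingSubalgebra B (Lpsi h P Ih) ∧
    ∃ Jphi Jpsi : GenEndField (EuclideanSpace ℝ (Fin n)) G,
      (∀ J, IsInducedBy B (Lphi h P Ih) J ↔ J = Jphi) ∧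
      (∀ J, IsInducedBy B (Lpsi h P Ih) J ↔ J = Jpsi) ∧
      IsTwistedGeneralizedKahler (cartanThreeForm B) Jphi Jpsi :=
  mainTheorem3_general B hB h hconj P hP Ih hI hIB
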